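/- Let $n\ge 1$ and let $\Omega\subset\mathbb R^n$ be a bounded domain (nonempty, open, connected) with smooth boundary and outward unit normal $\nu$. Let $(I-\Delta)^{-1}$ be the inverse of $I-\Delta$ with homogeneous Neumann boundary condition: for $f\in L^2(\Omega)$, $w=(I-\Delta)^{-1}[f]\in H^1(\Omega)$ is the unique weak solution of $w-\Delta w=f$ in $\Omega$, $\partial_\nu w=0$ on $\partial\Omega$, i.e. $\int_\Omega(\nabla w\cdot\nabla\varphi+w\varphi)\,dx=\int_\Omega f\varphi\,dx$ for all $\varphi\in H^1(\Omega)$, evaluated pointwise in $\Omega$ through its continuous representative. Let $\mu\ge0$; let $\gamma\in C^3[0,\infty)$ with $\gamma>0$ and $\gamma'\le0$ on $(0,\infty)$; let $u_0\in C^0(\overline\Omega)$, $u_0\ge0$, $u_0\not\equiv0$; and let $0<T\le\infty$. Let $u,v\in C^0(\overline\Omega\times[0,T))\cap C^{2,1}(\overline\Omega\times(0,T))$ be a classical solution of $$u_t=\Delta(\gamma(v)u)+\mu u(1-u),\qquad -\Delta v+v=u\qquad\text{in }\Omega\times(0,T),$$ $$\partial_\nu u=\partial_\nu v=0\ \text{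 on }\partial\Omega\times(0,T),\qquad u(\cdot,0)=u_0$$ (for instance with $T=T_{\max}$, the maximal time of existence). Put $v_0=(I-\Delta)^{-1}[u_0]$. Then $v_0$ and, for every $t\in(0,T)$, the functions $(I-\Delta)^{-1}[u^2]$ and $(I-\Delta)^{-1}[\gamma(v)u+\mu u]$ at time $t$ have representatives continuous in $\Omega$, and the following hold. 1. For all $x\in\Omega$ and $0<t<T$, $$v_t+\gamma(v)u+\mu(I-\Delta)^{-1}[u^2]=(I-\Delta)^{-1}[\gamma(v)u+\mu u].$$ 2. For all $x\in\Omega$ and $0\le t<T$, the integral below exists and $$v(x,t)\le v_0(x)+\int_0^t(I-\Delta)^{-1}[\gamma(v)u+\mu u](x,s)\,ds.$$ 3. $v\ge 0$ in $\Omega\times[0,T)$. If $\mu=0$, then moreover $v\ge v_*$ in $\Omega\times[0,T)$ with a constant $v_*>0$ that depends only on $n$, $\Omega$ and $\|u_0\|_{L^1(\Omega)}$. 4. For every constant $v_*\ge0$ with $v\ge v_*$ in $\Omega\times(0,T)$ (in particular for $v_*=0$, and if $\mu=0$ for the positive $v_*$ of item 3), $$v(x,t)\le v_0(x)\,e^{(\gamma(v_*)+\mu)t}\qquad\text{for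 all }x\in\Omega,\ 0\le t<T.$$ 5. The diffusion does not degenerate in finite time: for every $\tau<\infty$ there is $\delta>0$ with $\gamma(v(x,t))\ge\delta$ for all $x\in\Omega$ and all $t\in[0,T)$ with $t\le\tau$. -/

import Mathlib

open Set Filter Topology MeasureTheory
open scoped ContDiff Laplacian

/-! Smooth bounded domains -/

/-- `ρ` is a smooth boundary defining function for `Ω` near the point `x`: near `x` the set `Ω` is
`{ρ < 0}`, and the gradient of `ρ` does not vanish at `x`. -/
def IsBoundaryDefining {n : ℕ} (Ω : Set (EuclideanSpace ℝ (Fin n)))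
    (x : EuclideanSpace ℝ (Fin n)) (ρ : EuclideanSpace ℝ (Fin n) → ℝ) : Prop :=
  ContDiff ℝ ∞ ρ ∧ gradient ρ x ≠ 0 ∧ ∀ᶠ y in 𝓝 x, (y ∈ Ω ↔ ρ y < 0)

/-- A bounded domain (nonempty connected open set) of `ℝⁿ` with smooth boundary. -/
structure IsSmoothBoundedDomain {n : ℕ} (Ω : Set (EuclideanSpace ℝ (Fin n))) : Prop where
  isOpen : IsOpen Ω
  isConnected : IsConnected Ω
  isBounded : Bornology.IsBounded Ω
  smooth_boundary : ∀ x ∈ frontier Ω, ∃ ρ, IsBoundaryDefining Ω x ρ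

/-- `ν` is the outward unit normal of `Ω` at the boundary point `x`. -/
def IsOuterNormal {n : ℕ} (Ω : Set (EuclideanSpace ℝ (Fin n)))
    (x ν : EuclideanSpace ℝ (Fin n)) : Prop :=
  ∃ ρ, IsBoundaryDefining Ω x ρ ∧ ν = ‖gradient ρ x‖⁻¹ • gradient ρ x

/-- The homogeneous Neumann condition `∂_ν f = 0` on `∂Ω`, for a function `f` which is `C¹` in `Ω`
and whose gradient extends continuously to the closure of `Ω`: the boundary value of `∇f · ν`
is the limit from inside `Ω`. -/
def NeumannBC {n : ℕ} (Ω : Set (EuclideanSpace ℝ (Fin n)))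
    (f : EuclideanSpace ℝ (Fin n) → ℝ) : Prop :=
  ∀ x ∈ frontier Ω, ∀ ν, IsOuterNormal Ω x ν →
    Tendsto (fun y => fderiv ℝ f y ν) (𝓝[Ω] x) (𝓝 0)

/-! The Neumann inverse of `I - Δ` -/

/-- `w ∈ H¹(Ω)` with weak gradient `G`. -/
structure MemH1 {n : ℕ} (Ω : Set (EuclideanSpace ℝ (Fin n)))
    (w : EuclideanSpace ℝ (Fin n) → ℝ)
    (G : EuclideanSpace ℝ (Fin n) → EuclideanSpace ℝ (Fin n)) : Prop where
  memLp : MemLp w 2 (volume.restrict Ω)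
  memLp_grad : MemLp G 2 (volume.restrict Ω)
  weak_grad : ∀ φ : EuclideanSpace ℝ (Fin n) → ℝ, ContDiff ℝ ∞ φ → HasCompactSupport φ →
    tsupport φ ⊆ Ω → ∀ e : EuclideanSpace ℝ (Fin n),
      ∫ x in Ω, w x * fderiv ℝ φ x e = - ∫ x in Ω, inner ℝ (G x) e * φ x

/-- `w ∈ H¹(Ω)` is the weak solution of the Neumann problem `w - Δw = f` in `Ω`, `∂_ν w = 0` on
`∂Ω`, with right-hand side `f ∈ L²(Ω)`. -/
def IsWeakNeumannSolution {n : ℕ} (Ω : Set (EuclideanSpace ℝ (Fin n)))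
    (f w : EuclideanSpace ℝ (Fin n) → ℝ) : Prop :=
  MemLp f 2 (volume.restrict Ω) ∧ ∃ G, MemH1 Ω w G ∧
    ∀ φ Φ, MemH1 Ω φ Φ →
      ∫ x in Ω, (inner ℝ (G x) (Φ x) + w x * φ x) = ∫ x in Ω, f x * φ x

/-- `w` is the representative, continuous in `Ω`, of `(I - Δ)⁻¹ f`. Since the weak solution is
unique as an element of `L²(Ω)`, this determines `w` at every point of the open set `Ω`. -/
def IsNeumannInv {n : ℕ} (Ω : Set (EuclideanSpace ℝ (Fin n)))
    (f w : EuclideanSpace ℝ (Fin n) → ℝ) : Prop :=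
  ContinuousOn w Ω ∧ IsWeakNeumannSolution Ω f w

open Classical in
/-- The function `(I - Δ)⁻¹ f` on `Ω`, where `Δ` is the Laplacian with homogeneous Neumann boundary
condition (with value `0` if there is no solution with a continuous representative). -/
noncomputable def neumannInv {n : ℕ} (Ω : Set (EuclideanSpace ℝ (Fin n)))
    (f : EuclideanSpace ℝ (Fin n) → ℝ) : EuclideanSpace ℝ (Fin n) → ℝ :=
  if h : ∃ w, IsNeumannInv Ω f w then h.choose else 0

/-! Classical solutions -/

/-- `f ∈ C^{2,1}(closure Ω × (0, T))`: `f` is `C²` in `x` and differentiable in `t` inside, and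
`f`, its first and second `x`-derivatives and its `t`-derivative are continuous up to the boundary
of `Ω`, that is, they extend continuously to `closure Ω × (0, T)`. -/
structure IsC21 {n : ℕ} (Ω : Set (EuclideanSpace ℝ (Fin n))) (T : EReal)
    (f : EuclideanSpace ℝ (Fin n) → ℝ → ℝ) : Prop where
  contDiffOn : ∀ t : ℝ, 0 < t → (t : EReal) < T → ContDiffOn ℝ 2 (fun x => f x t) Ω
  differentiableAt : ∀ x ∈ Ω, ∀ t : ℝ, 0 < t → (t : EReal) < T →
    DifferentiableAt ℝ (fun s => f x s) t
  continuousOn : ContinuousOn (fun p : EuclideanSpace ℝ (Fin n) × ℝ => f p.1 p.2)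
    (closure Ω ×ˢ {t : ℝ | 0 < t ∧ (t : EReal) < T})
  grad_ext : ∃ g : EuclideanSpace ℝ (Fin n) × ℝ → (EuclideanSpace ℝ (Fin n) →L[ℝ] ℝ),
    ContinuousOn g (closure Ω ×ˢ {t : ℝ | 0 < t ∧ (t : EReal) < T}) ∧
      ∀ x ∈ Ω, ∀ t : ℝ, 0 < t → (t : EReal) < T → g (x, t) = fderiv ℝ (fun y => f y t) x
  hess_ext : ∃ g : EuclideanSpace ℝ (Fin n) × ℝ →
      (EuclideanSpace ℝ (Fin n) →L[ℝ] EuclideanSpace ℝ (Fin n) →L[ℝ] ℝ),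
    ContinuousOn g (closure Ω ×ˢ {t : ℝ | 0 < t ∧ (t : EReal) < T}) ∧
      ∀ x ∈ Ω, ∀ t : ℝ, 0 < t → (t : EReal) < T →
        g (x, t) = fderiv ℝ (fderiv ℝ (fun y => f y t)) x
  time_ext : ∃ g : EuclideanSpace ℝ (Fin n) × ℝ → ℝ,
    ContinuousOn g (closure Ω ×ˢ {t : ℝ | 0 < t ∧ (t : EReal) < T}) ∧
      ∀ x ∈ Ω, ∀ t : ℝ, 0 < t → (t : EReal) < T → g (x, t) = deriv (fun s => f x s) t

/-- The assumption on the motility: `γ ∈ C³[0, ∞)`, `γ > 0` and `γ' ≤ 0` on `(0, ∞)`. Nothing is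
required of the values of `γ` on the negative half-line. -/
structure IsMotility (γ : ℝ → ℝ) : Prop where
  contDiffOn : ContDiffOn ℝ 3 γ (Ici 0)
  pos : ∀ s, 0 < s → 0 < γ s
  deriv_nonpos : ∀ s, 0 < s → deriv γ s ≤ 0

/-- Admissible initial data: continuous on the closure of `Ω`, nonnegative, not identically
zero. -/
structure IsInitialDatum {n : ℕ} (Ω : Set (EuclideanSpace ℝ (Fin n)))
    (u₀ : EuclideanSpace ℝ (Fin n) → ℝ) : Prop where
  continuousOn : ContinuousOn u₀ (closure Ω)
  nonneg : ∀ x ∈ closure Ω, 0 ≤ u₀ x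
  not_zero : ∃ x ∈ closure Ω, u₀ x ≠ 0

/-- `(u, v)` is a classical solution on `Ω × [0, T)`, `0 < T ≤ ∞`, of
`u_t = Δ(γ(v)u) + μu(1-u)`, `-Δv + v = u` in `Ω × (0, T)`, `∂_ν u = ∂_ν v = 0` on
`∂Ω × (0, T)`, `u(·, 0) = u₀`. -/
structure IsClassicalSolution {n : ℕ} (Ω : Set (EuclideanSpace ℝ (Fin n))) (γ : ℝ → ℝ) (μ : ℝ)
    (u₀ : EuclideanSpace ℝ (Fin n) → ℝ) (T : EReal)
    (u v : EuclideanSpace ℝ (Fin n) → ℝ → ℝ) : Prop where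
  continuousOn_u : ContinuousOn (fun p : EuclideanSpace ℝ (Fin n) × ℝ => u p.1 p.2)
    (closure Ω ×ˢ {t : ℝ | 0 ≤ t ∧ (t : EReal) < T})
  continuousOn_v : ContinuousOn (fun p : EuclideanSpace ℝ (Fin n) × ℝ => v p.1 p.2)
    (closure Ω ×ˢ {t : ℝ | 0 ≤ t ∧ (t : EReal) < T})
  regular_u : IsC21 Ω T u
  regular_v : IsC21 Ω T v
  eq_u : ∀ x ∈ Ω, ∀ t : ℝ, 0 < t → (t : EReal) < T →
    deriv (fun s => u x s) t
      = Δ (fun y => γ (v y t) * u y t) x + μ * u x t * (1 - u x t)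
  eq_v : ∀ x ∈ Ω, ∀ t : ℝ, 0 < t → (t : EReal) < T →
    - Δ (fun y => v y t) x + v x t = u x t
  neumann_u : ∀ t : ℝ, 0 < t → (t : EReal) < T → NeumannBC Ω (fun y => u y t)
  neumann_v : ∀ t : ℝ, 0 < t → (t : EReal) < T → NeumannBC Ω (fun y => v y t)
  initial : ∀ x ∈ closure Ω, u x 0 = u₀ x

/-!
The signal is `v(·, t) = (I - Δ)⁻¹ u(·, t)`, so that `v_t = (I - Δ)⁻¹ u_t`, while the first equation
reads `u_t + (w - Δw) + μ u² = w + μ u` with `w = γ(v) u`. Applying `(I - Δ)⁻¹` gives the key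
identity, because `(I - Δ)⁻¹ (w - Δw) = w` for a function `w` satisfying the Neumann condition.
Dropping nonnegative terms leaves `v_t ≤ (I - Δ)⁻¹[γ(v) u + μ u] ≤ (γ(v_*) + μ) v`, and the
upper bounds follow by integration in time. The work lies in the properties of the weak Neumann
problem, and in showing that `u ≥ 0` and that `v` stays away from zero: nothing is known about `γ`
on the negative half-line.

*The Neumann problem.* Weak solutions exist by orthogonal projection in `L² × L²`, and a chain rule
for `H¹` functions (`MemH1.comp`, by mollification) gives the maximum principle, by testing with
`smoothPosPart`. Averaging against explicit kernels on balls yields continuous representatives for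
bounded right-hand sides (`exists_isNeumannInv`) and a weak Harnack inequality
(`IsNeumannInv.meanAvg_le`).

*The boundary.* No traces are used. With a global defining function `ρ` of `Ω`, cutoffs `η(-k ρ)`
reduce Green's formula (`IsNeumannRegular.integral_inner`) to interior integration by parts: the
Neumann condition makes `∇ρ · ∇h = O(|ρ|)` (`IsDefiningFunction.exists_normal_le`), so the cutoff
error vanishes in the limit. In the same way `exp (-α ρ)` is a subsolution near the boundary, which
leads to the bound `(I - Δ)⁻¹ f ≥ c ∫ f` for `f ≥ 0` (`IsSmoothBoundedDomain.exists_mass_le`),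
with `c > 0` depending on the domain only. This is where the lower bound for `v` comes from.

*The solution.* While `v` is bounded below, the key identity bounds `v_t` down to `t = 0`, and
Gronwall's inequality for `∫ (u⁻)³ γ(v)²` shows `u ≥ 0`
(`IsClassicalSolution.nonneg_of_signal`). Then `∫ u` decays at most exponentially, and not at all if
`μ = 0`, and `v ≥ c ∫ u` reproduces the lower bound with a constant not depending on the one
assumed; a continuation argument finishes the proof (`IsClassicalSolution.le_signal`).
-/

open Metric
open scoped Convolution

variable {n : ℕ} {Ω : Set (EuclideanSpace ℝ (Fin n))}

local notation "𝔼" => EuclideanSpace ℝ (Fin n)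

/-! ### Mollification in `L¹` -/

/-- The standard bump functions at the origin with radii `1 / (2 (k + 1))` and `1 / (k + 1)`. -/
noncomputable def mollifier (n k : ℕ) : ContDiffBump (0 : EuclideanSpace ℝ (Fin n)) where
  rIn := 1 / (2 * ((k : ℝ) + 1))
  rOut := 1 / ((k : ℝ) + 1)
  rIn_pos := by positivity
  rIn_lt_rOut := by
    apply one_div_lt_one_div_of_lt <;> nlinarith [Nat.cast_nonneg (α := ℝ) k]

theorem tendsto_mollifier_rOut : Tendsto (fun k => (mollifier n k).rOut) atTop (𝓝 0) :=
  tendsto_one_div_add_atTop_nhds_zero_nat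

theorem ae_tendsto_mollifier_convolution {g : 𝔼 → ℝ} (hg : Integrable g) :
    ∀ᵐ x, Tendsto (fun k => ((mollifier n k).normed volume ⋆[ContinuousLinearMap.lsmul ℝ ℝ] g) x)
      atTop (𝓝 (g x)) :=
  ContDiffBump.ae_convolution_tendsto_right_of_locallyIntegrable (K := 2) tendsto_mollifier_rOut
    (Eventually.of_forall fun k => by
      change 1 / ((k : ℝ) + 1) ≤ 2 * (1 / (2 * ((k : ℝ) + 1)))
      apply le_of_eq
      field_simp) hg.locallyIntegrable

theorem integrable_mollifier_convolution {g : 𝔼 → ℝ} (hg : Integrable g) (k : ℕ) :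
    Integrable ((mollifier n k).normed volume ⋆[ContinuousLinearMap.lsmul ℝ ℝ] g) :=
  (mollifier n k).integrable_normed.integrable_convolution _ hg

/-- Scheffé's argument: almost everywhere convergence and equality of the integrals give
convergence in `L¹`. -/
theorem tendsto_integral_abs_mollifier_sub_of_nonneg {g : 𝔼 → ℝ} (hg : Integrable g)
    (h0 : ∀ x, 0 ≤ g x) :
    Tendsto (fun k => ∫ x,
      |((mollifier n k).normed volume ⋆[ContinuousLinearMap.lsmul ℝ ℝ] g) x - g x|)
      atTop (𝓝 0) := by
  set a : ℕ → 𝔼 → ℝ :=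
    fun k => (mollifier n k).normed volume ⋆[ContinuousLinearMap.lsmul ℝ ℝ] g with ha
  have hai : ∀ k, Integrable (a k) := integrable_mollifier_convolution hg
  have ha0 : ∀ k x, 0 ≤ a k x := fun k x => by
    simp only [ha, convolution_def]
    exact integral_nonneg fun t =>
      mul_nonneg ((mollifier n k).nonneg_normed t) (h0 _)
  have hint : ∀ k, ∫ x, a k x = ∫ x, g x := fun k => by
    simp only [ha]
    rw [integral_convolution _ (mollifier n k).integrable_normed hg,
      (mollifier n k).integral_normed]
    simp
  have hpos : ∀ k, Integrable (fun x => max (g x - a k x) 0) := fun k =>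
    (hg.sub (hai k)).pos_part
  have hab : ∀ k, ∫ x, |a k x - g x| = 2 * ∫ x, max (g x - a k x) 0 := fun k => by
    have : ∀ x, |a k x - g x| = (a k x - g x) + 2 * max (g x - a k x) 0 := fun x => by
      rcases le_total (a k x) (g x) with h | h
      · rw [abs_of_nonpos (by linarith), max_eq_left (by linarith)]; ring
      · rw [abs_of_nonneg (by linarith), max_eq_right (by linarith)]; ring
    simp_rw [this]
    rw [integral_add (f := fun x => a k x - g x) ((hai k).sub hg) ((hpos k).const_mul 2),
      integral_sub (hai k) hg, hint k, integral_const_mul]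
    simp
  have hlim : Tendsto (fun k => ∫ x, max (g x - a k x) 0) atTop (𝓝 (∫ _ : 𝔼, (0 : ℝ))) := by
    refine tendsto_integral_of_dominated_convergence g (fun k => (hpos k).aestronglyMeasurable) hg
      (fun k => Eventually.of_forall fun x => ?_) ?_
    · rw [Real.norm_eq_abs, abs_of_nonneg (le_max_right _ _)]
      exact max_le (by linarith [ha0 k x]) (h0 x)
    · filter_upwards [ae_tendsto_mollifier_convolution hg] with x hx
      have h1 : Tendsto (fun k => max (g x - a k x) 0) atTop (𝓝 (max (g x - g x) 0)) :=
        (tendsto_const_nhds.sub hx).max tendsto_const_nhds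
      simpa using h1
  have h2 := hlim.const_mul 2
  simp only [integral_zero, mul_zero] at h2
  exact h2.congr fun k => (hab k).symm

theorem tendsto_integral_abs_mollifier_sub {g : 𝔼 → ℝ} (hg : Integrable g) :
    Tendsto (fun k => ∫ x,
      |((mollifier n k).normed volume ⋆[ContinuousLinearMap.lsmul ℝ ℝ] g) x - g x|)
      atTop (𝓝 0) := by
  have hp : Integrable (fun x => max (g x) 0) := hg.pos_part
  have hn : Integrable (fun x => max (-g x) 0) := hg.neg_part
  have h := (tendsto_integral_abs_mollifier_sub_of_nonneg hp fun x => le_max_right _ _).add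
    (tendsto_integral_abs_mollifier_sub_of_nonneg hn fun x => le_max_right _ _)
  rw [add_zero] at h
  refine squeeze_zero (fun k => integral_nonneg fun x => abs_nonneg _) (fun k => ?_) h
  have hc : ∀ᵐ x, ((mollifier n k).normed volume ⋆[ContinuousLinearMap.lsmul ℝ ℝ] g) x
      = ((mollifier n k).normed volume ⋆[ContinuousLinearMap.lsmul ℝ ℝ] fun x => max (g x) 0) x
      - ((mollifier n k).normed volume ⋆[ContinuousLinearMap.lsmul ℝ ℝ]
          fun x => max (-g x) 0) x := by
    refine Eventually.of_forall fun x => ?_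
    have hex : ∀ {f : 𝔼 → ℝ}, Integrable f → Integrable (fun t =>
        (ContinuousLinearMap.lsmul ℝ ℝ) ((mollifier n k).normed volume t) (f (x - t))) :=
      fun hf => (mollifier n k).hasCompactSupport_normed.convolutionExists_left _
        (mollifier n k).continuous_normed hf.locallyIntegrable x
    rw [convolution_def, convolution_def, convolution_def, ← integral_sub (hex hp) (hex hn)]
    congr 1
    ext t
    rw [← map_sub]
    congr 1
    rcases le_total (g (x - t)) 0 with h | h
    · rw [max_eq_right h, max_eq_left (by linarith)]; ring
    · rw [max_eq_left h, max_eq_right (by linarith)]; ring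
  have hi : ∀ {f : 𝔼 → ℝ}, Integrable f → Integrable (fun x =>
      |((mollifier n k).normed volume ⋆[ContinuousLinearMap.lsmul ℝ ℝ] f) x - f x|) :=
    fun hf => ((integrable_mollifier_convolution hf k).sub hf).abs
  rw [← integral_add (hi hp) (hi hn)]
  refine integral_mono_ae (hi hg) ((hi hp).add (hi hn)) ?_
  filter_upwards [hc] with x hx
  rw [hx]
  have : g x = max (g x) 0 - max (-g x) 0 := by
    rcases le_total (g x) 0 with h | h
    · rw [max_eq_right h, max_eq_left (by linarith)]; ring
    · rw [max_eq_left h, max_eq_right (by linarith)]; ring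
  calc _ = |(((mollifier n k).normed volume ⋆[ContinuousLinearMap.lsmul ℝ ℝ]
          fun x => max (g x) 0) x - max (g x) 0)
        - (((mollifier n k).normed volume ⋆[ContinuousLinearMap.lsmul ℝ ℝ]
          fun x => max (-g x) 0) x - max (-g x) 0)| := by
        congr 1; linarith
    _ ≤ _ := abs_sub _ _

/-! ### The space `H¹(Ω)` -/

section H1

variable {w : EuclideanSpace ℝ (Fin n) → ℝ}
  {G : EuclideanSpace ℝ (Fin n) → EuclideanSpace ℝ (Fin n)}

/-- In the interior, the mollifications of an `H¹` function have as partial derivatives the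
mollifications of its weak partial derivatives. -/
theorem MemH1.fderiv_mollifier (hΩ : IsOpen Ω) (hfin : volume Ω ≠ ⊤) (h : MemH1 Ω w G) (k : ℕ)
    {x : 𝔼} (hx : closedBall x (mollifier n k).rOut ⊆ Ω) (e : 𝔼) :
    fderiv ℝ ((mollifier n k).normed volume ⋆[ContinuousLinearMap.lsmul ℝ ℝ] Ω.indicator w) x e
      = ((mollifier n k).normed volume ⋆[ContinuousLinearMap.lsmul ℝ ℝ]
          Ω.indicator (fun y => inner ℝ (G y) e)) x := by
  have : IsFiniteMeasure (volume.restrict Ω) := ⟨by simpa using hfin.lt_top⟩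
  have hwi : Integrable (Ω.indicator w) :=
    (integrable_indicator_iff hΩ.measurableSet).2 (h.memLp.integrable (by norm_num))
  set η := (mollifier n k).normed (volume : Measure 𝔼) with hη
  have hηc : ContDiff ℝ ∞ η := (mollifier n k).contDiff_normed
  have hηs : HasCompactSupport η := (mollifier n k).hasCompactSupport_normed
  rw [(hηs.hasFDerivAt_convolution_left (ContinuousLinearMap.lsmul ℝ ℝ) (hηc.of_le (by simp))
    hwi.locallyIntegrable x).fderiv]
  rw [convolution_eq_swap, convolution_eq_swap]
  have hex : Integrable (fun t =>
      ((ContinuousLinearMap.lsmul ℝ ℝ).precompL 𝔼 (fderiv ℝ η (x - t))) (Ω.indicator w t)) := by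
    have := (hηs.fderiv ℝ).convolutionExists_left
      ((ContinuousLinearMap.lsmul ℝ ℝ : ℝ →L[ℝ] ℝ →L[ℝ] ℝ).precompL 𝔼)
      (hηc.continuous_fderiv (by simp)) hwi.locallyIntegrable x
    exact convolutionExistsAt_iff_integrable_swap.1 this
  rw [ContinuousLinearMap.integral_apply hex]
  -- `ψ t = η (x - t)` is an admissible test function
  set ψ : 𝔼 → ℝ := fun t => η (x - t) with hψ
  have hψc : ContDiff ℝ ∞ ψ := hηc.comp (contDiff_const.sub contDiff_id)
  have hψt : tsupport ψ ⊆ closedBall x (mollifier n k).rOut := by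
    apply closure_minimal _ isClosed_closedBall
    intro t ht
    have : x - t ∈ Function.support η := ht
    rw [hη, (mollifier n k).support_normed_eq] at this
    rw [mem_closedBall, dist_comm, dist_eq_norm]
    exact (mem_ball_zero_iff.1 this).le
  have hψs : HasCompactSupport ψ :=
    (isCompact_closedBall x _).of_isClosed_subset (isClosed_tsupport _) hψt
  have hψd : ∀ t, fderiv ℝ ψ t e = - fderiv ℝ η (x - t) e := fun t => by
    have h1 : HasFDerivAt (fun t : 𝔼 => x - t) (-(ContinuousLinearMap.id ℝ 𝔼)) t := by
      simpa using (hasFDerivAt_id t).const_sub x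
    have h2 := ((hηc.differentiable (by simp)) (x - t)).hasFDerivAt.comp t h1
    change fderiv ℝ (η ∘ fun t => x - t) t e = _
    rw [h2.fderiv]
    simp
  have hw := h.weak_grad ψ hψc hψs (hψt.trans hx) e
  have e1 : ∫ t, ((ContinuousLinearMap.lsmul ℝ ℝ).precompL 𝔼 (fderiv ℝ η (x - t)))
      (Ω.indicator w t) e = ∫ t in Ω, - (w t * fderiv ℝ ψ t e) := by
    rw [← integral_indicator hΩ.measurableSet]
    congr 1
    ext t
    by_cases ht : t ∈ Ω
    · simp [ht, hψd, mul_comm]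
    · simp [ht]
  have e2 : ∫ t, (ContinuousLinearMap.lsmul ℝ ℝ) (η (x - t))
      (Ω.indicator (fun y => inner ℝ (G y) e) t) = ∫ t in Ω, inner ℝ (G t) e * ψ t := by
    rw [← integral_indicator hΩ.measurableSet]
    congr 1
    ext t
    by_cases ht : t ∈ Ω
    · simp [ht, hψ, mul_comm]
    · simp [ht]
  rw [e1, e2, integral_neg, hw, neg_neg]

/-- Local approximation of `H¹` functions by `C¹` functions, in `L¹` together with the
derivatives, and almost everywhere. -/
theorem MemH1.exists_approx (hΩ : IsOpen Ω) (hfin : volume Ω ≠ ⊤) (h : MemH1 Ω w G) {K : Set 𝔼}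
    (hK : IsCompact K) (hKΩ : K ⊆ Ω) :
    ∃ W : ℕ → 𝔼 → ℝ, (∀ k, ContDiff ℝ 1 (W k)) ∧
      (∀ᵐ x, x ∈ K → Tendsto (fun k => W k x) atTop (𝓝 (w x))) ∧
      Tendsto (fun k => ∫ x in K, |W k x - w x|) atTop (𝓝 0) ∧
      ∀ e, Tendsto (fun k => ∫ x in K, |fderiv ℝ (W k) x e - inner ℝ (G x) e|) atTop (𝓝 0) := by
  have : IsFiniteMeasure (volume.restrict Ω) := ⟨by simpa using hfin.lt_top⟩
  have hwi : Integrable (Ω.indicator w) :=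
    (integrable_indicator_iff hΩ.measurableSet).2 (h.memLp.integrable (by norm_num))
  have hGi : ∀ e : 𝔼, Integrable (Ω.indicator fun y => inner ℝ (G y) e) := fun e =>
    (integrable_indicator_iff hΩ.measurableSet).2
      ((h.memLp_grad.integrable (by norm_num)).inner_const e)
  refine ⟨fun k => (mollifier n k).normed volume ⋆[ContinuousLinearMap.lsmul ℝ ℝ] Ω.indicator w,
    fun k => ?_, ?_, ?_, fun e => ?_⟩
  · exact (mollifier n k).hasCompactSupport_normed.contDiff_convolution_left (n := 1) _
      ((mollifier n k).contDiff_normed) hwi.locallyIntegrable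
  · filter_upwards [ae_tendsto_mollifier_convolution hwi] with x hx hxK
    rwa [indicator_of_mem (hKΩ hxK)] at hx
  · refine squeeze_zero (fun k => integral_nonneg fun x => abs_nonneg _) (fun k => ?_)
      (tendsto_integral_abs_mollifier_sub hwi)
    have hi := ((integrable_mollifier_convolution hwi k).sub hwi).abs
    calc _ = ∫ x in K, |((mollifier n k).normed volume ⋆[ContinuousLinearMap.lsmul ℝ ℝ]
          Ω.indicator w) x - Ω.indicator w x| := by
          refine setIntegral_congr_fun hK.measurableSet fun x hx => ?_
          simp only [indicator_of_mem (hKΩ hx)]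
      _ ≤ _ := setIntegral_le_integral hi (Eventually.of_forall fun x => abs_nonneg _)
  · obtain ⟨δ, hδ, hδK⟩ := hK.exists_cthickening_subset_open hΩ hKΩ
    have hev : ∀ᶠ k in atTop, (mollifier n k).rOut < δ :=
      (tendsto_order.1 tendsto_mollifier_rOut).2 δ hδ
    refine squeeze_zero' (Eventually.of_forall fun k => integral_nonneg fun x => abs_nonneg _)
      (hev.mono fun k hk => ?_) (tendsto_integral_abs_mollifier_sub (hGi e))
    have hi := ((integrable_mollifier_convolution (hGi e) k).sub (hGi e)).abs
    calc _ = ∫ x in K, |((mollifier n k).normed volume ⋆[ContinuousLinearMap.lsmul ℝ ℝ]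
          Ω.indicator (fun y => inner ℝ (G y) e)) x
            - Ω.indicator (fun y => inner ℝ (G y) e) x| := by
          refine setIntegral_congr_fun hK.measurableSet fun x hx => ?_
          have hball : closedBall x (mollifier n k).rOut ⊆ Ω :=
            ((closedBall_subset_closedBall hk.le).trans
              (closedBall_subset_cthickening hx δ)).trans hδK
          simp only [h.fderiv_mollifier hΩ hfin k hball e]
          rw [indicator_of_mem (hKΩ hx)]
      _ ≤ _ := setIntegral_le_integral hi (Eventually.of_forall fun x => abs_nonneg _)

theorem tendsto_setIntegral_mul {K : Set 𝔼} (hK : MeasurableSet K) {a : ℕ → 𝔼 → ℝ} {a' : 𝔼 → ℝ}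
    {b : ℕ → 𝔼 → ℝ} {b' : 𝔼 → ℝ} {C : ℝ} (ha : ∀ k, IntegrableOn (a k) K)
    (ha' : IntegrableOn a' K) (hlim : Tendsto (fun k => ∫ x in K, |a k x - a' x|) atTop (𝓝 0))
    (hbm : ∀ k, AEStronglyMeasurable (b k) (volume.restrict K)) (hbC : ∀ k x, |b k x| ≤ C)
    (hb : ∀ᵐ x, x ∈ K → Tendsto (fun k => b k x) atTop (𝓝 (b' x))) :
    Tendsto (fun k => ∫ x in K, a k x * b k x) atTop (𝓝 (∫ x in K, a' x * b' x)) := by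
  have hi : ∀ {f : 𝔼 → ℝ} (k : ℕ), IntegrableOn f K → IntegrableOn (fun x => f x * b k x) K :=
    fun k hf => hf.mul_bdd (c := C) (hbm k) (Eventually.of_forall fun x => hbC k x)
  have h1 : Tendsto (fun k => ∫ x in K, (a k x - a' x) * b k x) atTop (𝓝 0) := by
    have h2 := hlim.const_mul C
    rw [mul_zero] at h2
    refine squeeze_zero_norm (fun k => ?_) h2
    rw [← integral_const_mul]
    refine norm_integral_le_of_norm_le (((ha k).sub ha').abs.const_mul C)
      (Eventually.of_forall fun x => ?_)
    rw [norm_mul, Real.norm_eq_abs, Real.norm_eq_abs, mul_comm]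
    exact mul_le_mul_of_nonneg_right (hbC k x) (abs_nonneg _)
  have h3 : Tendsto (fun k => ∫ x in K, a' x * b k x) atTop (𝓝 (∫ x in K, a' x * b' x)) := by
    refine tendsto_integral_of_dominated_convergence (fun x => |a' x| * C)
      (fun k => (hi k ha').aestronglyMeasurable) (ha'.abs.mul_const C)
      (fun k => Eventually.of_forall fun x => ?_) ?_
    · rw [norm_mul, Real.norm_eq_abs, Real.norm_eq_abs]
      exact mul_le_mul_of_nonneg_left (hbC k x) (abs_nonneg _)
    · filter_upwards [(ae_restrict_iff' hK).2 hb] with x hx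
      exact hx.const_mul _
  have h4 := h1.add h3
  rw [zero_add] at h4
  refine h4.congr fun k => ?_
  rw [← integral_add (f := fun x => (a k x - a' x) * b k x) (hi k ((ha k).sub ha')) (hi k ha')]
  congr 1
  ext x
  ring

theorem exists_bound_of_hasCompactSupport {F : Type*} [NormedAddCommGroup F] {φ : 𝔼 → F}
    (hφ : Continuous φ) (hs : HasCompactSupport φ) : ∃ C, ∀ x, ‖φ x‖ ≤ C :=
  hs.exists_bound_of_continuous hφ

/-- The integral of a function supported in `K ⊆ Ω`, over `Ω` and over `K`. -/
theorem setIntegral_eq_of_support {K : Set 𝔼} (hΩ : MeasurableSet Ω)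
    (hKΩ : K ⊆ Ω) {f : 𝔼 → ℝ} (hf : ∀ x, x ∉ K → f x = 0) :
    ∫ x in Ω, f x = ∫ x in K, f x :=
  setIntegral_eq_of_subset_of_forall_sdiff_eq_zero hΩ hKΩ fun x hx => hf x hx.2

theorem fderiv_apply_eq_zero_of_notMem_tsupport {φ : 𝔼 → ℝ} {x : 𝔼} (hx : x ∉ tsupport φ)
    (e : 𝔼) : fderiv ℝ φ x e = 0 := by
  rw [fderiv_of_notMem_tsupport (𝕜 := ℝ) hx]
  rfl

/-- Integration by parts of a function which is `C¹` in `Ω` against a compactly supported `C¹`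
function. -/
theorem setIntegral_mul_fderiv_of_contDiffOn (hΩ : IsOpen Ω) {h φ : 𝔼 → ℝ}
    (hh : ContDiffOn ℝ 1 h Ω) (hφ : ContDiff ℝ 1 φ) (hs : HasCompactSupport φ)
    (hsΩ : tsupport φ ⊆ Ω) (e : 𝔼) :
    ∫ x in Ω, h x * fderiv ℝ φ x e = - ∫ x in Ω, fderiv ℝ h x e * φ x := by
  have hφd : Continuous fun x => fderiv ℝ φ x e :=
    (hφ.continuous_fderiv one_ne_zero).clm_apply continuous_const
  have hhd : ContinuousOn (fun x => fderiv ℝ h x e) Ω :=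
    (hh.continuousOn_fderiv_of_isOpen hΩ le_rfl).clm_apply continuousOn_const
  have hφ0 : ∀ x, x ∉ tsupport φ → φ x = 0 := fun x hx => image_eq_zero_of_notMem_tsupport hx
  have hint : ∀ {f : 𝔼 → ℝ}, ContinuousOn f Ω → (∀ x, x ∉ tsupport φ → f x = 0) →
      Integrable f := fun {f} hf h0 => by
    rw [← integrableOn_iff_integrable_of_support_subset (s := tsupport φ)
      fun x hx => by by_contra hn; exact hx (h0 x hn)]
    exact (hf.mono hsΩ).integrableOn_compact hs
  rw [setIntegral_eq_integral_of_forall_compl_eq_zero fun x hx => by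
      rw [fderiv_apply_eq_zero_of_notMem_tsupport (fun hn => hx (hsΩ hn)), mul_zero],
    setIntegral_eq_integral_of_forall_compl_eq_zero fun x hx => by
      rw [hφ0 x (fun hn => hx (hsΩ hn)), mul_zero]]
  refine integral_mul_fderiv_eq_neg_fderiv_mul_of_integrable ?_ ?_ ?_ ?_ ?_
  · exact hint (hhd.mul hφ.continuous.continuousOn) fun x hx => by rw [hφ0 x hx, mul_zero]
  · exact hint (hh.continuousOn.mul hφd.continuousOn) fun x hx => by
      rw [fderiv_apply_eq_zero_of_notMem_tsupport hx, mul_zero]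
  · exact hint (hh.continuousOn.mul hφ.continuous.continuousOn) fun x hx => by
      rw [hφ0 x hx, mul_zero]
  · exact fun x hx => (hh.differentiableOn one_ne_zero).differentiableAt (hΩ.mem_nhds (hsΩ hx))
  · exact fun x _ => hφ.differentiable one_ne_zero x

theorem MemH1.integrableOn_inner (hfin : volume Ω ≠ ⊤) (h : MemH1 Ω w G) (e : 𝔼) :
    IntegrableOn (fun x => inner ℝ (G x) e) Ω := by
  have : IsFiniteMeasure (volume.restrict Ω) := ⟨by simpa using hfin.lt_top⟩
  exact (h.memLp_grad.integrable (by norm_num)).inner_const e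

theorem MemH1.integrableOn (hfin : volume Ω ≠ ⊤) (h : MemH1 Ω w G) : IntegrableOn w Ω := by
  have : IsFiniteMeasure (volume.restrict Ω) := ⟨by simpa using hfin.lt_top⟩
  exact h.memLp.integrable (by norm_num)

theorem integrableOn_fderiv_of_contDiff {W : 𝔼 → ℝ} (hW : ContDiff ℝ 1 W) {K : Set 𝔼}
    (hK : IsCompact K) (e : 𝔼) : IntegrableOn (fun x => fderiv ℝ W x e) K :=
  ((hW.continuous_fderiv one_ne_zero).clm_apply continuous_const).continuousOn.integrableOn_compact
    hK

/-- **Chain rule** in `H¹(Ω)` for `C¹` functions with bounded derivative, tested against compactly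
supported `C¹` functions. -/
theorem MemH1.comp_weak_grad (hΩ : IsOpen Ω) (hfin : volume Ω ≠ ⊤) (h : MemH1 Ω w G) {F : ℝ → ℝ}
    (hF : ContDiff ℝ 1 F) {C : ℝ} (hC : ∀ s, |deriv F s| ≤ C) {φ : 𝔼 → ℝ} (hφ : ContDiff ℝ 1 φ)
    (hs : HasCompactSupport φ) (hsΩ : tsupport φ ⊆ Ω) (e : 𝔼) :
    ∫ x in Ω, F (w x) * fderiv ℝ φ x e
      = - ∫ x in Ω, (deriv F (w x) * inner ℝ (G x) e) * φ x := by
  set K := tsupport φ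
  have hK : IsCompact K := hs
  have hKm : MeasurableSet K := hK.measurableSet
  have hC0 : 0 ≤ C := (abs_nonneg _).trans (hC 0)
  obtain ⟨W, hW, hWae, hW1, hWd⟩ := h.exists_approx hΩ hfin hK hsΩ
  have hφ0 : ∀ x, x ∉ K → φ x = 0 := fun x hx => image_eq_zero_of_notMem_tsupport hx
  have hφd0 : ∀ x, x ∉ K → fderiv ℝ φ x e = 0 := fun x hx =>
    fderiv_apply_eq_zero_of_notMem_tsupport hx e
  have hφd : Continuous fun x => fderiv ℝ φ x e :=
    (hφ.continuous_fderiv one_ne_zero).clm_apply continuous_const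
  have hF' : Continuous (deriv F) := hF.continuous_deriv le_rfl
  have hlip : ∀ s t, |F s - F t| ≤ C * |s - t| := fun s t =>
    convex_univ.norm_image_sub_le_of_norm_deriv_le
      (fun x _ => hF.differentiable one_ne_zero x) (fun x _ => hC x) (mem_univ t) (mem_univ s)
  obtain ⟨M, hM⟩ := exists_bound_of_hasCompactSupport hφ.continuous hs
  obtain ⟨M', hM'⟩ := exists_bound_of_hasCompactSupport (hφ.continuous_fderiv one_ne_zero)
    (hs.fderiv ℝ)
  have hwK : IntegrableOn w K := (h.integrableOn hfin).mono_set hsΩ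
  have hWi : ∀ k, IntegrableOn (W k) K := fun k =>
    (hW k).continuous.continuousOn.integrableOn_compact hK
  have hFWi : ∀ k, IntegrableOn (fun x => F (W k x)) K := fun k =>
    (hF.continuous.comp (hW k).continuous).continuousOn.integrableOn_compact hK
  have : IsFiniteMeasure (volume.restrict K) := ⟨by simpa using hK.measure_lt_top⟩
  have hFw : IntegrableOn (fun x => F (w x)) K := by
    refine Integrable.mono' (g := fun x => |F 0| + C * |w x|)
      ((integrable_const _).add (hwK.abs.const_mul C))
      (hF.continuous.comp_aestronglyMeasurable hwK.aestronglyMeasurable)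
      (Eventually.of_forall fun x => ?_)
    have h1 := hlip (w x) 0
    rw [sub_zero] at h1
    have h2 : |F (w x)| ≤ |F (w x) - F 0| + |F 0| := by
      simpa using abs_add_le (F (w x) - F 0) (F 0)
    rw [Real.norm_eq_abs]
    linarith
  have h1 : Tendsto (fun k => ∫ x in K, F (W k x) * fderiv ℝ φ x e) atTop
      (𝓝 (∫ x in K, F (w x) * fderiv ℝ φ x e)) := by
    refine tendsto_setIntegral_mul hKm (C := M' * ‖e‖) hFWi hFw ?_
      (fun k => hφd.aestronglyMeasurable) (fun k x => ?_)
      (Eventually.of_forall fun x _ => tendsto_const_nhds)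
    · have h2 := hW1.const_mul C
      rw [mul_zero] at h2
      refine squeeze_zero (fun k => integral_nonneg fun x => abs_nonneg _) (fun k => ?_) h2
      rw [← integral_const_mul]
      exact integral_mono ((hFWi k).sub hFw).abs (((hWi k).sub hwK).abs.const_mul C)
        fun x => hlip _ _
    · exact (ContinuousLinearMap.le_opNorm _ _).trans
        (mul_le_mul_of_nonneg_right (hM' x) (norm_nonneg _))
  have h2 : Tendsto (fun k => ∫ x in K, fderiv ℝ (W k) x e * (deriv F (W k x) * φ x)) atTop
      (𝓝 (∫ x in K, inner ℝ (G x) e * (deriv F (w x) * φ x))) := by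
    refine tendsto_setIntegral_mul hKm (C := C * M)
      (fun k => integrableOn_fderiv_of_contDiff (hW k) hK e)
      ((h.integrableOn_inner hfin e).mono_set hsΩ) (hWd e)
      (fun k => ((hF'.comp (hW k).continuous).mul hφ.continuous).aestronglyMeasurable)
      (fun k x => ?_) ?_
    · rw [abs_mul]
      exact mul_le_mul (hC _) (hM x) (abs_nonneg _) hC0
    · filter_upwards [hWae] with x hx hxK
      exact ((hF'.tendsto _).comp (hx hxK)).mul tendsto_const_nhds
  have h3 : ∀ k, ∫ x in K, F (W k x) * fderiv ℝ φ x e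
      = - ∫ x in K, fderiv ℝ (W k) x e * (deriv F (W k x) * φ x) := fun k => by
    have h4 := setIntegral_mul_fderiv_of_contDiffOn isOpen_univ
      ((hF.comp (hW k)).contDiffOn (s := univ)) hφ hs (subset_univ _) e
    rw [setIntegral_eq_of_support .univ (subset_univ K) fun x hx => by rw [hφd0 x hx, mul_zero],
      setIntegral_eq_of_support .univ (subset_univ K) fun x hx => by rw [hφ0 x hx, mul_zero]] at h4
    refine h4.trans ?_
    congr 2
    ext x
    have h5 : HasFDerivAt (F ∘ W k) (deriv F (W k x) • fderiv ℝ (W k) x) x :=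
      (hF.differentiable one_ne_zero _).hasDerivAt.comp_hasFDerivAt x
        ((hW k).differentiable one_ne_zero x).hasFDerivAt
    rw [h5.fderiv]
    simp only [smul_apply, smul_eq_mul]
    ring
  rw [setIntegral_eq_of_support hΩ.measurableSet hsΩ fun x hx => by rw [hφd0 x hx, mul_zero],
    setIntegral_eq_of_support hΩ.measurableSet hsΩ fun x hx => by rw [hφ0 x hx, mul_zero],
    tendsto_nhds_unique h1 (h2.neg.congr fun k => (h3 k).symm)]
  congr 2
  ext x
  ring

/-- The defining property of the weak gradient, for test functions which are only `C¹`. -/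
theorem MemH1.weak_grad_of_contDiff_one (hΩ : IsOpen Ω) (hfin : volume Ω ≠ ⊤) (h : MemH1 Ω w G)
    {φ : 𝔼 → ℝ} (hφ : ContDiff ℝ 1 φ) (hs : HasCompactSupport φ) (hsΩ : tsupport φ ⊆ Ω) (e : 𝔼) :
    ∫ x in Ω, w x * fderiv ℝ φ x e = - ∫ x in Ω, inner ℝ (G x) e * φ x := by
  simpa using h.comp_weak_grad hΩ hfin (F := id) contDiff_id (C := 1) (by simp) hφ hs hsΩ e

theorem MemH1.comp (hΩ : IsOpen Ω) (hfin : volume Ω ≠ ⊤) (h : MemH1 Ω w G) {F : ℝ → ℝ}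
    (hF : ContDiff ℝ 1 F) {C : ℝ} (hC : ∀ s, |deriv F s| ≤ C) :
    MemH1 Ω (fun x => F (w x)) (fun x => deriv F (w x) • G x) := by
  have : IsFiniteMeasure (volume.restrict Ω) := ⟨by simpa using hfin.lt_top⟩
  have hlip : ∀ s t, |F s - F t| ≤ C * |s - t| := fun s t =>
    convex_univ.norm_image_sub_le_of_norm_deriv_le
      (fun x _ => hF.differentiable one_ne_zero x) (fun x _ => hC x) (mem_univ t) (mem_univ s)
  refine ⟨?_, ?_, fun φ hφ hs hsΩ e => ?_⟩
  · have h1 : MemLp (fun x => F (w x) - F 0) 2 (volume.restrict Ω) := by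
      refine h.memLp.of_le_mul (c := C) ((hF.continuous.comp_aestronglyMeasurable
        h.memLp.aestronglyMeasurable).sub aestronglyMeasurable_const)
        (Eventually.of_forall fun x => ?_)
      simpa using hlip (w x) 0
    refine (h1.add (memLp_const (F 0))).ae_eq (Eventually.of_forall fun x => ?_)
    simp
  · refine h.memLp_grad.of_le_mul (c := C) (((hF.continuous_deriv le_rfl).comp_aestronglyMeasurable
      h.memLp.aestronglyMeasurable).smul h.memLp_grad.aestronglyMeasurable)
      (Eventually.of_forall fun x => ?_)
    rw [norm_smul]
    exact mul_le_mul_of_nonneg_right (hC _) (norm_nonneg _)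
  · rw [h.comp_weak_grad hΩ hfin hF hC (hφ.of_le (by simp)) hs hsΩ e]
    simp only [inner_smul_left, RCLike.conj_to_real]

/-- A function which is `C¹` in `Ω`, bounded and with bounded gradient, belongs to `H¹(Ω)`. -/
theorem memH1_of_contDiffOn (hΩ : IsOpen Ω) (hfin : volume Ω ≠ ⊤) {h : 𝔼 → ℝ}
    (hh : ContDiffOn ℝ 1 h Ω) {C C' : ℝ} (hC : ∀ x ∈ Ω, |h x| ≤ C)
    (hC' : ∀ x ∈ Ω, ‖fderiv ℝ h x‖ ≤ C') : MemH1 Ω h (gradient h) := by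
  have : IsFiniteMeasure (volume.restrict Ω) := ⟨by simpa using hfin.lt_top⟩
  have hgc : ContinuousOn (gradient h) Ω :=
    (InnerProductSpace.toDual ℝ 𝔼).symm.continuous.comp_continuousOn
      (hh.continuousOn_fderiv_of_isOpen hΩ le_rfl)
  refine ⟨?_, ?_, fun φ hφ hs hsΩ e => ?_⟩
  · exact MemLp.of_bound (hh.continuousOn.aestronglyMeasurable hΩ.measurableSet) C
      ((ae_restrict_iff' hΩ.measurableSet).2 (Eventually.of_forall fun x hx => hC x hx))
  · refine MemLp.of_bound (hgc.aestronglyMeasurable hΩ.measurableSet) C'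
      ((ae_restrict_iff' hΩ.measurableSet).2 (Eventually.of_forall fun x hx => ?_))
    rw [gradient, LinearIsometryEquiv.norm_map]
    exact hC' x hx
  · rw [setIntegral_mul_fderiv_of_contDiffOn hΩ hh (hφ.of_le (by simp)) hs hsΩ e]
    simp only [inner_gradient_left]

theorem memH1_const (hΩ : IsOpen Ω) (hfin : volume Ω ≠ ⊤) (c : ℝ) :
    MemH1 Ω (fun _ : 𝔼 => c) (fun _ => 0) := by
  have h := memH1_of_contDiffOn hΩ hfin (h := fun _ : 𝔼 => c) contDiffOn_const (C := |c|)
    (C' := 0) (fun _ _ => le_rfl) (by simp)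
  rwa [gradient_fun_const'] at h

theorem MemH1.linear_comb (hfin : volume Ω ≠ ⊤) {w₁ w₂ : 𝔼 → ℝ} {G₁ G₂ : 𝔼 → 𝔼}
    (h₁ : MemH1 Ω w₁ G₁) (h₂ : MemH1 Ω w₂ G₂) (a b : ℝ) :
    MemH1 Ω (fun x => a * w₁ x + b * w₂ x) (fun x => a • G₁ x + b • G₂ x) := by
  have : IsFiniteMeasure (volume.restrict Ω) := ⟨by simpa using hfin.lt_top⟩
  refine ⟨(h₁.memLp.const_mul a).add (h₂.memLp.const_mul b),
    (h₁.memLp_grad.const_smul a).add (h₂.memLp_grad.const_smul b), fun φ hφ hs hsΩ e => ?_⟩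
  have hφd : Continuous fun x => fderiv ℝ φ x e :=
    (hφ.continuous_fderiv (by simp)).clm_apply continuous_const
  obtain ⟨M, hM⟩ := exists_bound_of_hasCompactSupport hφ.continuous hs
  obtain ⟨M', hM'⟩ := exists_bound_of_hasCompactSupport hφd ((hs.fderiv_apply (𝕜 := ℝ) e))
  have i1 : ∀ {w : 𝔼 → ℝ} {G : 𝔼 → 𝔼}, MemH1 Ω w G →
      IntegrableOn (fun x => w x * fderiv ℝ φ x e) Ω := fun h =>
    (h.integrableOn hfin).mul_bdd (c := M') hφd.aestronglyMeasurable (Eventually.of_forall hM')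
  have i2 : ∀ {w : 𝔼 → ℝ} {G : 𝔼 → 𝔼}, MemH1 Ω w G →
      IntegrableOn (fun x => inner ℝ (G x) e * φ x) Ω := fun h =>
    (h.integrableOn_inner hfin e).mul_bdd (c := M) hφ.continuous.aestronglyMeasurable
      (Eventually.of_forall hM)
  have e1 := h₁.weak_grad φ hφ hs hsΩ e
  have e2 := h₂.weak_grad φ hφ hs hsΩ e
  calc _ = ∫ x in Ω, (a * (w₁ x * fderiv ℝ φ x e) + b * (w₂ x * fderiv ℝ φ x e)) := by
        congr 1; ext x; ring
    _ = a * (∫ x in Ω, w₁ x * fderiv ℝ φ x e) + b * ∫ x in Ω, w₂ x * fderiv ℝ φ x e := by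
        rw [integral_add ((i1 h₁).const_mul a) ((i1 h₂).const_mul b), integral_const_mul,
          integral_const_mul]
    _ = - (a * (∫ x in Ω, inner ℝ (G₁ x) e * φ x) + b * ∫ x in Ω, inner ℝ (G₂ x) e * φ x) := by
        rw [e1, e2]; ring
    _ = - ∫ x in Ω, (a * (inner ℝ (G₁ x) e * φ x) + b * (inner ℝ (G₂ x) e * φ x)) := by
        rw [integral_add ((i2 h₁).const_mul a) ((i2 h₂).const_mul b), integral_const_mul,
          integral_const_mul]
    _ = _ := by
        congr 2; ext x; rw [inner_add_left, inner_smul_left, inner_smul_left]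
        simp only [RCLike.conj_to_real]; ring

theorem MemH1.congr_ae {w₁ w₂ : 𝔼 → ℝ} {G₁ : 𝔼 → 𝔼} (h₁ : MemH1 Ω w₁ G₁)
    (hw : w₁ =ᵐ[volume.restrict Ω] w₂) : MemH1 Ω w₂ G₁ := by
  refine ⟨h₁.memLp.ae_eq hw, h₁.memLp_grad, fun φ hφ hs hsΩ e => ?_⟩
  rw [← h₁.weak_grad φ hφ hs hsΩ e]
  refine integral_congr_ae ?_
  filter_upwards [hw] with x hx
  rw [hx]

end H1

/-! ### Truncation functions -/

theorem hasDerivAt_max_zero_sq (s : ℝ) :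
    HasDerivAt (fun s : ℝ => max s 0 ^ 2) (2 * max s 0) s := by
  rcases lt_trichotomy s 0 with h | h | h
  · rw [max_eq_right h.le, mul_zero]
    refine (hasDerivAt_const s (0 : ℝ)).congr_of_eventuallyEq ?_
    filter_upwards [Iio_mem_nhds h] with t ht
    rw [max_eq_right (le_of_lt ht)]
    norm_num
  · subst h
    have h1 : (fun s : ℝ => max s 0 ^ 2) =O[𝓝 0] fun s => ‖s - 0‖ ^ 2 :=
      Asymptotics.IsBigO.of_bound 1 (Eventually.of_forall fun s => by
        rw [one_mul, sub_zero, norm_pow, norm_pow, norm_norm, Real.norm_eq_abs, Real.norm_eq_abs]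
        refine pow_le_pow_left₀ (abs_nonneg _) ?_ 2
        rw [abs_of_nonneg (le_max_right _ _)]
        exact max_le (le_abs_self s) (abs_nonneg s))
    have h2 := (h1.hasFDerivAt one_lt_two).hasDerivAt
    simpa using h2
  · rw [max_eq_left h.le]
    have h1 : HasDerivAt (fun s : ℝ => s ^ 2) (2 * s) s := by simpa using hasDerivAt_pow 2 s
    refine h1.congr_of_eventuallyEq ?_
    filter_upwards [Ioi_mem_nhds h] with t ht
    rw [max_eq_left (le_of_lt ht)]

/-- A nondecreasing `C¹` function of linear growth which vanishes exactly on the negative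
half-line: a substitute for the positive part to which the `C¹` chain rule applies. -/
noncomputable def smoothPosPart (s : ℝ) : ℝ := √(1 + max s 0 ^ 2) - 1

theorem hasDerivAt_smoothPosPart (s : ℝ) :
    HasDerivAt smoothPosPart (max s 0 / √(1 + max s 0 ^ 2)) s := by
  have h1 : HasDerivAt (fun s : ℝ => 1 + max s 0 ^ 2) (2 * max s 0) s :=
    (hasDerivAt_max_zero_sq s).const_add 1
  have h2 := (h1.sqrt (by positivity)).sub_const 1
  convert! h2 using 1
  rw [mul_div_mul_left _ _ two_ne_zero]

theorem deriv_smoothPosPart (s : ℝ) :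
    deriv smoothPosPart s = max s 0 / √(1 + max s 0 ^ 2) :=
  (hasDerivAt_smoothPosPart s).deriv

theorem contDiff_smoothPosPart : ContDiff ℝ 1 smoothPosPart := by
  rw [contDiff_one_iff_deriv]
  refine ⟨fun s => (hasDerivAt_smoothPosPart s).differentiableAt, ?_⟩
  rw [funext deriv_smoothPosPart]
  have hc : Continuous fun s : ℝ => max s 0 := continuous_id.max continuous_const
  exact hc.div (continuous_const.add (hc.pow 2)).sqrt fun s => by positivity

theorem deriv_smoothPosPart_nonneg (s : ℝ) : 0 ≤ deriv smoothPosPart s := by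
  rw [deriv_smoothPosPart]
  positivity

theorem abs_deriv_smoothPosPart_le (s : ℝ) : |deriv smoothPosPart s| ≤ 1 := by
  rw [abs_of_nonneg (deriv_smoothPosPart_nonneg s), deriv_smoothPosPart]
  exact div_le_one_of_le₀ (Real.le_sqrt_of_sq_le (by linarith)) (by positivity)

theorem smoothPosPart_of_nonpos {s : ℝ} (hs : s ≤ 0) : smoothPosPart s = 0 := by
  simp [smoothPosPart, max_eq_right hs]

theorem smoothPosPart_nonneg (s : ℝ) : 0 ≤ smoothPosPart s := by
  rw [smoothPosPart, sub_nonneg, Real.one_le_sqrt]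
  nlinarith [sq_nonneg (max s 0)]

theorem smoothPosPart_pos {s : ℝ} (hs : 0 < s) : 0 < smoothPosPart s := by
  rw [smoothPosPart, sub_pos, Real.lt_sqrt zero_le_one, max_eq_left hs.le]
  nlinarith

/-! ### Weak solutions of the Neumann problem -/

theorem isFiniteMeasure_restrict (hfin : volume Ω ≠ ⊤) :
    IsFiniteMeasure ((volume : Measure 𝔼).restrict Ω) := ⟨by simpa using hfin.lt_top⟩

theorem integrableOn_inner_of_memLp {f g : 𝔼 → 𝔼} (hf : MemLp f 2 (volume.restrict Ω))
    (hg : MemLp g 2 (volume.restrict Ω)) : IntegrableOn (fun x => inner ℝ (f x) (g x)) Ω := by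
  refine (L2.integrable_inner (𝕜 := ℝ) (hf.toLp f) (hg.toLp g)).congr ?_
  filter_upwards [hf.coeFn_toLp, hg.coeFn_toLp] with x h1 h2
  rw [h1, h2]

theorem integrableOn_mul_of_memLp {f g : 𝔼 → ℝ} (hf : MemLp f 2 (volume.restrict Ω))
    (hg : MemLp g 2 (volume.restrict Ω)) : IntegrableOn (fun x => f x * g x) Ω :=
  hf.integrable_mul hg

/-- The `L²` inner product of two pairs (function, vector field). -/
theorem inner_toLp_pair {f₁ f₂ : 𝔼 → ℝ} {g₁ g₂ : 𝔼 → 𝔼} (hf₁ : MemLp f₁ 2 (volume.restrict Ω))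
    (hf₂ : MemLp f₂ 2 (volume.restrict Ω)) (hg₁ : MemLp g₁ 2 (volume.restrict Ω))
    (hg₂ : MemLp g₂ 2 (volume.restrict Ω)) :
    inner ℝ (WithLp.toLp 2 (hf₁.toLp f₁, hg₁.toLp g₁)) (WithLp.toLp 2 (hf₂.toLp f₂, hg₂.toLp g₂))
      = (∫ x in Ω, f₁ x * f₂ x) + ∫ x in Ω, inner ℝ (g₁ x) (g₂ x) := by
  rw [WithLp.prod_inner_apply, L2.inner_def, L2.inner_def]
  congr 1
  · refine integral_congr_ae ?_
    filter_upwards [hf₁.coeFn_toLp, hf₂.coeFn_toLp] with x h1 h2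
    simp only [h1, h2, RCLike.inner_apply, RCLike.conj_to_real]
    ring
  · refine integral_congr_ae ?_
    filter_upwards [hg₁.coeFn_toLp, hg₂.coeFn_toLp] with x h1 h2
    simp only [h1, h2]

/-- Orthogonal projection onto the orthogonal complement of a set. -/
theorem exists_projection_of_orthogonal {H : Type*} [NormedAddCommGroup H] [InnerProductSpace ℝ H]
    [CompleteSpace H] (S : Set H) (p : H) :
    ∃ q, (∀ s ∈ S, inner ℝ s q = 0) ∧
      ∀ v, (∀ s ∈ S, inner ℝ s v = 0) → inner ℝ q v = inner ℝ p v := by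
  let V : Submodule ℝ H := (Submodule.span ℝ S)ᗮ
  refine ⟨V.orthogonalProjectionOnto p, fun s hs => ?_, fun v hv => ?_⟩
  · exact (Submodule.mem_orthogonal _ _).1 (V.orthogonalProjectionOnto p).2 _
      (Submodule.subset_span hs)
  · have hvV : v ∈ V := by
      refine (Submodule.mem_orthogonal _ _).2 fun s hs => ?_
      induction hs using Submodule.span_induction with
      | mem s hs => exact hv s hs
      | zero => exact inner_zero_left _
      | add a b _ _ ha hb => rw [inner_add_left, ha, hb, add_zero]
      | smul c a _ ha => rw [inner_smul_left, ha, mul_zero]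
    have h := Submodule.inner_orthogonalProjectionOnto_eq_of_mem_left (⟨v, hvV⟩ : V) p
    rw [real_inner_comm, real_inner_comm v]
    exact h

/-- Existence of weak solutions: `H¹(Ω)`, embedded in `L²(Ω; ℝ × ℝⁿ)` by `w ↦ (w, ∇w)`, is the
orthogonal complement of the pairs `(∂ₑφ, φ e)` with `φ` a test function, hence closed, and
`(w, ∇w)` is the orthogonal projection of `(f, 0)`. -/
theorem exists_isWeakNeumannSolution {f : 𝔼 → ℝ} (hf : MemLp f 2 (volume.restrict Ω)) :
    ∃ w, IsWeakNeumannSolution Ω f w := by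
  have hφe : ∀ {φ : 𝔼 → ℝ}, ContDiff ℝ ∞ φ → HasCompactSupport φ → ∀ e : 𝔼,
      MemLp (fun x => φ x • e) 2 (volume.restrict Ω) := fun h hs e =>
    ((h.continuous.smul continuous_const).memLp_of_hasCompactSupport hs.smul_right).restrict Ω
  have hφd : ∀ {φ : 𝔼 → ℝ}, ContDiff ℝ ∞ φ → HasCompactSupport φ → ∀ e : 𝔼,
      MemLp (fun x => fderiv ℝ φ x e) 2 (volume.restrict Ω) := fun h hs e =>
    (((h.continuous_fderiv (by simp)).clm_apply continuous_const).memLp_of_hasCompactSupport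
      (hs.fderiv_apply (𝕜 := ℝ) e)).restrict Ω
  let S : Set (WithLp 2 (Lp ℝ 2 ((volume : Measure 𝔼).restrict Ω) ×
      Lp 𝔼 2 ((volume : Measure 𝔼).restrict Ω))) :=
    {s | ∃ (φ : 𝔼 → ℝ) (h : ContDiff ℝ ∞ φ) (hs : HasCompactSupport φ) (_ : tsupport φ ⊆ Ω)
      (e : 𝔼), s = WithLp.toLp 2 ((hφd h hs e).toLp _, (hφe h hs e).toLp _)}
  have key : ∀ {w : 𝔼 → ℝ} {G : 𝔼 → 𝔼} (h1 : MemLp w 2 (volume.restrict Ω))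
      (h2 : MemLp G 2 (volume.restrict Ω)) {φ : 𝔼 → ℝ} (h : ContDiff ℝ ∞ φ)
      (hs : HasCompactSupport φ) (e : 𝔼),
      inner ℝ (WithLp.toLp 2 ((hφd h hs e).toLp _, (hφe h hs e).toLp _))
        (WithLp.toLp 2 (h1.toLp w, h2.toLp G))
      = (∫ x in Ω, w x * fderiv ℝ φ x e) + ∫ x in Ω, inner ℝ (G x) e * φ x := by
    intro w G h1 h2 φ h hs e
    rw [inner_toLp_pair]
    congr 1
    · congr 1; ext x; ring
    · congr 1; ext x; rw [inner_smul_left, real_inner_comm]; simp only [RCLike.conj_to_real]; ring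
  have h0 : MemLp (fun _ : 𝔼 => (0 : 𝔼)) 2 (volume.restrict Ω) := MemLp.zero'
  obtain ⟨q, hqS, hq⟩ := exists_projection_of_orthogonal S (WithLp.toLp 2 (hf.toLp f, h0.toLp _))
  have hwq := Lp.memLp q.fst
  have hGq := Lp.memLp q.snd
  have hq' : q = WithLp.toLp 2 (hwq.toLp _, hGq.toLp _) := by
    rw [Lp.toLp_coeFn, Lp.toLp_coeFn]
    rfl
  rw [hq'] at hqS hq
  refine ⟨_, hf, _, ⟨hwq, hGq, fun φ h hs hsΩ e => ?_⟩, fun φ Φ hφ => ?_⟩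
  · have h3 := hqS _ ⟨φ, h, hs, hsΩ, e, rfl⟩
    rw [key hwq hGq h hs] at h3
    linarith
  · have h1 := hq (WithLp.toLp 2 (hφ.memLp.toLp _, hφ.memLp_grad.toLp _)) (by
      rintro s ⟨ψ, h, hs, hsΩ, e, rfl⟩
      rw [key hφ.memLp hφ.memLp_grad h hs, hφ.weak_grad ψ h hs hsΩ e]
      ring)
    rw [inner_toLp_pair, inner_toLp_pair] at h1
    rw [integral_add (integrableOn_inner_of_memLp hGq hφ.memLp_grad)
      (integrableOn_mul_of_memLp hwq hφ.memLp)]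
    simp only [inner_zero_left, integral_zero, add_zero] at h1
    rw [← h1, add_comm]

theorem IsWeakNeumannSolution.linear_comb (hfin : volume Ω ≠ ⊤) {f₁ f₂ w₁ w₂ : 𝔼 → ℝ}
    (h₁ : IsWeakNeumannSolution Ω f₁ w₁) (h₂ : IsWeakNeumannSolution Ω f₂ w₂) (a b : ℝ) :
    IsWeakNeumannSolution Ω (fun x => a * f₁ x + b * f₂ x) (fun x => a * w₁ x + b * w₂ x) := by
  obtain ⟨hf₁, G₁, hG₁, e₁⟩ := h₁
  obtain ⟨hf₂, G₂, hG₂, e₂⟩ := h₂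
  refine ⟨(hf₁.const_mul a).add (hf₂.const_mul b), _, hG₁.linear_comb hfin hG₂ a b,
    fun φ Φ hφ => ?_⟩
  have i : ∀ {w : 𝔼 → ℝ} {G : 𝔼 → 𝔼}, MemH1 Ω w G →
      IntegrableOn (fun x => inner ℝ (G x) (Φ x) + w x * φ x) Ω := fun h =>
    (integrableOn_inner_of_memLp h.memLp_grad hφ.memLp_grad).add
      (integrableOn_mul_of_memLp h.memLp hφ.memLp)
  calc _ = ∫ x in Ω, (a * (inner ℝ (G₁ x) (Φ x) + w₁ x * φ x)
          + b * (inner ℝ (G₂ x) (Φ x) + w₂ x * φ x)) := by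
        congr 1; ext x
        rw [inner_add_left, inner_smul_left, inner_smul_left]
        simp only [RCLike.conj_to_real]; ring
    _ = a * (∫ x in Ω, f₁ x * φ x) + b * ∫ x in Ω, f₂ x * φ x := by
        rw [integral_add ((i hG₁).const_mul a) ((i hG₂).const_mul b), integral_const_mul,
          integral_const_mul, e₁ φ Φ hφ, e₂ φ Φ hφ]
    _ = ∫ x in Ω, (a * (f₁ x * φ x) + b * (f₂ x * φ x)) := by
        rw [integral_add ((integrableOn_mul_of_memLp hf₁ hφ.memLp).const_mul a)
          ((integrableOn_mul_of_memLp hf₂ hφ.memLp).const_mul b), integral_const_mul,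
          integral_const_mul]
    _ = _ := by congr 1; ext x; ring

theorem IsWeakNeumannSolution.congr_ae {f₁ f₂ w₁ w₂ : 𝔼 → ℝ}
    (h : IsWeakNeumannSolution Ω f₁ w₁) (hf : f₁ =ᵐ[volume.restrict Ω] f₂)
    (hw : w₁ =ᵐ[volume.restrict Ω] w₂) : IsWeakNeumannSolution Ω f₂ w₂ := by
  obtain ⟨hf₁, G, hG, e⟩ := h
  refine ⟨hf₁.ae_eq hf, G, hG.congr_ae hw, fun φ Φ hφ => ?_⟩
  have h1 : ∫ x in Ω, (inner ℝ (G x) (Φ x) + w₂ x * φ x)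
      = ∫ x in Ω, (inner ℝ (G x) (Φ x) + w₁ x * φ x) :=
    integral_congr_ae (by filter_upwards [hw] with x hx; rw [hx])
  have h2 : ∫ x in Ω, f₂ x * φ x = ∫ x in Ω, f₁ x * φ x :=
    integral_congr_ae (by filter_upwards [hf] with x hx; rw [hx])
  rw [h1, h2, e φ Φ hφ]

theorem isWeakNeumannSolution_const (hΩ : IsOpen Ω) (hfin : volume Ω ≠ ⊤) (c : ℝ) :
    IsWeakNeumannSolution Ω (fun _ : 𝔼 => c) (fun _ => c) := by
  have := isFiniteMeasure_restrict hfin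
  refine ⟨memLp_const c, _, memH1_const hΩ hfin c, fun φ Φ _ => ?_⟩
  simp

/-- Energy form of the maximum principle: the quadratic form of `I - Δ`, evaluated at
`(w, F(w))` with `F = smoothPosPart`, controls the positive part of `w`. -/
theorem MemH1.nonpos_of_energy_le {w : 𝔼 → ℝ} {G : 𝔼 → 𝔼} (hΩ : IsOpen Ω) (hfin : volume Ω ≠ ⊤)
    (h : MemH1 Ω w G)
    (hle : ∫ x in Ω, (inner ℝ (G x) (deriv smoothPosPart (w x) • G x)
      + w x * smoothPosPart (w x)) ≤ 0) : ∀ᵐ x ∂(volume.restrict Ω), w x ≤ 0 := by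
  have hF := h.comp hΩ hfin contDiff_smoothPosPart abs_deriv_smoothPosPart_le
  have hi : IntegrableOn (fun x => inner ℝ (G x) (deriv smoothPosPart (w x) • G x)
      + w x * smoothPosPart (w x)) Ω :=
    (integrableOn_inner_of_memLp h.memLp_grad hF.memLp_grad).add
      (integrableOn_mul_of_memLp h.memLp hF.memLp)
  have h1 : ∀ x, 0 ≤ inner ℝ (G x) (deriv smoothPosPart (w x) • G x) := fun x => by
    rw [inner_smul_right]
    exact mul_nonneg (deriv_smoothPosPart_nonneg _) real_inner_self_nonneg
  have h2 : ∀ x, 0 ≤ w x * smoothPosPart (w x) := fun x => by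
    rcases le_or_gt (w x) 0 with h | h
    · rw [smoothPosPart_of_nonpos h, mul_zero]
    · exact mul_nonneg h.le (smoothPosPart_nonneg _)
  have h3 : 0 ≤ fun x => inner ℝ (G x) (deriv smoothPosPart (w x) • G x)
      + w x * smoothPosPart (w x) := fun x => add_nonneg (h1 x) (h2 x)
  have h4 := (integral_eq_zero_iff_of_nonneg h3 hi).1 (le_antisymm hle (integral_nonneg h3))
  filter_upwards [h4] with x hx
  by_contra hn
  push Not at hn
  have h5 : 0 < w x * smoothPosPart (w x) := mul_pos hn (smoothPosPart_pos hn)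
  have h6 : inner ℝ (G x) (deriv smoothPosPart (w x) • G x)
      + w x * smoothPosPart (w x) = 0 := hx
  linarith [h1 x]

/-- **Weak maximum principle** for the Neumann problem. -/
theorem IsWeakNeumannSolution.nonpos (hΩ : IsOpen Ω) (hfin : volume Ω ≠ ⊤) {f w : 𝔼 → ℝ}
    (h : IsWeakNeumannSolution Ω f w) (hf : ∀ᵐ x ∂(volume.restrict Ω), f x ≤ 0) :
    ∀ᵐ x ∂(volume.restrict Ω), w x ≤ 0 := by
  obtain ⟨hf2, G, hG, e⟩ := h
  refine hG.nonpos_of_energy_le hΩ hfin ?_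
  rw [e _ _ (hG.comp hΩ hfin contDiff_smoothPosPart abs_deriv_smoothPosPart_le)]
  refine integral_nonpos_of_ae ?_
  filter_upwards [hf] with x hx
  exact mul_nonpos_of_nonpos_of_nonneg hx (smoothPosPart_nonneg _)

theorem IsWeakNeumannSolution.mono (hΩ : IsOpen Ω) (hfin : volume Ω ≠ ⊤) {f₁ f₂ w₁ w₂ : 𝔼 → ℝ}
    (h₁ : IsWeakNeumannSolution Ω f₁ w₁) (h₂ : IsWeakNeumannSolution Ω f₂ w₂)
    (hf : ∀ᵐ x ∂(volume.restrict Ω), f₁ x ≤ f₂ x) :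
    ∀ᵐ x ∂(volume.restrict Ω), w₁ x ≤ w₂ x := by
  have h := (h₁.linear_comb hfin h₂ 1 (-1)).nonpos hΩ hfin (by
    filter_upwards [hf] with x hx
    linarith)
  filter_upwards [h] with x hx
  linarith

theorem IsWeakNeumannSolution.abs_le (hΩ : IsOpen Ω) (hfin : volume Ω ≠ ⊤) {f w : 𝔼 → ℝ} {M : ℝ}
    (h : IsWeakNeumannSolution Ω f w) (hf : ∀ᵐ x ∂(volume.restrict Ω), |f x| ≤ M) :
    ∀ᵐ x ∂(volume.restrict Ω), |w x| ≤ M := by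
  have h1 := h.mono hΩ hfin (isWeakNeumannSolution_const hΩ hfin M) (by
    filter_upwards [hf] with x hx using (_root_.abs_le.1 hx).2)
  have h2 := (isWeakNeumannSolution_const hΩ hfin (-M)).mono hΩ hfin h (by
    filter_upwards [hf] with x hx using (_root_.abs_le.1 hx).1)
  filter_upwards [h1, h2] with x hx hx' using _root_.abs_le.2 ⟨hx', hx⟩

/-- `(I - Δ)⁻¹` is symmetric. -/
theorem IsWeakNeumannSolution.integral_mul_comm {f₁ f₂ w₁ w₂ : 𝔼 → ℝ}
    (h₁ : IsWeakNeumannSolution Ω f₁ w₁) (h₂ : IsWeakNeumannSolution Ω f₂ w₂) :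
    ∫ x in Ω, f₁ x * w₂ x = ∫ x in Ω, f₂ x * w₁ x := by
  obtain ⟨_, G₁, hG₁, e₁⟩ := h₁
  obtain ⟨_, G₂, hG₂, e₂⟩ := h₂
  rw [← e₁ _ _ hG₂, ← e₂ _ _ hG₁]
  congr 1
  ext x
  rw [real_inner_comm, mul_comm]

theorem IsWeakNeumannSolution.integral_eq (hΩ : IsOpen Ω) (hfin : volume Ω ≠ ⊤) {f w : 𝔼 → ℝ}
    (h : IsWeakNeumannSolution Ω f w) : ∫ x in Ω, w x = ∫ x in Ω, f x := by
  have := h.integral_mul_comm (isWeakNeumannSolution_const hΩ hfin 1)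
  simpa using this.symm

/-! ### The continuous representative -/

theorem forall_nonneg_of_ae (hΩ : IsOpen Ω) {w : 𝔼 → ℝ} (hc : ContinuousOn w Ω)
    (h : ∀ᵐ x ∂(volume.restrict Ω), 0 ≤ w x) : ∀ x ∈ Ω, 0 ≤ w x := by
  have hopen : IsOpen (Ω ∩ w ⁻¹' Iio 0) := hc.isOpen_inter_preimage hΩ isOpen_Iio
  have hzero : volume (Ω ∩ w ⁻¹' Iio 0) = 0 := by
    rw [ae_restrict_iff' hΩ.measurableSet] at h
    refine measure_mono_null (fun x hx => ?_) h
    simp only [mem_compl_iff, mem_ofPred_eq, Classical.not_imp, not_le]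
    exact hx
  have hempty := hopen.measure_eq_zero_iff _ |>.1 hzero
  intro x hx
  by_contra hn
  push Not at hn
  exact (hempty ▸ (⟨hx, hn⟩ : x ∈ Ω ∩ w ⁻¹' Iio 0) : x ∈ (∅ : Set 𝔼))

theorem forall_le_of_ae (hΩ : IsOpen Ω) {w₁ w₂ : 𝔼 → ℝ} (h₁ : ContinuousOn w₁ Ω)
    (h₂ : ContinuousOn w₂ Ω) (h : ∀ᵐ x ∂(volume.restrict Ω), w₁ x ≤ w₂ x) :
    ∀ x ∈ Ω, w₁ x ≤ w₂ x := fun x hx =>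
  sub_nonneg.1 (forall_nonneg_of_ae hΩ (h₂.sub h₁)
    (by filter_upwards [h] with y hy using sub_nonneg.2 hy) x hx)

theorem IsNeumannInv.mono (hΩ : IsOpen Ω) (hfin : volume Ω ≠ ⊤) {f₁ f₂ w₁ w₂ : 𝔼 → ℝ}
    (h₁ : IsNeumannInv Ω f₁ w₁) (h₂ : IsNeumannInv Ω f₂ w₂) (hf : ∀ x ∈ Ω, f₁ x ≤ f₂ x) :
    ∀ x ∈ Ω, w₁ x ≤ w₂ x :=
  forall_le_of_ae hΩ h₁.1 h₂.1 (h₁.2.mono hΩ hfin h₂.2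
    ((ae_restrict_iff' hΩ.measurableSet).2 (Eventually.of_forall hf)))

theorem IsNeumannInv.linear_comb (hfin : volume Ω ≠ ⊤) {f₁ f₂ w₁ w₂ : 𝔼 → ℝ}
    (h₁ : IsNeumannInv Ω f₁ w₁) (h₂ : IsNeumannInv Ω f₂ w₂) (a b : ℝ) :
    IsNeumannInv Ω (fun x => a * f₁ x + b * f₂ x) (fun x => a * w₁ x + b * w₂ x) :=
  ⟨(continuousOn_const.mul h₁.1).add (continuousOn_const.mul h₂.1), h₁.2.linear_comb hfin h₂.2 a b⟩

theorem isNeumannInv_const (hΩ : IsOpen Ω) (hfin : volume Ω ≠ ⊤) (c : ℝ) :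
    IsNeumannInv Ω (fun _ : 𝔼 => c) (fun _ => c) :=
  ⟨continuousOn_const, isWeakNeumannSolution_const hΩ hfin c⟩

theorem IsNeumannInv.congr (hΩ : IsOpen Ω) {f₁ f₂ w₁ w₂ : 𝔼 → ℝ} (h : IsNeumannInv Ω f₁ w₁)
    (hf : EqOn f₁ f₂ Ω) (hw : EqOn w₁ w₂ Ω) : IsNeumannInv Ω f₂ w₂ :=
  ⟨h.1.congr hw.symm, h.2.congr_ae
    ((ae_restrict_iff' hΩ.measurableSet).2 (Eventually.of_forall hf))
    ((ae_restrict_iff' hΩ.measurableSet).2 (Eventually.of_forall hw))⟩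

theorem IsNeumannInv.unique (hΩ : IsOpen Ω) (hfin : volume Ω ≠ ⊤) {f w₁ w₂ : 𝔼 → ℝ}
    (h₁ : IsNeumannInv Ω f w₁) (h₂ : IsNeumannInv Ω f w₂) : EqOn w₁ w₂ Ω := fun x hx =>
  le_antisymm (h₁.mono hΩ hfin h₂ (fun _ _ => le_rfl) x hx)
    (h₂.mono hΩ hfin h₁ (fun _ _ => le_rfl) x hx)

theorem IsNeumannInv.isNeumannInv_neumannInv {f w : 𝔼 → ℝ} (h : IsNeumannInv Ω f w) :
    IsNeumannInv Ω f (neumannInv Ω f) := by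
  have hex : ∃ w, IsNeumannInv Ω f w := ⟨w, h⟩
  rw [neumannInv, dif_pos hex]
  exact hex.choose_spec

theorem IsNeumannInv.neumannInv_eqOn (hΩ : IsOpen Ω) (hfin : volume Ω ≠ ⊤) {f w : 𝔼 → ℝ}
    (h : IsNeumannInv Ω f w) : EqOn (neumannInv Ω f) w Ω :=
  h.isNeumannInv_neumannInv.unique hΩ hfin h

theorem IsNeumannInv.nonneg (hΩ : IsOpen Ω) (hfin : volume Ω ≠ ⊤) {f w : 𝔼 → ℝ}
    (h : IsNeumannInv Ω f w) (hf : ∀ x ∈ Ω, 0 ≤ f x) : ∀ x ∈ Ω, 0 ≤ w x :=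
  (isNeumannInv_const hΩ hfin 0).mono hΩ hfin h hf

theorem IsNeumannInv.abs_le (hΩ : IsOpen Ω) (hfin : volume Ω ≠ ⊤) {f w : 𝔼 → ℝ} {M : ℝ}
    (h : IsNeumannInv Ω f w) (hf : ∀ x ∈ Ω, |f x| ≤ M) : ∀ x ∈ Ω, |w x| ≤ M := fun x hx =>
  _root_.abs_le.2 ⟨(isNeumannInv_const hΩ hfin (-M)).mono hΩ hfin h
      (fun y hy => (_root_.abs_le.1 (hf y hy)).1) x hx,
    h.mono hΩ hfin (isNeumannInv_const hΩ hfin M) (fun y hy => (_root_.abs_le.1 (hf y hy)).2) x hx⟩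

/-! ### A family of compactly supported averaging kernels -/

/-- The smooth profile `s ↦ exp (-1 / (1 - s))`, extended by zero to `s ≥ 1`. -/
noncomputable def bumpProfile (s : ℝ) : ℝ := expNegInvGlue (1 - s)

theorem contDiff_bumpProfile : ContDiff ℝ ∞ bumpProfile :=
  expNegInvGlue.contDiff.comp (contDiff_const.sub contDiff_id)

theorem bumpProfile_nonneg (s : ℝ) : 0 ≤ bumpProfile s := expNegInvGlue.nonneg _

theorem bumpProfile_of_one_le {s : ℝ} (hs : 1 ≤ s) : bumpProfile s = 0 :=
  expNegInvGlue.zero_of_nonpos (by linarith)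

theorem bumpProfile_pos {s : ℝ} (hs : s < 1) : 0 < bumpProfile s :=
  expNegInvGlue.pos_of_pos (by linarith)

theorem deriv_bumpProfile_of_one_le {s : ℝ} (hs : 1 ≤ s) : deriv bumpProfile s = 0 :=
  IsLocalMin.deriv_eq_zero (Eventually.of_forall fun t => by
    rw [bumpProfile_of_one_le hs]
    exact bumpProfile_nonneg t)

theorem deriv_bumpProfile_of_lt_one {s : ℝ} (hs : s < 1) :
    deriv bumpProfile s = - bumpProfile s / (1 - s) ^ 2 := by
  have h0 : (1 - s) ≠ 0 := by linarith
  have h1 : HasDerivAt (fun s : ℝ => 1 - s) (-1) s := by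
    simpa using (hasDerivAt_id s).const_sub 1
  have h2 : HasDerivAt (fun s : ℝ => Real.exp (-(1 - s)⁻¹))
      (Real.exp (-(1 - s)⁻¹) * -(- -1 / (1 - s) ^ 2)) s := ((h1.inv h0).neg).exp
  have h3 : bumpProfile =ᶠ[𝓝 s] fun s => Real.exp (-(1 - s)⁻¹) := by
    filter_upwards [Iio_mem_nhds hs] with t ht
    rw [bumpProfile, expNegInvGlue, if_neg (by rw [not_le, sub_pos]; exact ht)]
  rw [h3.deriv_eq, h3.self_of_nhds]
  refine h2.deriv.trans ?_
  ring

theorem deriv_bumpProfile_nonpos (s : ℝ) : deriv bumpProfile s ≤ 0 := by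
  rcases lt_or_ge s 1 with h | h
  · rw [deriv_bumpProfile_of_lt_one h]
    exact div_nonpos_of_nonpos_of_nonneg (neg_nonpos.2 (bumpProfile_nonneg s)) (sq_nonneg _)
  · exact (deriv_bumpProfile_of_one_le h).le

/-- This differential inequality allows for the zeroth order term in the weak Harnack
inequality. -/
theorem bumpProfile_le_neg_deriv {s : ℝ} (h0 : 0 ≤ s) : bumpProfile s ≤ - deriv bumpProfile s := by
  rcases lt_or_ge s 1 with h | h
  · rw [deriv_bumpProfile_of_lt_one h, neg_div, neg_neg, le_div_iff₀ (by nlinarith)]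
    have := bumpProfile_nonneg s
    have h1 : (1 - s) ^ 2 ≤ 1 := by nlinarith
    nlinarith
  · rw [deriv_bumpProfile_of_one_le h, bumpProfile_of_one_le h, neg_zero]

theorem deriv_bumpProfile_neg {s : ℝ} (hs : s < 1) : deriv bumpProfile s < 0 := by
  rw [deriv_bumpProfile_of_lt_one hs, neg_div, neg_lt_zero]
  have : 0 < 1 - s := by linarith
  have := bumpProfile_pos hs
  positivity

theorem contDiff_deriv_bumpProfile : ContDiff ℝ ∞ (deriv bumpProfile) :=
  (contDiff_infty_iff_deriv.1 contDiff_bumpProfile).2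

theorem hasDerivAt_bumpProfile (s : ℝ) : HasDerivAt bumpProfile (deriv bumpProfile s) s :=
  (contDiff_bumpProfile.differentiable (by simp) s).hasDerivAt

theorem hasDerivAt_deriv_bumpProfile (s : ℝ) :
    HasDerivAt (deriv bumpProfile) (deriv (deriv bumpProfile) s) s :=
  (contDiff_deriv_bumpProfile.differentiable (by simp) s).hasDerivAt

theorem deriv_deriv_bumpProfile_of_one_le {s : ℝ} (hs : 1 ≤ s) :
    deriv (deriv bumpProfile) s = 0 :=
  IsLocalMax.deriv_eq_zero (Eventually.of_forall fun t => by
    rw [deriv_bumpProfile_of_one_le hs]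
    exact deriv_bumpProfile_nonpos t)

theorem continuous_deriv_deriv_bumpProfile : Continuous (deriv (deriv bumpProfile)) :=
  contDiff_deriv_bumpProfile.continuous_deriv (by simp)

theorem exists_bound_bumpProfile (n : ℕ) : ∃ B, 0 < B ∧ ∀ s, 0 ≤ s → bumpProfile s ≤ B ∧
    |2 * deriv bumpProfile s| ≤ B ∧
    |4 * s * deriv (deriv bumpProfile) s + 2 * n * deriv bumpProfile s| ≤ B := by
  have hc1 : Continuous fun s => bumpProfile s := contDiff_bumpProfile.continuous
  have hc2 : Continuous fun s => |2 * deriv bumpProfile s| :=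
    (contDiff_deriv_bumpProfile.continuous.const_mul 2).abs
  have hc3 : Continuous fun s : ℝ =>
      |4 * s * deriv (deriv bumpProfile) s + 2 * n * deriv bumpProfile s| :=
    (((continuous_const.mul continuous_id).mul continuous_deriv_deriv_bumpProfile).add
      (contDiff_deriv_bumpProfile.continuous.const_mul _)).abs
  obtain ⟨B1, hB1⟩ := (isCompact_Icc (a := (0 : ℝ)) (b := 1)).exists_bound_of_continuousOn
    hc1.continuousOn
  obtain ⟨B2, hB2⟩ := (isCompact_Icc (a := (0 : ℝ)) (b := 1)).exists_bound_of_continuousOn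
    hc2.continuousOn
  obtain ⟨B3, hB3⟩ := (isCompact_Icc (a := (0 : ℝ)) (b := 1)).exists_bound_of_continuousOn
    hc3.continuousOn
  refine ⟨max 1 (max B1 (max B2 B3)), by positivity, fun s hs => ?_⟩
  have m1 : B1 ≤ max 1 (max B1 (max B2 B3)) := by simp
  have m2 : B2 ≤ max 1 (max B1 (max B2 B3)) := by simp
  have m3 : B3 ≤ max 1 (max B1 (max B2 B3)) := by simp
  rcases le_or_gt s 1 with h | h
  · have b1 := hB1 s ⟨hs, h⟩
    have b2 := hB2 s ⟨hs, h⟩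
    have b3 := hB3 s ⟨hs, h⟩
    rw [Real.norm_eq_abs] at b1 b2 b3
    rw [abs_abs] at b2 b3
    exact ⟨(le_abs_self _).trans (b1.trans m1), b2.trans m2, b3.trans m3⟩
  · rw [deriv_deriv_bumpProfile_of_one_le h.le, deriv_bumpProfile_of_one_le h.le,
      bumpProfile_of_one_le h.le]
    simp

/-- The rescaled bump `r⁻ⁿ F(|z|² / r²)`, where `F` is `bumpProfile`. -/
noncomputable def ballKernel (r : ℝ) (z : 𝔼) : ℝ := (r ^ n)⁻¹ * bumpProfile (‖z‖ ^ 2 / r ^ 2)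

/-- The averaging kernel `ψᵣ(z) = -2 r⁻ⁿ F'(|z|² / r²)`; its total mass does not depend on `r`. -/
noncomputable def meanKernel (r : ℝ) (z : 𝔼) : ℝ :=
  -((r ^ n)⁻¹ * (2 * deriv bumpProfile (‖z‖ ^ 2 / r ^ 2)))

/-- The Laplacian of `ballKernel r`. -/
noncomputable def ballKernelLap (r : ℝ) (z : 𝔼) : ℝ :=
  (r ^ n)⁻¹ * ((4 * (‖z‖ ^ 2 / r ^ 2) * deriv (deriv bumpProfile) (‖z‖ ^ 2 / r ^ 2)
    + 2 * n * deriv bumpProfile (‖z‖ ^ 2 / r ^ 2)) / r ^ 2)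

theorem ballKernel_nonneg {r : ℝ} (hr : 0 < r) (z : 𝔼) : 0 ≤ ballKernel r z :=
  mul_nonneg (by positivity) (bumpProfile_nonneg _)

theorem meanKernel_nonneg {r : ℝ} (hr : 0 < r) (z : 𝔼) : 0 ≤ meanKernel r z := by
  rw [meanKernel, ← mul_neg]
  exact mul_nonneg (by positivity) (by linarith [deriv_bumpProfile_nonpos (‖z‖ ^ 2 / r ^ 2)])

theorem ballKernel_le_meanKernel {r : ℝ} (hr : 0 < r) (z : 𝔼) :
    2 * ballKernel r z ≤ meanKernel r z := by
  have h := bumpProfile_le_neg_deriv (s := ‖z‖ ^ 2 / r ^ 2) (by positivity)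
  have h1 : 0 < (r ^ n)⁻¹ := by positivity
  rw [meanKernel, ballKernel]
  nlinarith

theorem one_le_sq_div {r : ℝ} (hr : 0 < r) {z : 𝔼} (hz : r ≤ ‖z‖) : 1 ≤ ‖z‖ ^ 2 / r ^ 2 := by
  rw [le_div_iff₀ (by positivity), one_mul]
  exact pow_le_pow_left₀ hr.le hz 2

theorem sq_div_lt_one {r : ℝ} (hr : 0 < r) {z : 𝔼} (hz : ‖z‖ < r) : ‖z‖ ^ 2 / r ^ 2 < 1 := by
  rw [div_lt_one (by positivity)]
  exact pow_lt_pow_left₀ hz (norm_nonneg _) two_ne_zero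

theorem ballKernel_eq_zero {r : ℝ} (hr : 0 < r) {z : 𝔼} (hz : r ≤ ‖z‖) : ballKernel r z = 0 := by
  rw [ballKernel, bumpProfile_of_one_le (one_le_sq_div hr hz), mul_zero]

theorem meanKernel_eq_zero {r : ℝ} (hr : 0 < r) {z : 𝔼} (hz : r ≤ ‖z‖) : meanKernel r z = 0 := by
  rw [meanKernel, deriv_bumpProfile_of_one_le (one_le_sq_div hr hz)]
  simp

theorem meanKernel_pos {r : ℝ} (hr : 0 < r) {z : 𝔼} (hz : ‖z‖ < r) : 0 < meanKernel r z := by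
  rw [meanKernel, ← mul_neg]
  have h := deriv_bumpProfile_neg (sq_div_lt_one hr hz)
  exact mul_pos (by positivity) (by linarith)

theorem contDiff_norm_sq_div (r : ℝ) : ContDiff ℝ ∞ fun z : 𝔼 => ‖z‖ ^ 2 / r ^ 2 :=
  (contDiff_norm_sq ℝ).div_const _

theorem contDiff_ballKernel (r : ℝ) : ContDiff ℝ ∞ (ballKernel r : 𝔼 → ℝ) :=
  contDiff_const.mul (contDiff_bumpProfile.comp (contDiff_norm_sq_div r))

theorem continuous_meanKernel (r : ℝ) : Continuous (meanKernel r : 𝔼 → ℝ) :=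
  (continuous_const.mul ((contDiff_deriv_bumpProfile.continuous.comp
    (contDiff_norm_sq_div r).continuous).const_mul 2)).neg

theorem continuous_ballKernelLap (r : ℝ) : Continuous (ballKernelLap r : 𝔼 → ℝ) := by
  have h := (contDiff_norm_sq_div (n := n) r).continuous
  exact continuous_const.mul ((((h.const_mul 4).mul
    (continuous_deriv_deriv_bumpProfile.comp h)).add
    ((contDiff_deriv_bumpProfile.continuous.comp h).const_mul _)).div_const _)

/-- The averaging kernels evolve by `∂ᵣ ψᵣ = r Δ Φᵣ`. -/
theorem hasDerivAt_meanKernel {r : ℝ} (hr : 0 < r) (z : 𝔼) :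
    HasDerivAt (fun r => meanKernel r z) (r * ballKernelLap r z) r := by
  have hr0 : r ≠ 0 := hr.ne'
  have h1 : HasDerivAt (fun r : ℝ => (r ^ n)⁻¹) (-(n * r ^ (n - 1)) / (r ^ n) ^ 2) r :=
    (hasDerivAt_pow n r).inv (pow_ne_zero n hr0)
  have h2 : HasDerivAt (fun r : ℝ => ‖z‖ ^ 2 / r ^ 2) (-(‖z‖ ^ 2 * (2 * r)) / (r ^ 2) ^ 2) r := by
    have hp : HasDerivAt (fun r : ℝ => r ^ 2) (2 * r) r := by simpa using hasDerivAt_pow 2 r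
    have hq : HasDerivAt (fun r : ℝ => ‖z‖ ^ 2 / r ^ 2)
        ((0 * r ^ 2 - ‖z‖ ^ 2 * (2 * r)) / (r ^ 2) ^ 2) r :=
      (hasDerivAt_const r (‖z‖ ^ 2)).div hp (pow_ne_zero 2 hr0)
    simpa using hq
  have h3 := (hasDerivAt_deriv_bumpProfile (‖z‖ ^ 2 / r ^ 2)).comp r h2
  have h4 := (h1.mul (h3.const_mul 2)).neg
  convert! h4 using 1
  rw [ballKernelLap]
  simp only [Function.comp]
  have hpow : (n : ℝ) * r ^ (n - 1) = n * r ^ n / r := by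
    rcases n with _ | m
    · simp
    · rw [Nat.add_sub_cancel, pow_succ]; field_simp
  rw [hpow]
  have : r ^ n ≠ 0 := pow_ne_zero n hr0
  field_simp
  ring

theorem fderiv_ballKernel {r : ℝ} (x y e : 𝔼) :
    fderiv ℝ (fun y => ballKernel r (y - x)) y e
      = (r ^ n)⁻¹
        * (deriv bumpProfile (‖y - x‖ ^ 2 / r ^ 2) * (2 * inner ℝ (y - x) e / r ^ 2)) := by
  have h1 : HasFDerivAt (fun y : 𝔼 => ‖y - x‖ ^ 2) (2 • (innerSL ℝ (y - x))) y := by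
    simpa using ((hasFDerivAt_id y).sub_const x).norm_sq
  have h2 : HasFDerivAt (fun y : 𝔼 => ‖y - x‖ ^ 2 / r ^ 2)
      ((r ^ 2)⁻¹ • (2 • (innerSL ℝ (y - x)))) y := by
    simpa only [div_eq_mul_inv] using h1.mul_const (r ^ 2)⁻¹
  have h3 := ((hasDerivAt_bumpProfile (‖y - x‖ ^ 2 / r ^ 2)).comp_hasFDerivAt y h2).const_mul
    (r ^ n)⁻¹
  have h4 : HasFDerivAt (fun y => ballKernel r (y - x)) _ y := h3
  rw [h4.fderiv]
  simp only [smul_apply, smul_eq_mul, innerSL_apply_apply, nsmul_eq_mul, Nat.cast_ofNat]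
  ring

theorem sum_fderiv_fderiv_ballKernel {r : ℝ} (hr : 0 < r) (x y : 𝔼) :
    ∑ i, fderiv ℝ (fun y => fderiv ℝ (fun y => ballKernel r (y - x)) y
      (EuclideanSpace.basisFun (Fin n) ℝ i)) y (EuclideanSpace.basisFun (Fin n) ℝ i)
      = ballKernelLap r (y - x) := by
  have key : ∀ e : 𝔼, ‖e‖ = 1 → fderiv ℝ (fun y => fderiv ℝ (fun y => ballKernel r (y - x)) y e) y e
      = (r ^ n)⁻¹ * (deriv (deriv bumpProfile) (‖y - x‖ ^ 2 / r ^ 2)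
          * (4 * inner ℝ (y - x) e ^ 2 / r ^ 4)
        + deriv bumpProfile (‖y - x‖ ^ 2 / r ^ 2) * (2 / r ^ 2)) := by
    intro e he
    simp_rw [fderiv_ballKernel]
    have h1 : HasFDerivAt (fun y : 𝔼 => ‖y - x‖ ^ 2) (2 • (innerSL ℝ (y - x))) y := by
      simpa using ((hasFDerivAt_id y).sub_const x).norm_sq
    have h2 : HasFDerivAt (fun y : 𝔼 => ‖y - x‖ ^ 2 / r ^ 2)
        ((r ^ 2)⁻¹ • (2 • (innerSL ℝ (y - x)))) y := by
      simpa only [div_eq_mul_inv] using h1.mul_const (r ^ 2)⁻¹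
    have h3 := (hasDerivAt_deriv_bumpProfile (‖y - x‖ ^ 2 / r ^ 2)).comp_hasFDerivAt y h2
    have h4 : HasFDerivAt (fun y : 𝔼 => 2 * inner ℝ (y - x) e / r ^ 2)
        ((r ^ 2)⁻¹ • (2 : ℝ) • innerSL ℝ e) y := by
      have h5 : HasFDerivAt (fun y : 𝔼 => inner ℝ (y - x) e) (innerSL ℝ e) y := by
        have h6 := (innerSL ℝ e).hasFDerivAt.comp y ((hasFDerivAt_id y).sub_const x)
        refine (h6.congr_of_eventuallyEq (Eventually.of_forall fun y => ?_)).congr_fderiv ?_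
        · simp [real_inner_comm]
        · ext; simp
      simpa only [div_eq_mul_inv] using (h5.const_mul 2).mul_const (r ^ 2)⁻¹
    have h7 := (h3.mul h4).const_mul (r ^ n)⁻¹
    have h8 : HasFDerivAt (fun y : 𝔼 => (r ^ n)⁻¹ * (deriv bumpProfile (‖y - x‖ ^ 2 / r ^ 2)
      * (2 * inner ℝ (y - x) e / r ^ 2))) _ y := h7
    rw [h8.fderiv]
    simp only [smul_apply, add_apply, smul_eq_mul, innerSL_apply_apply, nsmul_eq_mul,
      Nat.cast_ofNat, real_inner_self_eq_norm_sq, he, Function.comp]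
    field_simp
    ring
  have hsum : ∑ i, inner ℝ (y - x) (EuclideanSpace.basisFun (Fin n) ℝ i) ^ 2 = ‖y - x‖ ^ 2 :=
    (EuclideanSpace.basisFun (Fin n) ℝ).sum_sq_inner_left (y - x)
  have hr0 : r ≠ 0 := hr.ne'
  rw [Finset.sum_congr rfl fun i _ => key _ ((EuclideanSpace.basisFun (Fin n) ℝ).norm_eq_one i),
    ← Finset.mul_sum, Finset.sum_add_distrib, ← Finset.mul_sum, ← Finset.sum_div,
    ← Finset.mul_sum, hsum, ballKernelLap]
  simp only [Finset.sum_const, Finset.card_univ, Fintype.card_fin, nsmul_eq_mul]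
  field_simp

theorem hasCompactSupport_ballKernel_sub {r : ℝ} (hr : 0 < r) (x : 𝔼) :
    tsupport (fun y => ballKernel r (y - x)) ⊆ closedBall x r := by
  refine closure_minimal (fun y hy => ?_) isClosed_closedBall
  by_contra hn
  rw [mem_closedBall, dist_eq_norm, not_le] at hn
  exact hy (ballKernel_eq_zero hr hn.le)

theorem hasCompactSupport_meanKernel {r : ℝ} (hr : 0 < r) :
    HasCompactSupport (meanKernel r : 𝔼 → ℝ) :=
  HasCompactSupport.intro (isCompact_closedBall (0 : 𝔼) r) fun z hz => by
    rw [mem_closedBall_zero_iff, not_le] at hz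
    exact meanKernel_eq_zero hr hz.le

theorem integrable_meanKernel {r : ℝ} (hr : 0 < r) : Integrable (meanKernel r : 𝔼 → ℝ) :=
  (continuous_meanKernel r).integrable_of_hasCompactSupport (hasCompactSupport_meanKernel hr)

/-- The common mass of the kernels `meanKernel r`. -/
noncomputable def meanKernelMass (n : ℕ) : ℝ :=
  ∫ z : EuclideanSpace ℝ (Fin n), meanKernel 1 z

theorem meanKernelMass_pos : 0 < meanKernelMass n := by
  refine (continuous_meanKernel 1).integral_pos_of_hasCompactSupport_nonneg_nonzero
    (hasCompactSupport_meanKernel one_pos) (fun z => meanKernel_nonneg one_pos z) (x := 0) ?_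
  exact (meanKernel_pos one_pos (by simp)).ne'

theorem integral_meanKernel {r : ℝ} (hr : 0 < r) :
    ∫ z : 𝔼, meanKernel r z = meanKernelMass n := by
  have h1 : ∀ z : 𝔼, meanKernel r z = (r ^ n)⁻¹ * meanKernel 1 (r⁻¹ • z) := fun z => by
    rw [meanKernel, meanKernel, norm_smul, norm_inv, Real.norm_of_nonneg hr.le]
    have : (r⁻¹ * ‖z‖) ^ 2 / 1 ^ 2 = ‖z‖ ^ 2 / r ^ 2 := by field_simp
    rw [this]
    ring
  simp_rw [h1]
  rw [integral_const_mul, Measure.integral_comp_inv_smul_of_nonneg _ _ hr.le,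
    finrank_euclideanSpace_fin, smul_eq_mul, inv_mul_cancel_left₀ (by positivity)]
  rfl

theorem integral_meanKernel_sub {r : ℝ} (hr : 0 < r) (x : 𝔼) :
    ∫ y : 𝔼, meanKernel r (y - x) = meanKernelMass n := by
  rw [integral_sub_right_eq_self (fun z : 𝔼 => meanKernel r z), integral_meanKernel hr]

/-- Averages of `w`, restricted to `Ω`, against the kernels `meanKernel r`. -/
noncomputable def meanAvg (Ω : Set (EuclideanSpace ℝ (Fin n)))
    (w : EuclideanSpace ℝ (Fin n) → ℝ) (r : ℝ) (x : EuclideanSpace ℝ (Fin n)) : ℝ :=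
  ∫ y in Ω, w y * meanKernel r (y - x)

theorem exists_bound_kernels (n : ℕ) : ∃ B, 0 < B ∧ ∀ r, 0 < r → ∀ z : EuclideanSpace ℝ (Fin n),
    ballKernel r z ≤ (r ^ n)⁻¹ * B ∧ |meanKernel r z| ≤ (r ^ n)⁻¹ * B ∧
    |ballKernelLap r z| ≤ (r ^ n)⁻¹ * (B / r ^ 2) := by
  obtain ⟨B, hB0, hB⟩ := exists_bound_bumpProfile n
  refine ⟨B, hB0, fun r hr z => ?_⟩
  obtain ⟨h1, h2, h3⟩ := hB (‖z‖ ^ 2 / r ^ 2) (by positivity)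
  have hrn : 0 < (r ^ n)⁻¹ := by positivity
  refine ⟨mul_le_mul_of_nonneg_left h1 hrn.le, ?_, ?_⟩
  · rw [meanKernel, abs_neg, abs_mul, abs_of_pos hrn]
    exact mul_le_mul_of_nonneg_left h2 hrn.le
  · rw [ballKernelLap, abs_mul, abs_of_pos hrn, abs_div, abs_of_pos (pow_pos hr 2)]
    gcongr

theorem integrableOn_mul_meanKernel {w : 𝔼 → ℝ} (hw : IntegrableOn w Ω) {r : ℝ} (hr : 0 < r)
    (x : 𝔼) : IntegrableOn (fun y => w y * meanKernel r (y - x)) Ω := by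
  obtain ⟨B, _, hB⟩ := exists_bound_kernels n
  exact hw.mul_bdd (c := (r ^ n)⁻¹ * B) ((continuous_meanKernel r).comp
    (continuous_id.sub continuous_const)).aestronglyMeasurable
    (Eventually.of_forall fun y => (hB r hr _).2.1)

theorem integrableOn_mul_ballKernel {w : 𝔼 → ℝ} (hw : IntegrableOn w Ω) {r : ℝ} (hr : 0 < r)
    (x : 𝔼) : IntegrableOn (fun y => w y * ballKernel r (y - x)) Ω := by
  obtain ⟨B, _, hB⟩ := exists_bound_kernels n
  refine hw.mul_bdd (c := (r ^ n)⁻¹ * B) ((contDiff_ballKernel r).continuous.comp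
    (continuous_id.sub continuous_const)).aestronglyMeasurable
    (Eventually.of_forall fun y => ?_)
  rw [Real.norm_of_nonneg (ballKernel_nonneg hr _)]
  exact (hB r hr _).1

theorem continuous_meanAvg {w : 𝔼 → ℝ} (hw : IntegrableOn w Ω) {r : ℝ} (hr : 0 < r) :
    Continuous (meanAvg Ω w r) := by
  obtain ⟨B, _, hB⟩ := exists_bound_kernels n
  refine continuous_of_dominated (bound := fun y => |w y| * ((r ^ n)⁻¹ * B))
    (fun x => (integrableOn_mul_meanKernel hw hr x).aestronglyMeasurable)
    (fun x => Eventually.of_forall fun y => ?_) (hw.abs.mul_const _)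
    (Eventually.of_forall fun y => ?_)
  · rw [norm_mul, Real.norm_eq_abs]
    exact mul_le_mul_of_nonneg_left (hB r hr _).2.1 (abs_nonneg _)
  · exact continuous_const.mul ((continuous_meanKernel r).comp
      (continuous_const.sub continuous_id))

theorem hasDerivAt_meanAvg {w : 𝔼 → ℝ} (hw : IntegrableOn w Ω) {r : ℝ} (hr : 0 < r) (x : 𝔼) :
    HasDerivAt (fun r => meanAvg Ω w r x) (∫ y in Ω, w y * (r * ballKernelLap r (y - x))) r := by
  obtain ⟨B, hB0, hB⟩ := exists_bound_kernels n
  have hs : Ioo (r / 2) (2 * r) ∈ 𝓝 r := Ioo_mem_nhds (by linarith) (by linarith)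
  have hpos : ∀ t ∈ Ioo (r / 2) (2 * r), 0 < t := fun t ht => by
    have := ht.1; linarith
  refine (hasDerivAt_integral_of_dominated_loc_of_deriv_le
    (F := fun r y => w y * meanKernel r (y - x))
    (F' := fun r y => w y * (r * ballKernelLap r (y - x)))
    (bound := fun y => |w y| * (2 * r * (((r / 2) ^ n)⁻¹ * (B / (r / 2) ^ 2)))) hs
    ?_ (integrableOn_mul_meanKernel hw hr x) ?_ (Eventually.of_forall fun y t ht => ?_)
    (hw.abs.mul_const _) (Eventually.of_forall fun y t ht => ?_)).2
  · filter_upwards [hs] with t ht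
    exact (integrableOn_mul_meanKernel hw (hpos t ht) x).aestronglyMeasurable
  · exact hw.aestronglyMeasurable.mul (((continuous_ballKernelLap r).comp
      (continuous_id.sub continuous_const)).const_mul r).aestronglyMeasurable
  · rw [norm_mul, Real.norm_eq_abs, norm_mul, Real.norm_of_nonneg (hpos t ht).le, Real.norm_eq_abs]
    refine mul_le_mul_of_nonneg_left ?_ (abs_nonneg _)
    have h1 := ht.1
    have h2 := ht.2
    have h3 := hpos t ht
    have h4 : |ballKernelLap t (y - x)| ≤ ((r / 2) ^ n)⁻¹ * (B / (r / 2) ^ 2) := by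
      refine ((hB t h3 _).2.2).trans ?_
      gcongr
    exact mul_le_mul h2.le h4 (abs_nonneg _) (by positivity)
  · exact (hasDerivAt_meanKernel (hpos t ht) (y - x)).const_mul (w y)

theorem memH1_of_contDiff_hasCompactSupport (hΩ : IsOpen Ω) (hfin : volume Ω ≠ ⊤) {φ : 𝔼 → ℝ}
    (hφ : ContDiff ℝ 1 φ) (hs : HasCompactSupport φ) : MemH1 Ω φ (gradient φ) := by
  obtain ⟨M, hM⟩ := exists_bound_of_hasCompactSupport hφ.continuous hs
  obtain ⟨M', hM'⟩ := exists_bound_of_hasCompactSupport (hφ.continuous_fderiv one_ne_zero)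
    (hs.fderiv ℝ)
  exact memH1_of_contDiffOn hΩ hfin hφ.contDiffOn (fun x _ => hM x) (fun x _ => hM' x)

theorem inner_eq_sum_basisFun (a b : 𝔼) :
    inner ℝ a b = ∑ i, inner ℝ a (EuclideanSpace.basisFun (Fin n) ℝ i)
      * inner ℝ b (EuclideanSpace.basisFun (Fin n) ℝ i) := by
  rw [← (EuclideanSpace.basisFun (Fin n) ℝ).sum_inner_mul_inner a b]
  exact Finset.sum_congr rfl fun i _ => by rw [real_inner_comm b]

/-- The weak equation in the form `∫ w (φ - Δφ) = ∫ f φ` for test functions `φ`. -/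
theorem IsWeakNeumannSolution.integral_test (hΩ : IsOpen Ω) (hfin : volume Ω ≠ ⊤) {f w : 𝔼 → ℝ}
    (h : IsWeakNeumannSolution Ω f w) {φ : 𝔼 → ℝ} (hφ : ContDiff ℝ ∞ φ)
    (hs : HasCompactSupport φ) (hsΩ : tsupport φ ⊆ Ω) :
    (∫ x in Ω, w x * φ x) - ∫ x in Ω, w x * (∑ i, fderiv ℝ (fun y => fderiv ℝ φ y
      (EuclideanSpace.basisFun (Fin n) ℝ i)) x (EuclideanSpace.basisFun (Fin n) ℝ i))
      = ∫ x in Ω, f x * φ x := by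
  obtain ⟨hf, G, hG, e⟩ := h
  have hφ1 := memH1_of_contDiff_hasCompactSupport hΩ hfin (hφ.of_le (by simp)) hs
  rw [← e _ _ hφ1, integral_add (integrableOn_inner_of_memLp hG.memLp_grad hφ1.memLp_grad)
    (integrableOn_mul_of_memLp hG.memLp hφ1.memLp)]
  set b := EuclideanSpace.basisFun (Fin n) ℝ
  have hφi : ∀ i, ContDiff ℝ ∞ fun y => fderiv ℝ φ y (b i) := fun i =>
    (hφ.fderiv_right (m := ∞) (by simp)).clm_apply contDiff_const
  have hsi : ∀ i, HasCompactSupport fun y => fderiv ℝ φ y (b i) := fun i =>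
    hs.fderiv_apply (𝕜 := ℝ) (b i)
  have hφii : ∀ i, Continuous fun x => fderiv ℝ (fun y => fderiv ℝ φ y (b i)) x (b i) := fun i =>
    ((hφi i).continuous_fderiv (by simp)).clm_apply continuous_const
  have i1 : ∀ i, IntegrableOn (fun x => w x * fderiv ℝ (fun y => fderiv ℝ φ y (b i)) x (b i)) Ω :=
    fun i => by
      obtain ⟨M, hM⟩ := exists_bound_of_hasCompactSupport (hφii i)
        ((hsi i).fderiv_apply (𝕜 := ℝ) (b i))
      exact (hG.integrableOn hfin).mul_bdd (c := M) (hφii i).aestronglyMeasurable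
        (Eventually.of_forall hM)
  have i2 : ∀ i, IntegrableOn (fun x => inner ℝ (G x) (b i) * fderiv ℝ φ x (b i)) Ω := fun i => by
    obtain ⟨M, hM⟩ := exists_bound_of_hasCompactSupport (hφi i).continuous (hsi i)
    exact (hG.integrableOn_inner hfin (b i)).mul_bdd (c := M)
      (hφi i).continuous.aestronglyMeasurable (Eventually.of_forall hM)
  have e1 : ∫ x in Ω, inner ℝ (G x) (gradient φ x)
      = ∑ i, ∫ x in Ω, inner ℝ (G x) (b i) * fderiv ℝ φ x (b i) := by
    rw [← integral_finsetSum _ fun i _ => i2 i]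
    congr 1
    ext x
    rw [inner_eq_sum_basisFun]
    simp only [inner_gradient_left, b]
  have e2 : ∫ x in Ω, w x * (∑ i, fderiv ℝ (fun y => fderiv ℝ φ y (b i)) x (b i))
      = ∑ i, ∫ x in Ω, w x * fderiv ℝ (fun y => fderiv ℝ φ y (b i)) x (b i) := by
    rw [← integral_finsetSum _ fun i _ => i1 i]
    congr 1
    ext x
    rw [Finset.mul_sum]
  rw [e1, e2, sub_eq_add_neg, add_comm, ← Finset.sum_neg_distrib]
  congr 1
  refine Finset.sum_congr rfl fun i _ => ?_
  rw [hG.weak_grad _ (hφi i) (hsi i) ((tsupport_fderiv_apply_subset ℝ _).trans hsΩ), neg_neg]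

theorem IsWeakNeumannSolution.integral_ballKernel (hΩ : IsOpen Ω) (hfin : volume Ω ≠ ⊤)
    {f w : 𝔼 → ℝ} (h : IsWeakNeumannSolution Ω f w) {x : 𝔼} {r : ℝ} (hr : 0 < r)
    (hball : closedBall x r ⊆ Ω) :
    ∫ y in Ω, w y * ballKernelLap r (y - x)
      = (∫ y in Ω, w y * ballKernel r (y - x)) - ∫ y in Ω, f y * ballKernel r (y - x) := by
  have hsupp := hasCompactSupport_ballKernel_sub hr x
  have h1 := h.integral_test hΩ hfin (φ := fun y => ballKernel r (y - x))
    ((contDiff_ballKernel r).comp (contDiff_id.sub contDiff_const))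
    ((isCompact_closedBall x r).of_isClosed_subset (isClosed_tsupport _) hsupp)
    (hsupp.trans hball)
  simp_rw [sum_fderiv_fderiv_ballKernel hr] at h1
  linarith

theorem IsWeakNeumannSolution.hasDerivAt_meanAvg (hΩ : IsOpen Ω) (hfin : volume Ω ≠ ⊤)
    {f w : 𝔼 → ℝ} (h : IsWeakNeumannSolution Ω f w) {x : 𝔼} {r : ℝ} (hr : 0 < r)
    (hball : closedBall x r ⊆ Ω) :
    HasDerivAt (fun r => meanAvg Ω w r x)
      (r * ((∫ y in Ω, w y * ballKernel r (y - x)) - ∫ y in Ω, f y * ballKernel r (y - x))) r := by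
  have hw : IntegrableOn w Ω := by
    obtain ⟨_, G, hG, _⟩ := h
    exact hG.integrableOn hfin
  convert _root_.hasDerivAt_meanAvg hw hr x using 1
  rw [← h.integral_ballKernel hΩ hfin hr hball, ← integral_const_mul]
  congr 1
  ext y
  ring

/-- Lebesgue's differentiation theorem for the kernels `meanKernel r`. -/
theorem ae_tendsto_meanAvg (hΩ : MeasurableSet Ω) {w : 𝔼 → ℝ} (hw : IntegrableOn w Ω) :
    ∀ᵐ x ∂((volume : Measure 𝔼).restrict Ω),
      Tendsto (fun r => meanAvg Ω w r x) (𝓝[>] 0) (𝓝 (meanKernelMass n * w x)) := by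
  have hwi : Integrable (Ω.indicator w) := (integrable_indicator_iff hΩ).2 hw
  obtain ⟨B, hB0, hB⟩ := exists_bound_kernels n
  have hZ := meanKernelMass_pos (n := n)
  rw [ae_restrict_iff' hΩ]
  filter_upwards [(Besicovitch.vitaliFamily (volume : Measure 𝔼)).ae_tendsto_average_norm_sub
    hwi.locallyIntegrable] with x hx hxΩ
  have h1 := hx.comp (Besicovitch.tendsto_filterAt volume x)
  have hr0 : ∀ᶠ r : ℝ in 𝓝[>] 0, 0 < r := self_mem_nhdsWithin
  have h2 : Tendsto (fun r => ∫ y, ((meanKernelMass n)⁻¹ * meanKernel r (y - x)) •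
      Ω.indicator w y) (𝓝[>] 0) (𝓝 (Ω.indicator w x)) := by
    refine tendsto_integral_smul_of_tendsto_average_norm_sub
      ((meanKernelMass n)⁻¹ * B * volume.real (ball (0 : 𝔼) 1)) h1 ?_ ?_ ?_ ?_
    · exact Eventually.of_forall fun r => hwi.integrableOn
    · refine tendsto_const_nhds.congr' ?_
      filter_upwards [hr0] with r hr
      rw [integral_const_mul, integral_meanKernel_sub hr, inv_mul_cancel₀ hZ.ne']
    · filter_upwards [hr0] with r hr y hy
      by_contra hn
      rw [mem_closedBall, dist_eq_norm, not_le] at hn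
      exact hy (by simp only [meanKernel_eq_zero hr hn.le, mul_zero])
    · filter_upwards [hr0] with r hr y
      rw [Measure.addHaar_real_closedBall volume x hr.le, finrank_euclideanSpace_fin, abs_mul,
        abs_of_pos (inv_pos.2 hZ)]
      have hv : 0 < volume.real (ball (0 : 𝔼) 1) :=
        ENNReal.toReal_pos (measure_ball_pos volume _ one_pos).ne' measure_ball_lt_top.ne
      calc _ ≤ (meanKernelMass n)⁻¹ * ((r ^ n)⁻¹ * B) :=
            mul_le_mul_of_nonneg_left (hB r hr _).2.1 (inv_pos.2 hZ).le
        _ = _ := by field_simp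
  have h3 := h2.const_mul (meanKernelMass n)
  rw [indicator_of_mem hxΩ] at h3
  refine h3.congr fun r => ?_
  rw [meanAvg, ← integral_indicator hΩ, ← integral_const_mul]
  congr 1
  ext y
  by_cases hy : y ∈ Ω
  · simp only [hy, indicator_of_mem, smul_eq_mul]
    field_simp
  · simp only [hy, indicator_of_notMem, not_false_eq_true, smul_eq_mul, mul_zero]

/-! ### Interior regularity and the weak Harnack inequality -/

theorem ae_abs_mul_ballKernel_le {g : 𝔼 → ℝ} {M : ℝ} (hM : 0 ≤ M)
    (hg : ∀ᵐ x ∂((volume : Measure 𝔼).restrict Ω), |g x| ≤ M) {r : ℝ} (hr : 0 < r) (x : 𝔼) :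
    |∫ y in Ω, g y * ballKernel r (y - x)| ≤ M * meanKernelMass n := by
  have hi : Integrable (fun y : 𝔼 => M * meanKernel r (y - x)) :=
    ((integrable_meanKernel hr).comp_sub_right x).const_mul M
  have h0 : ∀ y : 𝔼, 0 ≤ M * meanKernel r (y - x) := fun y =>
    mul_nonneg hM (meanKernel_nonneg hr _)
  calc |∫ y in Ω, g y * ballKernel r (y - x)| ≤ ∫ y in Ω, M * meanKernel r (y - x) := by
        rw [← Real.norm_eq_abs]
        refine norm_integral_le_of_norm_le hi.integrableOn ?_
        filter_upwards [hg] with y hy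
        have h1 := ballKernel_nonneg hr (y - x)
        have h2 := ballKernel_le_meanKernel hr (y - x)
        rw [norm_mul, Real.norm_eq_abs, Real.norm_of_nonneg h1]
        exact mul_le_mul hy (by linarith) h1 hM
    _ ≤ ∫ y, M * meanKernel r (y - x) :=
        setIntegral_le_integral hi (Eventually.of_forall h0)
    _ = _ := by rw [integral_const_mul, integral_meanKernel_sub hr]

theorem IsWeakNeumannSolution.integrableOn (hfin : volume Ω ≠ ⊤) {f w : 𝔼 → ℝ}
    (h : IsWeakNeumannSolution Ω f w) : IntegrableOn w Ω := by
  obtain ⟨_, G, hG, _⟩ := h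
  exact hG.integrableOn hfin

theorem IsWeakNeumannSolution.integrableOn_right (hfin : volume Ω ≠ ⊤) {f w : 𝔼 → ℝ}
    (h : IsWeakNeumannSolution Ω f w) : IntegrableOn f Ω := by
  have := isFiniteMeasure_restrict hfin
  exact h.1.integrable (by norm_num)

theorem IsWeakNeumannSolution.abs_meanAvg_sub_le (hΩ : IsOpen Ω) (hfin : volume Ω ≠ ⊤)
    {f w : 𝔼 → ℝ} (h : IsWeakNeumannSolution Ω f w) {M : ℝ} (hM : 0 ≤ M)
    (hf : ∀ᵐ x ∂((volume : Measure 𝔼).restrict Ω), |f x| ≤ M) {x : 𝔼} {r s : ℝ} (hs : 0 < s)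
    (hsr : s ≤ r) (hball : closedBall x r ⊆ Ω) :
    |meanAvg Ω w s x - meanAvg Ω w r x| ≤ 2 * M * meanKernelMass n * r ^ 2 := by
  have hw := h.abs_le hΩ hfin hf
  have hZ := meanKernelMass_pos (n := n)
  have hr : 0 < r := hs.trans_le hsr
  have hC : 0 ≤ r * (2 * M * meanKernelMass n) := by positivity
  have h1 : ∀ t ∈ Icc s r, HasDerivWithinAt (fun r => meanAvg Ω w r x)
      (t * ((∫ y in Ω, w y * ballKernel t (y - x)) - ∫ y in Ω, f y * ballKernel t (y - x)))
      (Icc s r) t := fun t ht =>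
    (h.hasDerivAt_meanAvg hΩ hfin (hs.trans_le ht.1)
      ((closedBall_subset_closedBall ht.2).trans hball)).hasDerivWithinAt
  have h2 : ∀ t ∈ Icc s r,
      ‖t * ((∫ y in Ω, w y * ballKernel t (y - x)) - ∫ y in Ω, f y * ballKernel t (y - x))‖
      ≤ r * (2 * M * meanKernelMass n) := fun t ht => by
    have ht0 := hs.trans_le ht.1
    rw [norm_mul, Real.norm_of_nonneg ht0.le]
    refine mul_le_mul ht.2 ((norm_sub_le _ _).trans ?_) (norm_nonneg _) hr.le
    have h3 := ae_abs_mul_ballKernel_le hM hw ht0 x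
    have h4 := ae_abs_mul_ballKernel_le hM hf ht0 x
    rw [Real.norm_eq_abs, Real.norm_eq_abs]
    linarith
  have h5 := (convex_Icc s r).norm_image_sub_le_of_norm_hasDerivWithin_le h1 h2
    (right_mem_Icc.2 hsr) (left_mem_Icc.2 hsr)
  rw [Real.norm_eq_abs, Real.norm_eq_abs] at h5
  refine h5.trans ?_
  have h6 : |s - r| ≤ r := by rw [abs_sub_comm, abs_of_nonneg (by linarith)]; linarith
  calc _ ≤ r * (2 * M * meanKernelMass n) * r := mul_le_mul_of_nonneg_left h6 hC
    _ = _ := by ring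

/-- **Interior regularity**: for bounded right-hand side the weak solution has a continuous
representative, because its averages at scale `r` converge locally uniformly as `r → 0`. -/
theorem exists_isNeumannInv (hΩ : IsOpen Ω) (hfin : volume Ω ≠ ⊤) {f : 𝔼 → ℝ} {M : ℝ}
    (hM : 0 ≤ M) (hfm : AEStronglyMeasurable f ((volume : Measure 𝔼).restrict Ω))
    (hf : ∀ᵐ x ∂((volume : Measure 𝔼).restrict Ω), |f x| ≤ M) : ∃ w, IsNeumannInv Ω f w := by
  have := isFiniteMeasure_restrict hfin
  obtain ⟨w, h⟩ := exists_isWeakNeumannSolution (MemLp.of_bound (p := 2) hfm M hf)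
  have hw := h.integrableOn hfin
  have hZ := meanKernelMass_pos (n := n)
  set C := 2 * M * meanKernelMass n with hC
  have hC0 : 0 ≤ C := by positivity
  set ρ : ℕ → ℝ := fun k => 1 / ((k : ℝ) + 1) with hρ
  have hρ0 : ∀ k, 0 < ρ k := fun k => by positivity
  have hρanti : Antitone ρ := fun i j hij => one_div_le_one_div_of_le (by positivity)
    (by exact_mod_cast Nat.add_le_add_right hij 1)
  have hρlim : Tendsto ρ atTop (𝓝 0) := tendsto_one_div_add_atTop_nhds_zero_nat
  have hCρ : Tendsto (fun k => C * ρ k ^ 2) atTop (𝓝 0) := by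
    simpa using (hρlim.pow 2).const_mul C
  have hest : ∀ x R, closedBall x R ⊆ Ω → ∀ k j, k ≤ j → ρ k ≤ R →
      |meanAvg Ω w (ρ j) x - meanAvg Ω w (ρ k) x| ≤ C * ρ k ^ 2 := fun x R hR k j hkj hk =>
    h.abs_meanAvg_sub_le hΩ hfin hM hf (hρ0 j) (hρanti hkj)
      ((closedBall_subset_closedBall hk).trans hR)
  have hballs : ∀ x ∈ Ω, ∃ R, 0 < R ∧ closedBall x R ⊆ Ω := fun x hx =>
    (nhds_basis_closedBall.mem_iff.1 (hΩ.mem_nhds hx))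
  have hlim : ∀ x, ∃ l, x ∈ Ω → Tendsto (fun k => meanAvg Ω w (ρ k) x) atTop (𝓝 l) := by
    intro x
    by_cases hx : x ∈ Ω
    swap
    · exact ⟨0, fun h => absurd h hx⟩
    obtain ⟨R, hR0, hR⟩ := hballs x hx
    have hcs : CauchySeq fun k => meanAvg Ω w (ρ k) x := by
      rw [Metric.cauchySeq_iff']
      intro ε hε
      obtain ⟨N, hN1, hN2⟩ := (((tendsto_order.1 hρlim).2 R hR0).and
        ((tendsto_order.1 hCρ).2 ε hε)).exists
      exact ⟨N, fun j hj => (hest x R hR N j hj hN1.le).trans_lt hN2⟩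
    obtain ⟨l, hl⟩ := cauchySeq_tendsto_of_complete hcs
    exact ⟨l, fun _ => hl⟩
  choose W hW using hlim
  have hestW : ∀ x ∈ Ω, ∀ R, closedBall x R ⊆ Ω → ∀ k, ρ k ≤ R →
      |W x - meanAvg Ω w (ρ k) x| ≤ C * ρ k ^ 2 := fun x hx R hR k hk =>
    le_of_tendsto ((hW x hx).sub_const _).abs (by
      filter_upwards [eventually_ge_atTop k] with j hj using hest x R hR k j hj hk)
  have hWc : ContinuousOn W Ω := by
    have hloc : TendstoLocallyUniformlyOn (fun k x => meanAvg Ω w (ρ k) x) W atTop Ω := by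
      rw [Metric.tendstoLocallyUniformlyOn_iff]
      intro ε hε x hx
      obtain ⟨R, hR0, hR⟩ := hballs x hx
      refine ⟨ball x (R / 2) ∩ Ω, inter_mem (mem_nhdsWithin_of_mem_nhds
        (ball_mem_nhds x (by positivity))) self_mem_nhdsWithin, ?_⟩
      filter_upwards [(tendsto_order.1 hρlim).2 (R / 2) (by positivity),
        (tendsto_order.1 hCρ).2 ε hε] with k hk1 hk2 y hy
      refine (hestW y hy.2 (R / 2) (fun z hz => hR ?_) k hk1.le).trans_lt hk2
      rw [mem_closedBall] at hz ⊢
      have hy1 := mem_ball.1 hy.1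
      linarith [dist_triangle z y x]
    exact hloc.continuousOn 
      (Frequently.of_forall fun k => (continuous_meanAvg hw (hρ0 k)).continuousOn)
  refine ⟨fun x => (meanKernelMass n)⁻¹ * W x, continuousOn_const.mul hWc,
    h.congr_ae EventuallyEq.rfl ?_⟩
  filter_upwards [ae_tendsto_meanAvg hΩ.measurableSet hw, ae_restrict_mem hΩ.measurableSet]
    with x hx hxΩ
  have h1 : Tendsto ρ atTop (𝓝[>] 0) :=
    tendsto_nhdsWithin_iff.2 ⟨hρlim, Eventually.of_forall hρ0⟩
  rw [tendsto_nhds_unique (hW x hxΩ) (hx.comp h1), inv_mul_cancel_left₀ hZ.ne']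

theorem IsWeakNeumannSolution.antitoneOn_meanAvg (hΩ : IsOpen Ω) (hfin : volume Ω ≠ ⊤)
    {f w : 𝔼 → ℝ} (h : IsWeakNeumannSolution Ω f w)
    (hf : ∀ᵐ x ∂((volume : Measure 𝔼).restrict Ω), 0 ≤ f x)
    (hw : ∀ᵐ x ∂((volume : Measure 𝔼).restrict Ω), 0 ≤ w x) {x : 𝔼} {R : ℝ}
    (hball : closedBall x R ⊆ Ω) :
    AntitoneOn (fun r => Real.exp (-(r ^ 2 / 2)) * meanAvg Ω w r x) (Ioc 0 R) := by
  have hwi := h.integrableOn hfin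
  have hd : ∀ r ∈ Ioc 0 R, HasDerivAt (fun r => Real.exp (-(r ^ 2 / 2)) * meanAvg Ω w r x)
      (Real.exp (-(r ^ 2 / 2)) * -r * meanAvg Ω w r x + Real.exp (-(r ^ 2 / 2)) *
      (r * ((∫ y in Ω, w y * ballKernel r (y - x)) - ∫ y in Ω, f y * ballKernel r (y - x)))) r := by
    intro r hr
    have h1 : HasDerivAt (fun r : ℝ => Real.exp (-(r ^ 2 / 2)))
        (Real.exp (-(r ^ 2 / 2)) * -r) r := by
      have h2 : HasDerivAt (fun r : ℝ => -(r ^ 2 / 2)) (-r) r := by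
        have h3 := ((hasDerivAt_pow 2 r).div_const 2).neg
        convert! h3 using 1
        simp
      exact h2.exp
    exact h1.mul (h.hasDerivAt_meanAvg hΩ hfin hr.1
      ((closedBall_subset_closedBall hr.2).trans hball))
  refine antitoneOn_of_deriv_nonpos (convex_Ioc 0 R)
    (fun r hr => (hd r hr).continuousAt.continuousWithinAt)
    (fun r hr => (hd r (interior_subset hr)).differentiableAt.differentiableWithinAt)
    fun r hr => ?_
  have hr' := interior_subset hr
  have hr0 : 0 < r := hr'.1
  rw [(hd r hr').deriv]
  have h1 : ∫ y in Ω, w y * ballKernel r (y - x) ≤ meanAvg Ω w r x := by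
    refine integral_mono_ae (integrableOn_mul_ballKernel hwi hr0 x)
      (integrableOn_mul_meanKernel hwi hr0 x) ?_
    filter_upwards [hw] with y hy
    have h2 := ballKernel_le_meanKernel hr0 (y - x)
    have h3 := ballKernel_nonneg hr0 (y - x)
    exact mul_le_mul_of_nonneg_left (by linarith) hy
  have h2 : 0 ≤ ∫ y in Ω, f y * ballKernel r (y - x) := by
    refine integral_nonneg_of_ae ?_
    filter_upwards [hf] with y hy
    exact mul_nonneg hy (ballKernel_nonneg hr0 _)
  have h3 : 0 ≤ Real.exp (-(r ^ 2 / 2)) * r := by positivity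
  nlinarith

/-- **Weak Harnack inequality**: a nonnegative supersolution is bounded below by its averages. -/
theorem IsNeumannInv.meanAvg_le (hΩ : IsOpen Ω) (hfin : volume Ω ≠ ⊤) {f w : 𝔼 → ℝ}
    (h : IsNeumannInv Ω f w) (hf : ∀ x ∈ Ω, 0 ≤ f x) {x : 𝔼} {R R' : ℝ} (hR : 0 < R)
    (hRR' : R < R') (hball : closedBall x R' ⊆ Ω) :
    Real.exp (-(R ^ 2 / 2)) * meanAvg Ω w R x ≤ meanKernelMass n * w x := by
  have hf' : ∀ᵐ x ∂((volume : Measure 𝔼).restrict Ω), 0 ≤ f x :=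
    (ae_restrict_iff' hΩ.measurableSet).2 (Eventually.of_forall hf)
  have hw' : ∀ᵐ x ∂((volume : Measure 𝔼).restrict Ω), 0 ≤ w x :=
    (ae_restrict_iff' hΩ.measurableSet).2 (Eventually.of_forall (h.nonneg hΩ hfin hf))
  have hwi := h.2.integrableOn hfin
  set U := ball x (R' - R)
  have hUball : ∀ y ∈ U, closedBall y R ⊆ Ω := fun y hy z hz => hball (by
    rw [mem_closedBall] at hz ⊢
    have := mem_ball.1 hy
    linarith [dist_triangle z y x])
  have hUΩ : U ⊆ Ω := fun y hy => hUball y hy (mem_closedBall_self hR.le)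
  refine forall_le_of_ae (Ω := U) isOpen_ball
    (w₁ := fun x => Real.exp (-(R ^ 2 / 2)) * meanAvg Ω w R x)
    (w₂ := fun x => meanKernelMass n * w x)
    (continuous_const.mul (continuous_meanAvg hwi hR)).continuousOn
    (continuousOn_const.mul (h.1.mono hUΩ)) ?_ x (mem_ball_self (by linarith))
  filter_upwards [ae_restrict_of_ae_restrict_of_subset hUΩ
    (ae_tendsto_meanAvg hΩ.measurableSet hwi), ae_restrict_mem isOpen_ball.measurableSet]
    with y hy hyU
  have hanti := h.2.antitoneOn_meanAvg hΩ hfin hf' hw' (hUball y hyU)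
  have h1 : Tendsto (fun r : ℝ => Real.exp (-(r ^ 2 / 2)) * meanAvg Ω w r y) (𝓝[>] 0)
      (𝓝 (1 * (meanKernelMass n * w y))) := by
    refine Tendsto.mul ?_ hy
    have hc : Continuous fun r : ℝ => Real.exp (-(r ^ 2 / 2)) := by fun_prop
    have := (hc.tendsto 0).mono_left (nhdsWithin_le_nhds (s := Ioi 0))
    simpa using this
  rw [one_mul] at h1
  refine ge_of_tendsto h1 ?_
  filter_upwards [Ioc_mem_nhdsGT hR] with r hr
  exact hanti hr (right_mem_Ioc.2 hR) hr.2

/-! ### A global defining function -/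

/-- `ρ` is a smooth function with `Ω = {ρ < 0}` whose gradient has no zero on `∂Ω`. -/
structure IsDefiningFunction (Ω : Set (EuclideanSpace ℝ (Fin n)))
    (ρ : EuclideanSpace ℝ (Fin n) → ℝ) : Prop where
  contDiff : ContDiff ℝ ∞ ρ
  mem_iff : ∀ x, x ∈ Ω ↔ ρ x < 0
  gradient_ne_zero : ∀ x ∈ frontier Ω, gradient ρ x ≠ 0

theorem IsBoundaryDefining.eq_zero (hΩ : IsOpen Ω) {x : 𝔼} (hx : x ∈ frontier Ω) {ρ : 𝔼 → ℝ}
    (hρ : ContDiff ℝ ∞ ρ) (h : ∀ᶠ y in 𝓝 x, (y ∈ Ω ↔ ρ y < 0)) : ρ x = 0 := by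
  have h1 : ¬ ρ x < 0 := fun hn => by
    have : x ∈ Ω := h.self_of_nhds.2 hn
    rw [hΩ.frontier_eq] at hx
    exact hx.2 this
  have h2 : ρ x ≤ 0 := by
    have hx' : (𝓝[Ω] x).NeBot := mem_closure_iff_nhdsWithin_neBot.1 (frontier_subset_closure hx)
    refine le_of_tendsto (hρ.continuous.continuousAt.tendsto.mono_left
      (nhdsWithin_le_nhds (s := Ω))) ?_
    filter_upwards [self_mem_nhdsWithin, nhdsWithin_le_nhds h] with y hy hy'
    exact (hy'.1 hy).le
  exact le_antisymm h2 (not_lt.1 h1)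

theorem eventually_sign_of_fderiv {ρ : 𝔼 → ℝ} {x e : 𝔼} (hd : DifferentiableAt ℝ ρ x)
    (h0 : ρ x = 0) (he : 0 < fderiv ℝ ρ x e) : ∀ᶠ t : ℝ in 𝓝[>] 0, 0 < ρ (x + t • e) := by
  have h1 : HasDerivAt (fun t : ℝ => ρ (x + t • e)) (fderiv ℝ ρ x e) 0 := by
    have h2 : HasDerivAt (fun t : ℝ => x + t • e) e 0 := by
      simpa using ((hasDerivAt_id (0 : ℝ)).smul_const e).const_add x
    have h3 : HasFDerivAt ρ (fderiv ℝ ρ x) (x + (0 : ℝ) • e) := by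
      simpa using hd.hasFDerivAt
    exact h3.comp_hasDerivAt 0 h2
  have h2 := (hasDerivAt_iff_tendsto_slope_zero.1 h1).mono_left
    (nhdsWithin_mono 0 (fun t (ht : 0 < t) => ht.ne'))
  filter_upwards [(tendsto_order.1 h2).1 0 he, self_mem_nhdsWithin] with t ht ht0
  have ht0' : 0 < t := ht0
  simp only [zero_add, zero_smul, add_zero, h0, sub_zero, smul_eq_mul] at ht
  exact (mul_pos_iff_of_pos_left (inv_pos.2 ht0')).1 ht

/-- The unit normal does not depend on the defining function: otherwise some direction would point
both into and out of `Ω`. -/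
theorem IsBoundaryDefining.normal_unique (hΩ : IsOpen Ω) {x : 𝔼} (hx : x ∈ frontier Ω)
    {ρ₁ ρ₂ : 𝔼 → ℝ} (h₁ : IsBoundaryDefining Ω x ρ₁) (h₂ : IsBoundaryDefining Ω x ρ₂) :
    ‖gradient ρ₁ x‖⁻¹ • gradient ρ₁ x = ‖gradient ρ₂ x‖⁻¹ • gradient ρ₂ x := by
  obtain ⟨c₁, g₁, s₁⟩ := h₁
  obtain ⟨c₂, g₂, s₂⟩ := h₂
  have z₁ := IsBoundaryDefining.eq_zero hΩ hx c₁ s₁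
  have z₂ := IsBoundaryDefining.eq_zero hΩ hx c₂ s₂
  set a := gradient ρ₁ x with ha
  set b := gradient ρ₂ x with hb
  by_contra hne
  have na : 0 < ‖a‖ := norm_pos_iff.2 g₁
  have nb : 0 < ‖b‖ := norm_pos_iff.2 g₂
  have hab : inner ℝ (‖a‖⁻¹ • a) (‖b‖⁻¹ • b) < 1 := by
    refine (inner_lt_one_iff_real_of_norm_eq_one ?_ ?_).2 hne
    · rw [norm_smul, norm_inv, norm_norm, inv_mul_cancel₀ na.ne']
    · rw [norm_smul, norm_inv, norm_norm, inv_mul_cancel₀ nb.ne']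
  rw [inner_smul_left, inner_smul_right] at hab
  simp only [RCLike.conj_to_real] at hab
  set e := ‖b‖⁻¹ • b - ‖a‖⁻¹ • a with he
  have e1 : 0 < fderiv ℝ ρ₂ x e := by
    rw [← inner_gradient_left, ← hb, he, inner_sub_right, inner_smul_right, inner_smul_right,
      real_inner_self_eq_norm_sq, real_inner_comm]
    have : ‖b‖⁻¹ * ‖b‖ ^ 2 - ‖a‖⁻¹ * inner ℝ a b
        = ‖b‖ * (1 - ‖a‖⁻¹ * (‖b‖⁻¹ * inner ℝ a b)) := by
      field_simp
    rw [this]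
    exact mul_pos nb (by linarith)
  have e2 : 0 < fderiv ℝ (fun y => -ρ₁ y) x e := by
    rw [fderiv_fun_neg, neg_apply, ← inner_gradient_left, ← ha, he, inner_sub_right,
      inner_smul_right, inner_smul_right, real_inner_self_eq_norm_sq]
    have : -(‖b‖⁻¹ * inner ℝ a b - ‖a‖⁻¹ * ‖a‖ ^ 2)
        = ‖a‖ * (1 - ‖a‖⁻¹ * (‖b‖⁻¹ * inner ℝ a b)) := by
      field_simp
      ring
    rw [this]
    exact mul_pos na (by linarith)
  have hlim : Tendsto (fun t : ℝ => x + t • e) (𝓝[>] 0) (𝓝 x) := by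
    have hc : Continuous fun t : ℝ => x + t • e := by fun_prop
    simpa using (hc.tendsto 0).mono_left (nhdsWithin_le_nhds (s := Ioi 0))
  obtain ⟨t, t1, t2, t3, t4⟩ := ((eventually_sign_of_fderiv
    (c₂.differentiable (by simp) x) z₂ e1).and ((eventually_sign_of_fderiv
    (c₁.differentiable (by simp) x).neg (by simpa using z₁) e2).and
    ((hlim.eventually s₁).and (hlim.eventually s₂)))).exists
  simp only [Pi.neg_apply] at t2
  have h5 : x + t • e ∈ Ω := t3.2 (by linarith)
  linarith [t4.1 h5]

theorem gradient_eq_zero_of_nonneg {b : 𝔼 → ℝ} (hb : ∀ y, 0 ≤ b y) {x : 𝔼} (hx : b x = 0) :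
    fderiv ℝ b x = 0 :=
  IsLocalMin.fderiv_eq_zero (Eventually.of_forall fun y => by rw [hx]; exact hb y)

theorem IsSmoothBoundedDomain.exists_local (hΩ : IsSmoothBoundedDomain Ω) {x : 𝔼}
    (hx : x ∈ frontier Ω) : ∃ ρ b : 𝔼 → ℝ, ContDiff ℝ ∞ ρ ∧ ContDiff ℝ ∞ b ∧ (∀ y, 0 ≤ b y) ∧
      b x ≠ 0 ∧ ∀ y, b y ≠ 0 → IsBoundaryDefining Ω y ρ := by
  obtain ⟨ρ, h1, h2, h3⟩ := hΩ.smooth_boundary x hx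
  have hgc : Continuous (gradient ρ) :=
    (InnerProductSpace.toDual ℝ 𝔼).symm.continuous.comp (h1.continuous_fderiv (by simp))
  have h4 : ∀ᶠ y in 𝓝 x, IsBoundaryDefining Ω y ρ := by
    filter_upwards [h3.eventually_nhds, hgc.continuousAt.eventually_ne h2] with y hy hy'
    exact ⟨h1, hy', hy⟩
  obtain ⟨U, hU, hUo, hxU⟩ := _root_.eventually_nhds_iff.1 h4
  obtain ⟨b, hb1, hb2, hb3⟩ := hUo.exists_contDiff_support_eq (n := ⊤)
  refine ⟨ρ, b, h1, hb2, fun y => (hb3 (mem_range_self y)).1, ?_, fun y hy => hU y ?_⟩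
  · have : x ∈ Function.support b := hb1 ▸ hxU
    exact this
  · have : y ∈ Function.support b := hy
    rwa [hb1] at this

/-- Gluing local defining functions by nonnegative bumps `bᵢ`, and subtracting a smooth `b₀ ≥ 0`
which is positive exactly in `Ω`, gives a global defining function. -/
theorem IsSmoothBoundedDomain.exists_isDefiningFunction (hΩ : IsSmoothBoundedDomain Ω) :
    ∃ ρ, IsDefiningFunction Ω ρ := by
  have hloc : ∀ x, ∃ ρ b : 𝔼 → ℝ, x ∈ frontier Ω → ContDiff ℝ ∞ ρ ∧ ContDiff ℝ ∞ b ∧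
      (∀ y, 0 ≤ b y) ∧ b x ≠ 0 ∧ ∀ y, b y ≠ 0 → IsBoundaryDefining Ω y ρ := fun x => by
    by_cases hx : x ∈ frontier Ω
    · obtain ⟨ρ, b, h⟩ := hΩ.exists_local hx
      exact ⟨ρ, b, fun _ => h⟩
    · exact ⟨0, 0, fun h => absurd h hx⟩
  choose ρ b hρb using hloc
  have hcomp : IsCompact (frontier Ω) :=
    hΩ.isBounded.isCompact_closure.of_isClosed_subset isClosed_frontier frontier_subset_closure
  obtain ⟨t, ht, hcov⟩ := hcomp.elim_nhds_subcover (fun x => Function.support (b x))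
    fun x hx => ((hρb x hx).2.1.continuous.isOpen_support).mem_nhds (hρb x hx).2.2.2.1
  obtain ⟨b₀, hb₀1, hb₀2, hb₀3⟩ := hΩ.isOpen.exists_contDiff_support_eq (n := ⊤)
  have hb₀0 : ∀ y, 0 ≤ b₀ y := fun y => (hb₀3 (mem_range_self y)).1
  have hb₀Ω : ∀ y, y ∈ Ω ↔ b₀ y ≠ 0 := fun y => by rw [← hb₀1]; rfl
  set R : 𝔼 → ℝ := fun y => (∑ x ∈ t, b x y * ρ x y) - b₀ y with hR
  have hRc : ContDiff ℝ ∞ R := (ContDiff.sum fun x hx =>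
    (hρb x (ht x hx)).2.1.mul (hρb x (ht x hx)).1).sub hb₀2
  have hmem : ∀ y, y ∈ Ω ↔ R y < 0 := fun y => by
    constructor
    · intro hy
      have h1 : 0 < b₀ y := lt_of_le_of_ne (hb₀0 y) ((hb₀Ω y).1 hy).symm
      have h2 : ∑ x ∈ t, b x y * ρ x y ≤ 0 := Finset.sum_nonpos fun x hx => by
        by_cases hxy : b x y = 0
        · rw [hxy, zero_mul]
        · exact mul_nonpos_of_nonneg_of_nonpos ((hρb x (ht x hx)).2.2.1 y)
            ((((hρb x (ht x hx)).2.2.2.2 y hxy).2.2.self_of_nhds).1 hy).le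
      simp only [hR]
      linarith
    · intro hy
      by_contra hn
      have h1 : b₀ y = 0 := by
        by_contra h; exact hn ((hb₀Ω y).2 h)
      have h2 : 0 ≤ ∑ x ∈ t, b x y * ρ x y := Finset.sum_nonneg fun x hx => by
        by_cases hxy : b x y = 0
        · rw [hxy, zero_mul]
        · refine mul_nonneg ((hρb x (ht x hx)).2.2.1 y) (not_lt.1 fun h => hn ?_)
          exact (((hρb x (ht x hx)).2.2.2.2 y hxy).2.2.self_of_nhds).2 h
      simp only [hR, h1] at hy
      linarith
  refine ⟨R, hRc, hmem, fun y hy h0 => ?_⟩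
  obtain ⟨x₀, hx₀, hx₀y⟩ : ∃ x ∈ t, b x y ≠ 0 := by
    have := hcov hy
    simp only [mem_iUnion] at this
    obtain ⟨x, hx, hxy⟩ := this
    exact ⟨x, hx, hxy⟩
  have hyΩ : y ∉ Ω := by rw [hΩ.isOpen.frontier_eq] at hy; exact hy.2
  have hb₀y : b₀ y = 0 := by by_contra h; exact hyΩ ((hb₀Ω y).2 h)
  set ν := ‖gradient (ρ x₀) y‖⁻¹ • gradient (ρ x₀) y
  have hterm : ∀ x ∈ t, fderiv ℝ (fun y => b x y * ρ x y) y ν = b x y * ‖gradient (ρ x) y‖ := by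
    intro x hx
    obtain ⟨c1, c2, c3, _, c5⟩ := hρb x (ht x hx)
    rw [fderiv_fun_mul (c2.differentiable (by simp) y) (c1.differentiable (by simp) y)]
    by_cases hxy : b x y = 0
    · rw [hxy, gradient_eq_zero_of_nonneg c3 hxy]
      simp
    · have hd := c5 y hxy
      rw [IsBoundaryDefining.eq_zero hΩ.isOpen hy c1 hd.2.2]
      have h1 := hd.normal_unique hΩ.isOpen hy ((hρb x₀ (ht x₀ hx₀)).2.2.2.2 y hx₀y)
      simp only [zero_smul, add_zero, smul_apply, smul_eq_mul]
      congr 1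
      change fderiv ℝ (ρ x) y (‖gradient (ρ x₀) y‖⁻¹ • gradient (ρ x₀) y) = _
      rw [← h1, ← inner_gradient_left, inner_smul_right, real_inner_self_eq_norm_sq, pow_two,
        inv_mul_cancel_left₀ (norm_ne_zero_iff.2 hd.2.1)]
  have hfd : fderiv ℝ R y ν = ∑ x ∈ t, b x y * ‖gradient (ρ x) y‖ := by
    simp only [hR]
    rw [fderiv_fun_sub (DifferentiableAt.fun_sum fun x hx =>
        ((hρb x (ht x hx)).2.1.mul (hρb x (ht x hx)).1).differentiable (by simp) y)
      (hb₀2.differentiable (by simp) y), gradient_eq_zero_of_nonneg hb₀0 hb₀y, sub_zero,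
      fderiv_fun_sum fun x hx =>
        ((hρb x (ht x hx)).2.1.mul (hρb x (ht x hx)).1).differentiable (by simp) y,
      sum_apply]
    exact Finset.sum_congr rfl hterm
  have hpos : 0 < ∑ x ∈ t, b x y * ‖gradient (ρ x) y‖ := by
    refine Finset.sum_pos' (fun x hx => mul_nonneg ((hρb x (ht x hx)).2.2.1 y) (norm_nonneg _))
      ⟨x₀, hx₀, ?_⟩
    obtain ⟨_, _, c3, _, c5⟩ := hρb x₀ (ht x₀ hx₀)
    exact mul_pos (lt_of_le_of_ne (c3 y) hx₀y.symm) (norm_pos_iff.2 (c5 y hx₀y).2.1)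
  rw [← inner_gradient_left, h0, inner_zero_left] at hfd
  linarith

section Defining

variable {ρ : EuclideanSpace ℝ (Fin n) → ℝ}

theorem IsDefiningFunction.isBoundaryDefining (h : IsDefiningFunction Ω ρ) {x : 𝔼}
    (hx : x ∈ frontier Ω) : IsBoundaryDefining Ω x ρ :=
  ⟨h.contDiff, h.gradient_ne_zero x hx, Eventually.of_forall h.mem_iff⟩

theorem IsDefiningFunction.continuous_gradient (h : IsDefiningFunction Ω ρ) :
    Continuous (gradient ρ) :=
  (InnerProductSpace.toDual ℝ 𝔼).symm.continuous.comp (h.contDiff.continuous_fderiv (by simp))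

theorem IsDefiningFunction.contDiff_gradient (h : IsDefiningFunction Ω ρ) :
    ContDiff ℝ ∞ (gradient ρ) :=
  (InnerProductSpace.toDual ℝ 𝔼).symm.contDiff.comp (h.contDiff.fderiv_right (by simp))

theorem IsDefiningFunction.isOpen (h : IsDefiningFunction Ω ρ) : IsOpen Ω := by
  have : Ω = ρ ⁻¹' Iio 0 := by ext x; exact h.mem_iff x
  rw [this]
  exact isOpen_Iio.preimage h.contDiff.continuous

theorem IsDefiningFunction.isCompact_le (h : IsDefiningFunction Ω ρ)
    (hb : Bornology.IsBounded Ω) {δ : ℝ} (hδ : 0 < δ) : IsCompact {x | ρ x ≤ -δ} :=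
  isCompact_of_isClosed_isBounded (isClosed_le h.contDiff.continuous continuous_const)
    (hb.subset fun x (hx : ρ x ≤ -δ) => (h.mem_iff x).2 (by linarith))

/-- The gradient of the defining function is bounded below near the boundary. -/
theorem IsDefiningFunction.exists_gradient_ge (h : IsDefiningFunction Ω ρ)
    (hb : Bornology.IsBounded Ω) : ∃ δ > 0, ∃ c > 0, ∀ x ∈ Ω, -δ < ρ x → c ≤ ‖gradient ρ x‖ := by
  have hcl := hb.isCompact_closure
  have hcomp : IsCompact (frontier Ω) :=
    hcl.of_isClosed_subset isClosed_frontier frontier_subset_closure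
  obtain ⟨c, hc0, hc⟩ : ∃ c > 0, ∀ x ∈ frontier Ω, c < ‖gradient ρ x‖ := by
    rcases (frontier Ω).eq_empty_or_nonempty with he | hne
    · exact ⟨1, one_pos, by simp [he]⟩
    · obtain ⟨x₀, hx₀, hmin⟩ := hcomp.exists_isMinOn hne h.continuous_gradient.norm.continuousOn
      have h1 : 0 < ‖gradient ρ x₀‖ := norm_pos_iff.2 (h.gradient_ne_zero x₀ hx₀)
      exact ⟨‖gradient ρ x₀‖ / 2, by positivity, fun x hx => by
        have := hmin hx
        simp only [mem_ofPred_eq] at this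
        linarith⟩
  have hK : IsCompact (closure Ω ∩ {x | ‖gradient ρ x‖ ≤ c}) :=
    hcl.inter_right (isClosed_le h.continuous_gradient.norm continuous_const)
  rcases (closure Ω ∩ {x | ‖gradient ρ x‖ ≤ c}).eq_empty_or_nonempty with he | hne
  · refine ⟨1, one_pos, c, hc0, fun x hx _ => ?_⟩
    by_contra hn
    exact (he ▸ (⟨subset_closure hx, (not_le.1 hn).le⟩ :
      x ∈ closure Ω ∩ {x | ‖gradient ρ x‖ ≤ c}) : x ∈ (∅ : Set 𝔼))
  · obtain ⟨x₀, hx₀, hmax⟩ := hK.exists_isMaxOn hne h.contDiff.continuous.continuousOn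
    have hx₀Ω : x₀ ∈ Ω := by
      by_contra hn
      have : x₀ ∈ frontier Ω := by rw [h.isOpen.frontier_eq]; exact ⟨hx₀.1, hn⟩
      have h2 : ‖gradient ρ x₀‖ ≤ c := hx₀.2
      linarith [hc x₀ this]
    have hρ := (h.mem_iff x₀).1 hx₀Ω
    refine ⟨-ρ x₀, by linarith, c, hc0, fun x hx hxρ => ?_⟩
    by_contra hn
    have h3 := hmax (⟨subset_closure hx, (not_le.1 hn).le⟩ :
      x ∈ closure Ω ∩ {x | ‖gradient ρ x‖ ≤ c})
    simp only [mem_ofPred_eq] at h3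
    linarith

theorem IsDefiningFunction.mem_frontier (h : IsDefiningFunction Ω ρ) {x : 𝔼} (hx : x ∈ closure Ω)
    (h0 : 0 ≤ ρ x) : x ∈ frontier Ω := by
  rw [h.isOpen.frontier_eq]
  exact ⟨hx, fun hn => not_lt.2 h0 ((h.mem_iff x).1 hn)⟩

/-- Cutoff functions `χₖ = η(-(k + 1) ρ)`, whose gradients are `-cₖ ∇ρ` with `0 ≤ cₖ ≤ B / |ρ|`. -/
theorem IsDefiningFunction.exists_cutoff (h : IsDefiningFunction Ω ρ)
    (hb : Bornology.IsBounded Ω) : ∃ (χ c : ℕ → 𝔼 → ℝ) (B : ℝ), 0 ≤ B ∧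
      (∀ k, ContDiff ℝ ∞ (χ k)) ∧ (∀ k, HasCompactSupport (χ k)) ∧ (∀ k, tsupport (χ k) ⊆ Ω) ∧
      (∀ k x, 0 ≤ χ k x ∧ χ k x ≤ 1) ∧ (∀ x ∈ Ω, ∀ᶠ k in atTop, χ k x = 1) ∧
      (∀ k x, gradient (χ k) x = -(c k x) • gradient ρ x) ∧ (∀ k x, 0 ≤ c k x) ∧
      (∀ k, ∀ x ∈ Ω, c k x * |ρ x| ≤ B) ∧ ∀ x ∈ Ω, ∀ᶠ k in atTop, c k x = 0 := by
  set η : ℝ → ℝ := fun s => Real.smoothTransition (s - 1) with hη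
  have hηc : ContDiff ℝ ∞ η := Real.smoothTransition.contDiff.comp (contDiff_id.sub contDiff_const)
  have hη0 : ∀ s, s ≤ 1 → η s = 0 := fun s hs =>
    Real.smoothTransition.zero_of_nonpos (by linarith)
  have hη1 : ∀ s, 2 ≤ s → η s = 1 := fun s hs => Real.smoothTransition.one_of_one_le (by linarith)
  have hη'0 : ∀ s, 2 < s → deriv η s = 0 := fun s hs => by
    have : η =ᶠ[𝓝 s] fun _ => 1 := by
      filter_upwards [Ioi_mem_nhds hs] with t ht using hη1 t (le_of_lt ht)
    rw [this.deriv_eq, deriv_const]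
  have hηmono : Monotone η := fun s t hst => Real.smoothTransition.monotone (by linarith)
  have hη'nn : ∀ s, 0 ≤ deriv η s := fun s => hηmono.deriv_nonneg
  obtain ⟨B, hB⟩ := (isCompact_Icc (a := (0 : ℝ)) (b := 2)).exists_bound_of_continuousOn
    (hηc.continuous_deriv (by simp)).continuousOn
  have hB0 : 0 ≤ B := (norm_nonneg _).trans (hB 0 (by norm_num))
  have hkρ : ∀ x ∈ Ω, Tendsto (fun k : ℕ => ((k : ℝ) + 1) * (-ρ x)) atTop atTop := fun x hx =>
    (tendsto_atTop_add_const_right _ _ tendsto_natCast_atTop_atTop).atTop_mul_const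
      (by linarith [(h.mem_iff x).1 hx])
  have hsupp : ∀ k : ℕ, tsupport (fun x => η (((k : ℝ) + 1) * (-ρ x)))
      ⊆ {x | ρ x ≤ -(1 / ((k : ℝ) + 1))} := fun k => by
    refine closure_minimal (fun x hx => ?_) (isClosed_le h.contDiff.continuous continuous_const)
    have h1 : 1 < ((k : ℝ) + 1) * (-ρ x) := by
      by_contra hn
      exact hx (hη0 _ (not_lt.1 hn))
    have hk : (0 : ℝ) < (k : ℝ) + 1 := by positivity
    have h2 : 1 / ((k : ℝ) + 1) < -ρ x := by rwa [div_lt_iff₀ hk, mul_comm]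
    change ρ x ≤ _
    linarith
  have hgrad : ∀ (k : ℕ) (x : 𝔼), gradient (fun x => η (((k : ℝ) + 1) * (-ρ x))) x
      = -(((k : ℝ) + 1) * deriv η (((k : ℝ) + 1) * (-ρ x))) • gradient ρ x := fun k x => by
    have h1 : HasFDerivAt (fun x => ((k : ℝ) + 1) * (-ρ x)) (((k : ℝ) + 1) • -fderiv ℝ ρ x) x :=
      (h.contDiff.differentiable (by simp) x).hasFDerivAt.neg.const_mul _
    have h2 : HasFDerivAt (fun x => η (((k : ℝ) + 1) * (-ρ x))) _ x :=
      (hηc.differentiable (by simp) _).hasDerivAt.comp_hasFDerivAt x h1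
    rw [gradient, h2.fderiv, gradient, map_smul, map_smul, map_neg, smul_smul, smul_neg, neg_smul,
      mul_comm]
  refine ⟨fun k x => η (((k : ℝ) + 1) * (-ρ x)),
    fun k x => ((k : ℝ) + 1) * deriv η (((k : ℝ) + 1) * (-ρ x)), 2 * B, by positivity,
    fun k => hηc.comp (contDiff_const.mul h.contDiff.neg), fun k => ?_, fun k => ?_,
    fun k x => ⟨Real.smoothTransition.nonneg _, Real.smoothTransition.le_one _⟩, fun x hx => ?_,
    hgrad, fun k x => mul_nonneg (by positivity) (hη'nn _), fun k x hx => ?_, fun x hx => ?_⟩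
  · exact (h.isCompact_le hb (by positivity)).of_isClosed_subset (isClosed_tsupport _) (hsupp k)
  · exact (hsupp k).trans fun x (hx : ρ x ≤ _) => (h.mem_iff x).2
      (hx.trans_lt (neg_lt_zero.2 (by positivity)))
  · filter_upwards [(hkρ x hx).eventually_ge_atTop 2] with k hk using hη1 _ hk
  · have hx' := (h.mem_iff x).1 hx
    have hk : (0 : ℝ) < (k : ℝ) + 1 := by positivity
    have hs : 0 ≤ ((k : ℝ) + 1) * (-ρ x) := mul_nonneg hk.le (by linarith)
    rw [abs_of_neg hx']
    rcases le_or_gt (((k : ℝ) + 1) * (-ρ x)) 2 with h2 | h2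
    · have h3 := hB _ ⟨hs, h2⟩
      rw [Real.norm_of_nonneg (hη'nn _)] at h3
      calc _ = (((k : ℝ) + 1) * (-ρ x)) * deriv η (((k : ℝ) + 1) * (-ρ x)) := by ring
        _ ≤ 2 * B := mul_le_mul h2 h3 (hη'nn _) (by norm_num)
    · simp only []
      rw [hη'0 _ h2]
      simpa using hB0
  · filter_upwards [(hkρ x hx).eventually_gt_atTop 2] with k hk
    rw [hη'0 _ hk, mul_zero]

end Defining

/-! ### Green's formula without a trace theorem -/

theorem laplacian_eq_sum (h : 𝔼 → ℝ) (x : 𝔼) :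
    Δ h x = ∑ i, fderiv ℝ (fderiv ℝ h) x (EuclideanSpace.basisFun (Fin n) ℝ i)
      (EuclideanSpace.basisFun (Fin n) ℝ i) := by
  rw [InnerProductSpace.laplacian_eq_iteratedFDeriv_orthonormalBasis h
    (EuclideanSpace.basisFun (Fin n) ℝ)]
  simp [iteratedFDeriv_two_apply]

theorem ContDiffOn.differentiableAt_fderiv_of_two (hΩ : IsOpen Ω) {h : 𝔼 → ℝ}
    (hh : ContDiffOn ℝ 2 h Ω) {x : 𝔼} (hx : x ∈ Ω) : DifferentiableAt ℝ (fderiv ℝ h) x :=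
  ((hh.contDiffAt (hΩ.mem_nhds hx)).fderiv_right (m := 1) (by norm_num)).differentiableAt
    (by norm_num)

theorem continuousOn_laplacian (hΩ : IsOpen Ω) {h : 𝔼 → ℝ} (hh : ContDiffOn ℝ 2 h Ω) :
    ContinuousOn (Δ h) Ω := by
  have h1 : ContinuousOn (fderiv ℝ (fderiv ℝ h)) Ω :=
    ((hh.fderiv_of_isOpen (m := 1) hΩ (by norm_num)).continuousOn_fderiv_of_isOpen hΩ (by norm_num))
  have h2 : Δ h = fun x => ∑ i, fderiv ℝ (fderiv ℝ h) x (EuclideanSpace.basisFun (Fin n) ℝ i)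
      (EuclideanSpace.basisFun (Fin n) ℝ i) := funext (laplacian_eq_sum h)
  rw [h2]
  exact continuousOn_finsetSum _ fun i _ =>
    (h1.clm_apply continuousOn_const).clm_apply continuousOn_const

theorem contDiff_of_contDiffOn_of_tsupport (hΩ : IsOpen Ω) {k : WithTop ℕ∞} {χ g : 𝔼 → ℝ}
    (hχ : ContDiff ℝ k χ) (hsΩ : tsupport χ ⊆ Ω) (hg : ContDiffOn ℝ k g Ω) :
    ContDiff ℝ k fun x => χ x * g x := by
  rw [contDiff_iff_contDiffAt]
  intro x
  by_cases hx : x ∈ Ω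
  · exact hχ.contDiffAt.mul (hg.contDiffAt (hΩ.mem_nhds hx))
  · have h1 : χ =ᶠ[𝓝 x] 0 := notMem_tsupport_iff_eventuallyEq.1 fun h => hx (hsΩ h)
    refine (contDiffAt_const (c := (0 : ℝ))).congr_of_eventuallyEq ?_
    filter_upwards [h1] with y hy
    simp [hy]

/-- Integration by parts against an `H¹` function, localized by a cutoff `χ`. -/
theorem MemH1.integral_cutoff_inner (hΩ : IsOpen Ω) (hfin : volume Ω ≠ ⊤) {φ h χ : 𝔼 → ℝ}
    {Φ : 𝔼 → 𝔼} (hφ : MemH1 Ω φ Φ) (hh : ContDiffOn ℝ 2 h Ω) (hχ : ContDiff ℝ ∞ χ)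
    (hs : HasCompactSupport χ) (hsΩ : tsupport χ ⊆ Ω) :
    ∫ x in Ω, χ x * inner ℝ (gradient h x) (Φ x)
      = - ∫ x in Ω, φ x * (χ x * Δ h x + inner ℝ (gradient χ x) (gradient h x)) := by
  set b := EuclideanSpace.basisFun (Fin n) ℝ with hb
  set ψ : Fin n → 𝔼 → ℝ := fun i x => χ x * fderiv ℝ h x (b i) with hψ
  have hg : ∀ i, ContDiffOn ℝ 1 (fun x => fderiv ℝ h x (b i)) Ω := fun i =>
    (hh.fderiv_of_isOpen hΩ (by norm_num)).clm_apply contDiffOn_const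
  have hψc : ∀ i, ContDiff ℝ 1 (ψ i) := fun i =>
    contDiff_of_contDiffOn_of_tsupport hΩ (hχ.of_le (by simp)) hsΩ (hg i)
  have hψs : ∀ i, HasCompactSupport (ψ i) := fun i => hs.mul_right
  have hψΩ : ∀ i, tsupport (ψ i) ⊆ Ω := fun i => (tsupport_mul_subset_left).trans hsΩ
  have hfd : ∀ i, ∀ x ∈ Ω, fderiv ℝ (ψ i) x (b i)
      = χ x * fderiv ℝ (fderiv ℝ h) x (b i) (b i) + fderiv ℝ χ x (b i) * fderiv ℝ h x (b i) := by
    intro i x hx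
    have hd := hh.differentiableAt_fderiv_of_two hΩ hx
    have h1 : HasFDerivAt (fun x => fderiv ℝ h x (b i))
        ((fderiv ℝ (fderiv ℝ h) x).flip (b i)) x := by
      simpa using hd.hasFDerivAt.clm_apply (hasFDerivAt_const (b i) x)
    have h2 := ((hχ.differentiable (by simp) x).hasFDerivAt).mul h1
    change fderiv ℝ (χ * fun x => fderiv ℝ h x (b i)) x (b i) = _
    rw [h2.fderiv]
    simp only [add_apply, smul_apply, ContinuousLinearMap.flip_apply, smul_eq_mul]
    ring
  have hint1 : ∀ i, IntegrableOn (fun x => φ x * fderiv ℝ (ψ i) x (b i)) Ω := fun i => by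
    have hc : Continuous fun x => fderiv ℝ (ψ i) x (b i) :=
      ((hψc i).continuous_fderiv (by norm_num)).clm_apply continuous_const
    obtain ⟨C, hC⟩ := exists_bound_of_hasCompactSupport hc ((hψs i).fderiv_apply ℝ (b i))
    exact (hφ.integrableOn hfin).mul_bdd (c := C) hc.aestronglyMeasurable
      (Eventually.of_forall hC)
  have hint2 : ∀ i, IntegrableOn (fun x => inner ℝ (Φ x) (b i) * ψ i x) Ω := fun i => by
    obtain ⟨C, hC⟩ := exists_bound_of_hasCompactSupport (hψc i).continuous (hψs i)
    exact (hφ.integrableOn_inner hfin (b i)).mul_bdd (c := C)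
      (hψc i).continuous.aestronglyMeasurable (Eventually.of_forall hC)
  calc ∫ x in Ω, χ x * inner ℝ (gradient h x) (Φ x)
      = ∫ x in Ω, ∑ i, inner ℝ (Φ x) (b i) * ψ i x := by
        refine integral_congr_ae (Eventually.of_forall fun x => ?_)
        simp only [hψ]
        rw [inner_eq_sum_basisFun, Finset.mul_sum]
        refine Finset.sum_congr rfl fun i _ => ?_
        rw [inner_gradient_left]
        ring
    _ = ∑ i, ∫ x in Ω, inner ℝ (Φ x) (b i) * ψ i x := integral_finsetSum _ fun i _ => hint2 i
    _ = ∑ i, - ∫ x in Ω, φ x * fderiv ℝ (ψ i) x (b i) := Finset.sum_congr rfl fun i _ => by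
        rw [hφ.weak_grad_of_contDiff_one hΩ hfin (hψc i) (hψs i) (hψΩ i), neg_neg]
    _ = - ∫ x in Ω, ∑ i, φ x * fderiv ℝ (ψ i) x (b i) := by
        rw [Finset.sum_neg_distrib, integral_finsetSum _ fun i _ => hint1 i]
    _ = _ := by
        congr 1
        refine setIntegral_congr_fun hΩ.measurableSet fun x hx => ?_
        rw [← Finset.mul_sum, Finset.sum_congr rfl fun i _ => hfd i x hx, Finset.sum_add_distrib,
          laplacian_eq_sum, inner_eq_sum_basisFun, Finset.mul_sum]
        simp only [inner_gradient_left, hb]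

/-- `h` is `C²` in `Ω`, with bounded gradient and Laplacian, and its derivative in the direction
`∇ρ` tends to zero linearly at the boundary: the classical form of the Neumann condition for which
Green's formula can be proved by cutting off at the boundary. -/
structure IsNeumannRegular (Ω : Set (EuclideanSpace ℝ (Fin n)))
    (ρ h : EuclideanSpace ℝ (Fin n) → ℝ) : Prop where
  contDiffOn : ContDiffOn ℝ 2 h Ω
  bounded : ∃ C, ∀ x ∈ Ω, |h x| ≤ C
  bounded_fderiv : ∃ C, ∀ x ∈ Ω, ‖fderiv ℝ h x‖ ≤ C
  bounded_laplacian : ∃ C, ∀ x ∈ Ω, |Δ h x| ≤ C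
  normal : ∃ C, ∀ x ∈ Ω, |fderiv ℝ h x (gradient ρ x)| ≤ C * |ρ x|

theorem norm_gradient_eq (h : 𝔼 → ℝ) (x : 𝔼) : ‖gradient h x‖ = ‖fderiv ℝ h x‖ := by
  rw [gradient, LinearIsometryEquiv.norm_map]

theorem continuousOn_gradient (hΩ : IsOpen Ω) {h : 𝔼 → ℝ} (hh : ContDiffOn ℝ 1 h Ω) :
    ContinuousOn (gradient h) Ω :=
  (InnerProductSpace.toDual ℝ 𝔼).symm.continuous.comp_continuousOn
    (hh.continuousOn_fderiv_of_isOpen hΩ (by norm_num))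

theorem integrableOn_inner_gradient (hΩ : IsOpen Ω) (hfin : volume Ω ≠ ⊤) {h : 𝔼 → ℝ}
    (hh : ContDiffOn ℝ 1 h Ω) {C : ℝ} (hC : ∀ x ∈ Ω, ‖fderiv ℝ h x‖ ≤ C) {Φ : 𝔼 → 𝔼}
    (hΦ : MemLp Φ 2 (volume.restrict Ω)) :
    IntegrableOn (fun x => inner ℝ (gradient h x) (Φ x)) Ω := by
  have := isFiniteMeasure_restrict hfin
  refine integrableOn_inner_of_memLp (MemLp.of_bound
    ((continuousOn_gradient hΩ hh).aestronglyMeasurable hΩ.measurableSet) C ?_) hΦ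
  filter_upwards [ae_restrict_mem hΩ.measurableSet] with x hx
  rw [norm_gradient_eq]
  exact hC x hx

theorem integrableOn_mul_laplacian (hΩ : IsOpen Ω) {h φ : 𝔼 → ℝ} (hh : ContDiffOn ℝ 2 h Ω) {C : ℝ}
    (hC : ∀ x ∈ Ω, |Δ h x| ≤ C) (hφ : IntegrableOn φ Ω) :
    IntegrableOn (fun x => φ x * Δ h x) Ω :=
  Integrable.mul_bdd (c := C) hφ ((continuousOn_laplacian hΩ hh).aestronglyMeasurable
    hΩ.measurableSet) ((ae_restrict_mem hΩ.measurableSet).mono fun x hx => hC x hx)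

/-- **Green's formula**. The error made by a cutoff `χₖ` is `∫ φ ∇χₖ · ∇h`, whose integrand is
bounded by a multiple of `|φ|` and tends to zero pointwise. -/
theorem IsNeumannRegular.integral_inner (hbd : Bornology.IsBounded Ω) {ρ h φ : 𝔼 → ℝ} {Φ : 𝔼 → 𝔼}
    (hρ : IsDefiningFunction Ω ρ) (h1 : IsNeumannRegular Ω ρ h) (hφ : MemH1 Ω φ Φ) :
    ∫ x in Ω, inner ℝ (gradient h x) (Φ x) = - ∫ x in Ω, φ x * Δ h x := by
  have hΩ := hρ.isOpen
  have hfin : volume Ω ≠ ⊤ := hbd.measure_lt_top.ne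
  obtain ⟨χ, c, B, hB, hχc, hχs, hχΩ, hχ01, hχ1, hχg, hc0, hcB, hc⟩ := hρ.exists_cutoff hbd
  have hC2 := h1.contDiffOn
  obtain ⟨C₁, hC₁⟩ := h1.bounded_fderiv
  obtain ⟨C₂, hC₂⟩ := h1.bounded_laplacian
  obtain ⟨C₃, hC₃⟩ := h1.normal
  have hφi := hφ.integrableOn hfin
  have hI1 := integrableOn_inner_gradient hΩ hfin (hC2.of_le (by norm_num)) hC₁ hφ.memLp_grad
  have hI2 := integrableOn_mul_laplacian hΩ hC2 hC₂ hφi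
  have hχm : ∀ k, AEStronglyMeasurable (χ k) ((volume : Measure 𝔼).restrict Ω) := fun k =>
    (hχc k).continuous.aestronglyMeasurable
  have hgm : ∀ k, AEStronglyMeasurable (fun x => inner ℝ (gradient (χ k) x) (gradient h x))
      ((volume : Measure 𝔼).restrict Ω) := fun k =>
    (((continuousOn_gradient hΩ ((hχc k).of_le (by simp)).contDiffOn)).inner
      (continuousOn_gradient hΩ (hC2.of_le (by norm_num)))).aestronglyMeasurable hΩ.measurableSet
  have hlim1 : Tendsto (fun k => ∫ x in Ω, χ k x * inner ℝ (gradient h x) (Φ x)) atTop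
      (𝓝 (∫ x in Ω, inner ℝ (gradient h x) (Φ x))) := by
    refine tendsto_integral_of_dominated_convergence _ (fun k => (hχm k).mul hI1.1) hI1.norm ?_ ?_
    · intro k
      refine Eventually.of_forall fun x => ?_
      rw [norm_mul, Real.norm_of_nonneg (hχ01 k x).1]
      exact mul_le_of_le_one_left (norm_nonneg _) (hχ01 k x).2
    · filter_upwards [ae_restrict_mem hΩ.measurableSet] with x hx
      refine tendsto_const_nhds.congr' ?_
      filter_upwards [hχ1 x hx] with k hk
      rw [hk, one_mul]
  have hlim2 : Tendsto (fun k => ∫ x in Ω, φ x * (χ k x * Δ h x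
      + inner ℝ (gradient (χ k) x) (gradient h x))) atTop (𝓝 (∫ x in Ω, φ x * Δ h x)) := by
    refine tendsto_integral_of_dominated_convergence (fun x => ‖φ x‖ * (C₂ + |C₃| * B))
      (fun k => ?_) (hφi.norm.mul_const _) ?_ ?_
    · exact hφi.1.mul (((hχm k).mul ((continuousOn_laplacian hΩ hC2).aestronglyMeasurable
        hΩ.measurableSet)).add (hgm k))
    · intro k
      filter_upwards [ae_restrict_mem hΩ.measurableSet] with x hx
      rw [norm_mul]
      refine mul_le_mul_of_nonneg_left ((norm_add_le _ _).trans (add_le_add ?_ ?_)) (norm_nonneg _)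
      · rw [norm_mul, Real.norm_of_nonneg (hχ01 k x).1]
        exact (mul_le_of_le_one_left (norm_nonneg _) (hχ01 k x).2).trans (hC₂ x hx)
      · rw [hχg, neg_smul, inner_neg_left, inner_smul_left, norm_neg, real_inner_comm,
          inner_gradient_left]
        simp only [RCLike.conj_to_real, norm_mul, Real.norm_eq_abs]
        rw [abs_of_nonneg (hc0 k x)]
        calc c k x * |fderiv ℝ h x (gradient ρ x)| ≤ c k x * (|C₃| * |ρ x|) :=
              mul_le_mul_of_nonneg_left ((hC₃ x hx).trans
                (mul_le_mul_of_nonneg_right (le_abs_self _) (abs_nonneg _))) (hc0 k x)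
          _ = |C₃| * (c k x * |ρ x|) := by ring
          _ ≤ |C₃| * B := mul_le_mul_of_nonneg_left (hcB k x hx) (abs_nonneg _)
    · filter_upwards [ae_restrict_mem hΩ.measurableSet] with x hx
      refine tendsto_const_nhds.congr' ?_
      filter_upwards [hχ1 x hx, hc x hx] with k hk hk'
      rw [hk, one_mul, hχg, hk', neg_zero, zero_smul, inner_zero_left, add_zero]
  exact tendsto_nhds_unique (hlim1.congr fun k =>
    hφ.integral_cutoff_inner hΩ hfin hC2 (hχc k) (hχs k) (hχΩ k)) hlim2.neg

/-- A function satisfying the classical Neumann condition is `(I - Δ)⁻¹[h - Δh]`. -/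
theorem IsNeumannRegular.isNeumannInv (hbd : Bornology.IsBounded Ω) {ρ h : 𝔼 → ℝ}
    (hρ : IsDefiningFunction Ω ρ) (h1 : IsNeumannRegular Ω ρ h) :
    IsNeumannInv Ω (fun x => h x - Δ h x) h := by
  have hΩ := hρ.isOpen
  have hfin : volume Ω ≠ ⊤ := hbd.measure_lt_top.ne
  have := isFiniteMeasure_restrict hfin
  have hC2 := h1.contDiffOn
  obtain ⟨C₀, hC₀⟩ := h1.bounded
  obtain ⟨C₁, hC₁⟩ := h1.bounded_fderiv
  obtain ⟨C₂, hC₂⟩ := h1.bounded_laplacian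
  have hm : AEStronglyMeasurable (Δ h) ((volume : Measure 𝔼).restrict Ω) :=
    (continuousOn_laplacian hΩ hC2).aestronglyMeasurable hΩ.measurableSet
  have hmem := memH1_of_contDiffOn hΩ hfin (hC2.of_le (by norm_num)) hC₀ hC₁
  refine ⟨hC2.continuousOn, hmem.memLp.sub (MemLp.of_bound hm C₂
    ((ae_restrict_mem hΩ.measurableSet).mono fun x hx => hC₂ x hx)), gradient h, hmem,
    fun φ Φ hφ => ?_⟩
  have hφi := hφ.integrableOn hfin
  have hI1 := integrableOn_inner_gradient hΩ hfin (hC2.of_le (by norm_num)) hC₁ hφ.memLp_grad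
  have hI2 := integrableOn_mul_laplacian hΩ hC2 hC₂ hφi
  have hI3 := integrableOn_mul_of_memLp hmem.memLp hφ.memLp
  rw [integral_add hI1 hI3, h1.integral_inner hbd hρ hφ, ← integral_neg,
    ← integral_add (f := fun x => -(φ x * Δ h x)) hI2.neg hI3]
  refine integral_congr_ae (Eventually.of_forall fun x => ?_)
  change -(φ x * Δ h x) + h x * φ x = (h x - Δ h x) * φ x
  ring

/-! ### A lower bound for the Neumann inverse -/

/-- The strong maximum principle: a nonnegative right-hand side with positive mass gives a solution
which is positive at every point of a connected domain. -/
theorem IsNeumannInv.pos (hΩ : IsOpen Ω) (hcon : IsPreconnected Ω) (hfin : volume Ω ≠ ⊤)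
    {f w : 𝔼 → ℝ} (h : IsNeumannInv Ω f w) (hf : ∀ x ∈ Ω, 0 ≤ f x) (hpos : 0 < ∫ x in Ω, f x) :
    ∀ x ∈ Ω, 0 < w x := by
  have hw := h.nonneg hΩ hfin hf
  have hwi := h.2.integrableOn hfin
  set Z := {x | ∀ᶠ y in 𝓝 x, w y = 0}
  -- by the Harnack inequality the zero set is open
  have hzero : ∀ x ∈ Ω, w x = 0 → x ∈ Z := fun x hx h0 => by
    obtain ⟨R, hR, hball⟩ := nhds_basis_closedBall.mem_iff.1 (hΩ.mem_nhds hx)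
    have h1 := h.meanAvg_le hΩ hfin hf (half_pos hR) (half_lt_self hR) hball
    rw [h0, mul_zero] at h1
    have h2 : ∫ y in Ω, w y * meanKernel (R / 2) (y - x) = 0 := by
      refine le_antisymm ?_ (setIntegral_nonneg hΩ.measurableSet fun y hy =>
        mul_nonneg (hw y hy) (meanKernel_nonneg (half_pos hR) _))
      by_contra hn
      exact absurd h1 (not_le.2 (mul_pos (Real.exp_pos _) (not_le.1 hn)))
    have h3 := (setIntegral_eq_zero_iff_of_nonneg_ae (by
      filter_upwards [ae_restrict_mem hΩ.measurableSet] with y hy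
      exact mul_nonneg (hw y hy) (meanKernel_nonneg (half_pos hR) _))
      (integrableOn_mul_meanKernel hwi (half_pos hR) x)).1 h2
    have hsub : ball x (R / 2) ⊆ Ω := fun y hy => hball (by
      rw [mem_closedBall]; have := mem_ball.1 hy; linarith)
    have h4 : ∀ y ∈ ball x (R / 2), w y ≤ 0 := by
      refine forall_le_of_ae isOpen_ball (h.1.mono hsub) continuousOn_const ?_
      filter_upwards [ae_restrict_of_ae_restrict_of_subset hsub h3,
        ae_restrict_mem isOpen_ball.measurableSet] with y hy hyb
      have h5 : 0 < meanKernel (R / 2) (y - x) :=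
        meanKernel_pos (half_pos hR) (by rw [← dist_eq_norm]; exact mem_ball.1 hyb)
      have h6 : w y * meanKernel (R / 2) (y - x) = 0 := hy
      exact (mul_eq_zero.1 h6).elim le_of_eq fun h => absurd h h5.ne'
    filter_upwards [ball_mem_nhds x (half_pos hR)] with y hy
    exact le_antisymm (h4 y hy) (hw y (hsub hy))
  have hZo : IsOpen Z := isOpen_setOfPred_eventually_nhds
  have hPo : IsOpen (Ω ∩ w ⁻¹' Ioi 0) := h.1.isOpen_inter_preimage hΩ isOpen_Ioi
  have hcover : Ω ⊆ (Ω ∩ w ⁻¹' Ioi 0) ∪ Z := fun x hx => by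
    rcases (hw x hx).eq_or_lt with h0 | h0
    · exact Or.inr (hzero x hx h0.symm)
    · exact Or.inl ⟨hx, h0⟩
  have hdisj : Ω ∩ ((Ω ∩ w ⁻¹' Ioi 0) ∩ Z) = ∅ := by
    ext x
    simp only [mem_inter_iff, mem_empty_iff_false, iff_false]
    rintro ⟨_, ⟨_, h1⟩, h2⟩
    have h3 : w x = 0 := Eventually.self_of_nhds (p := fun y => w y = 0) h2
    have h4 : 0 < w x := h1
    exact h4.ne' h3
  rcases isPreconnected_iff_subset_of_disjoint.1 hcon _ _ hPo hZo hcover hdisj with h1 | h1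
  · exact fun x hx => (h1 hx).2
  · exfalso
    rw [← h.2.integral_eq hΩ hfin, setIntegral_congr_fun (g := fun _ => (0 : ℝ)) hΩ.measurableSet
      fun x hx => Eventually.self_of_nhds (p := fun y => w y = 0) (h1 hx)] at hpos
    simp at hpos

/-- The weak maximum principle, where the sign of the right-hand side is only needed on the set
where the solution is positive. -/
theorem IsWeakNeumannSolution.nonpos_of_mul_nonpos (hΩ : IsOpen Ω) (hfin : volume Ω ≠ ⊤)
    {f w : 𝔼 → ℝ} (h : IsWeakNeumannSolution Ω f w)
    (hf : ∀ x ∈ Ω, f x * smoothPosPart (w x) ≤ 0) :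
    ∀ᵐ x ∂((volume : Measure 𝔼).restrict Ω), w x ≤ 0 := by
  obtain ⟨hf2, G, hG, e⟩ := h
  refine hG.nonpos_of_energy_le hΩ hfin ?_
  rw [e _ _ (hG.comp hΩ hfin contDiff_smoothPosPart abs_deriv_smoothPosPart_le)]
  exact integral_nonpos_of_ae ((ae_restrict_mem hΩ.measurableSet).mono fun x hx => hf x hx)

section Barrier

theorem ContDiff.two_of_infty {ρ : 𝔼 → ℝ} (hρ : ContDiff ℝ ∞ ρ) : ContDiff ℝ 2 ρ :=
  contDiff_infty.1 hρ 2

variable {ρ : EuclideanSpace ℝ (Fin n) → ℝ}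

theorem hasFDerivAt_exp_neg_mul {ρ : 𝔼 → ℝ} {x : 𝔼} (hρ : DifferentiableAt ℝ ρ x) (α : ℝ) :
    HasFDerivAt (fun y => Real.exp (-(α * ρ y)))
      (-(α * Real.exp (-(α * ρ x))) • fderiv ℝ ρ x) x := by
  have h1 := ((hρ.hasFDerivAt.const_mul α).neg).exp
  convert! h1 using 1
  rw [smul_neg, smul_smul, neg_smul, mul_comm]
  rfl

theorem laplacian_exp_neg_mul {ρ : 𝔼 → ℝ} (hρ : ContDiff ℝ ∞ ρ) (α : ℝ) (x : 𝔼) :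
    Δ (fun y => Real.exp (-(α * ρ y))) x
      = Real.exp (-(α * ρ x)) * (α ^ 2 * ‖gradient ρ x‖ ^ 2 - α * Δ ρ x) := by
  have hd : Differentiable ℝ ρ := hρ.differentiable (by simp)
  have hd' : DifferentiableAt ℝ (fderiv ℝ ρ) x :=
    (hρ.fderiv_right (m := ∞) (by simp)).differentiable (by simp) x
  have h1 : fderiv ℝ (fun y => Real.exp (-(α * ρ y)))
      = fun y => (-(α * Real.exp (-(α * ρ y)))) • fderiv ℝ ρ y :=
    funext fun y => (hasFDerivAt_exp_neg_mul (hd y) α).fderiv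
  have h2 : HasFDerivAt (fun y => -(α * Real.exp (-(α * ρ y))))
      ((α ^ 2 * Real.exp (-(α * ρ x))) • fderiv ℝ ρ x) x := by
    convert! ((hasFDerivAt_exp_neg_mul (hd x) α).const_mul α).neg using 1
    rw [smul_smul, ← neg_smul]
    congr 1
    ring
  have h3 := h2.smul hd'.hasFDerivAt
  rw [laplacian_eq_sum, h1]
  change ∑ i, fderiv ℝ ((fun y => -(α * Real.exp (-(α * ρ y)))) • fderiv ℝ ρ) x _ _ = _
  rw [h3.fderiv, laplacian_eq_sum, ← real_inner_self_eq_norm_sq, inner_eq_sum_basisFun]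
  simp only [add_apply, smul_apply, ContinuousLinearMap.smulRight_apply, smul_eq_mul,
    inner_gradient_left]
  rw [Finset.sum_add_distrib, mul_sub, Finset.mul_sum, Finset.mul_sum, Finset.mul_sum,
    Finset.mul_sum, ← Finset.sum_sub_distrib, ← Finset.sum_add_distrib]
  exact Finset.sum_congr rfl fun i _ => by ring

/-- Green's inequality for `s = exp (-α ρ)`, whose normal derivative at the boundary is
nonpositive. -/
theorem IsDefiningFunction.integral_inner_exp_le (hbd : Bornology.IsBounded Ω)
    (hρ : IsDefiningFunction Ω ρ) {α : ℝ} (hα : 0 ≤ α) {φ : 𝔼 → ℝ} {Φ : 𝔼 → 𝔼} (hφ : MemH1 Ω φ Φ)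
    (hφ0 : ∀ x ∈ Ω, 0 ≤ φ x) :
    ∫ x in Ω, inner ℝ (gradient (fun y => Real.exp (-(α * ρ y))) x) (Φ x)
      ≤ - ∫ x in Ω, φ x * Δ (fun y => Real.exp (-(α * ρ y))) x := by
  have hΩ := hρ.isOpen
  have hfin : volume Ω ≠ ⊤ := hbd.measure_lt_top.ne
  obtain ⟨χ, c, B, hB, hχc, hχs, hχΩ, hχ01, hχ1, hχg, hc0, hcB, hc⟩ := hρ.exists_cutoff hbd
  set s : 𝔼 → ℝ := fun y => Real.exp (-(α * ρ y)) with hs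
  have hsc : ContDiff ℝ ∞ s := Real.contDiff_exp.comp (contDiff_const.mul hρ.contDiff).neg
  have hC2 : ContDiffOn ℝ 2 s Ω := hsc.two_of_infty.contDiffOn
  have hsc2 : ContDiff ℝ 2 s := hsc.two_of_infty
  obtain ⟨C₁, hC₁⟩ := hbd.isCompact_closure.exists_bound_of_continuousOn
    (hsc.continuous_fderiv (by simp)).continuousOn
  have hΔc : Continuous (Δ s) := by
    rw [← continuousOn_univ]
    exact continuousOn_laplacian isOpen_univ hsc2.contDiffOn
  obtain ⟨C₂, hC₂⟩ := hbd.isCompact_closure.exists_bound_of_continuousOn hΔc.continuousOn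
  have hφi := hφ.integrableOn hfin
  have hI1 := integrableOn_inner_gradient hΩ hfin (hC2.of_le (by norm_num))
    (fun x hx => hC₁ x (subset_closure hx)) hφ.memLp_grad
  have hI2 := integrableOn_mul_laplacian hΩ hC2 (fun x hx => hC₂ x (subset_closure hx)) hφi
  have hχm : ∀ k, AEStronglyMeasurable (χ k) ((volume : Measure 𝔼).restrict Ω) := fun k =>
    (hχc k).continuous.aestronglyMeasurable
  have hχb : ∀ k x, ‖χ k x‖ ≤ 1 := fun k x => by
    rw [Real.norm_of_nonneg (hχ01 k x).1]
    exact (hχ01 k x).2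
  have hlim : ∀ g : 𝔼 → ℝ, IntegrableOn g Ω →
      Tendsto (fun k => ∫ x in Ω, χ k x * g x) atTop (𝓝 (∫ x in Ω, g x)) := fun g hg => by
    refine tendsto_integral_of_dominated_convergence _ (fun k => (hχm k).mul hg.1) hg.norm ?_ ?_
    · intro k
      refine Eventually.of_forall fun x => ?_
      rw [norm_mul]
      exact mul_le_of_le_one_left (norm_nonneg _) (hχb k x)
    · filter_upwards [ae_restrict_mem hΩ.measurableSet] with x hx
      refine tendsto_const_nhds.congr' ?_
      filter_upwards [hχ1 x hx] with k hk
      rw [hk, one_mul]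
  refine le_of_tendsto_of_tendsto (hlim _ hI1) (hlim _ hI2).neg (Eventually.of_forall fun k => ?_)
  beta_reduce
  rw [hφ.integral_cutoff_inner hΩ hfin hC2 (hχc k) (hχs k) (hχΩ k)]
  refine neg_le_neg ?_
  have hgc : Continuous fun x => inner ℝ (gradient (χ k) x) (gradient s x) := by
    rw [← continuousOn_univ]
    exact (continuousOn_gradient isOpen_univ ((hχc k).of_le (by simp)).contDiffOn).inner
      (continuousOn_gradient isOpen_univ (hsc.of_le (by simp)).contDiffOn)
  obtain ⟨C₃, hC₃⟩ := hbd.isCompact_closure.exists_bound_of_continuousOn hgc.continuousOn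
  have hI3 : IntegrableOn (fun x => φ x * inner ℝ (gradient (χ k) x) (gradient s x)) Ω :=
    Integrable.mul_bdd (c := C₃) hφi hgc.aestronglyMeasurable
      ((ae_restrict_mem hΩ.measurableSet).mono fun x hx => hC₃ x (subset_closure hx))
  have hI4 : IntegrableOn (fun x => χ k x * (φ x * Δ s x)) Ω :=
    Integrable.bdd_mul (c := 1) hI2 (hχm k) (Eventually.of_forall (hχb k))
  refine setIntegral_mono_on hI4 ((hI4.add hI3).congr (Eventually.of_forall fun x => ?_))
    hΩ.measurableSet fun x hx => ?_
  · simp only [Pi.add_apply]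
    ring
  · have h1 : gradient s x = (-(α * s x)) • gradient ρ x := by
      rw [gradient, (hasFDerivAt_exp_neg_mul (hρ.contDiff.differentiable (by simp) x) α).fderiv,
        map_smul, gradient]
    have h2 : 0 ≤ inner ℝ (gradient (χ k) x) (gradient s x) := by
      rw [h1, hχg, inner_smul_left, inner_smul_right, real_inner_self_eq_norm_sq]
      simp only [RCLike.conj_to_real]
      have h3 : 0 ≤ s x := (Real.exp_pos _).le
      have h4 := hc0 k x
      have : -c k x * (-(α * s x) * ‖gradient ρ x‖ ^ 2)
          = c k x * (α * s x * ‖gradient ρ x‖ ^ 2) := by ring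
      rw [this]
      positivity
    nlinarith [mul_nonneg (hφ0 x hx) h2]

/-- Comparison with the subsolution `exp (-α ρ)` in a collar of `∂Ω` shows that a solution which is
positive inside is bounded away from zero up to the boundary. -/
theorem IsNeumannInv.exists_pos_le (hΩs : IsSmoothBoundedDomain Ω) {f w : 𝔼 → ℝ}
    (h : IsNeumannInv Ω f w) (hf : ∀ x ∈ Ω, 0 ≤ f x) (hw : ∀ x ∈ Ω, 0 < w x) :
    ∃ c > 0, ∀ x ∈ Ω, c ≤ w x := by
  obtain ⟨ρ, hρ⟩ := hΩs.exists_isDefiningFunction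
  have hbd := hΩs.isBounded
  have hΩ := hρ.isOpen
  have hfin : volume Ω ≠ ⊤ := hbd.measure_lt_top.ne
  obtain ⟨δ, hδ, g, hg, hgrad⟩ := hρ.exists_gradient_ge hbd
  obtain ⟨κ, hκ, hκw⟩ : ∃ κ > 0, ∀ x, ρ x ≤ -δ → κ ≤ w x := by
    have hK := hρ.isCompact_le hbd hδ
    have hsub : {x | ρ x ≤ -δ} ⊆ Ω := fun x (hx : ρ x ≤ -δ) => (hρ.mem_iff x).2 (by linarith)
    rcases {x | ρ x ≤ -δ}.eq_empty_or_nonempty with he | hne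
    · exact ⟨1, one_pos, fun x hx => absurd (show x ∈ {x | ρ x ≤ -δ} from hx) (by simp [he])⟩
    · obtain ⟨x₀, hx₀, hmin⟩ := hK.exists_isMinOn hne (h.1.mono hsub)
      exact ⟨w x₀, hw x₀ (hsub hx₀), fun x hx => hmin hx⟩
  have hΔρ : Continuous (Δ ρ) := by
    rw [← continuousOn_univ]
    exact continuousOn_laplacian isOpen_univ hρ.contDiff.two_of_infty.contDiffOn
  obtain ⟨D, hD⟩ := hbd.isCompact_closure.exists_bound_of_continuousOn hΔρ.continuousOn
  -- for this `α`, the function `s = exp (-α ρ)` satisfies `s ≤ Δs` in the collar `-δ < ρ`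
  obtain ⟨α, hα0, hα⟩ : ∃ α : ℝ, 0 ≤ α ∧ 1 ≤ α ^ 2 * g ^ 2 - α * |D| := by
    have hg2 : 0 < g ^ 2 := by positivity
    refine ⟨(1 + |D|) / g ^ 2 + 1, by positivity, ?_⟩
    have h1 : ((1 + |D|) / g ^ 2 + 1) * g ^ 2 = 1 + |D| + g ^ 2 := by
      field_simp
    have h2 : 1 ≤ (1 + |D|) / g ^ 2 + 1 := le_add_of_nonneg_left (by positivity)
    nlinarith [abs_nonneg D]
  set s : 𝔼 → ℝ := fun y => Real.exp (-(α * ρ y)) with hs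
  have hsc : ContDiff ℝ ∞ s := Real.contDiff_exp.comp (contDiff_const.mul hρ.contDiff).neg
  have hs1 : ∀ x ∈ Ω, 1 ≤ s x := fun x hx => Real.one_le_exp (by
    have := (hρ.mem_iff x).1 hx
    nlinarith)
  obtain ⟨S, hS⟩ := hbd.isCompact_closure.exists_bound_of_continuousOn hsc.continuous.continuousOn
  obtain ⟨C₁, hC₁⟩ := hbd.isCompact_closure.exists_bound_of_continuousOn
    (hsc.continuous_fderiv (by simp)).continuousOn
  have hΔc : Continuous (Δ s) := by
    rw [← continuousOn_univ]
    exact continuousOn_laplacian isOpen_univ hsc.two_of_infty.contDiffOn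
  obtain ⟨C₂, hC₂⟩ := hbd.isCompact_closure.exists_bound_of_continuousOn hΔc.continuousOn
  -- `ε s ≤ κ ≤ w` outside the collar, so that `(ε s - w)⁺` is supported in the collar
  set ε := κ / (|S| + 1) with hε
  have hε0 : 0 < ε := by positivity
  have hεs : ∀ x ∈ Ω, ε * s x ≤ κ := fun x hx => by
    have h1 : s x ≤ |S| + 1 := by
      have := hS x (subset_closure hx)
      have h2 := le_abs_self S
      have h3 := le_abs_self (s x)
      rw [Real.norm_eq_abs] at this
      linarith
    calc ε * s x ≤ ε * (|S| + 1) := mul_le_mul_of_nonneg_left h1 hε0.le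
      _ = κ := div_mul_cancel₀ _ (by positivity)
  have hcont := h.1
  obtain ⟨-, -, G, hG, e⟩ := h
  have hmem : MemH1 Ω s (gradient s) :=
    memH1_of_contDiffOn hΩ hfin (hsc.of_le (by simp)).contDiffOn
      (fun x hx => hS x (subset_closure hx)) (fun x hx => hC₁ x (subset_closure hx))
  have hW := hmem.linear_comb hfin hG ε (-1)
  have hP := hW.comp hΩ hfin contDiff_smoothPosPart abs_deriv_smoothPosPart_le
  set W : 𝔼 → ℝ := fun x => ε * s x + -1 * w x with hWdef
  set Φ : 𝔼 → 𝔼 := fun x => deriv smoothPosPart (W x) • (ε • gradient s x + (-1 : ℝ) • G x) with hΦ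
  have hle : ∀ᵐ x ∂((volume : Measure 𝔼).restrict Ω), W x ≤ 0 := by
    refine hW.nonpos_of_energy_le hΩ hfin ?_
    have hI1 := integrableOn_inner_of_memLp hmem.memLp_grad hP.memLp_grad
    have hI2 := integrableOn_mul_of_memLp hmem.memLp hP.memLp
    have hI3 := integrableOn_inner_of_memLp hG.memLp_grad hP.memLp_grad
    have hI4 := integrableOn_mul_of_memLp hG.memLp hP.memLp
    have hI5 := integrableOn_mul_laplacian hΩ hsc.two_of_infty.contDiffOn
      (fun x hx => hC₂ x (subset_closure hx)) (hP.integrableOn hfin)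
    have h1 : ∫ x in Ω, (inner ℝ (gradient s x) (Φ x) + s x * smoothPosPart (W x)) ≤ 0 := by
      rw [integral_add hI1 hI2]
      have h2 := hρ.integral_inner_exp_le hbd hα0 hP (fun x _ => smoothPosPart_nonneg _)
      have h3 : (∫ x in Ω, s x * smoothPosPart (W x)) ≤ ∫ x in Ω, smoothPosPart (W x) * Δ s x := by
        refine setIntegral_mono_on hI2 hI5 hΩ.measurableSet fun x hx => ?_
        rcases le_or_gt (ρ x) (-δ) with hxδ | hxδ
        · have : W x ≤ 0 := by
            simp only [hWdef]
            linarith [hκw x hxδ, hεs x hx]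
          rw [smoothPosPart_of_nonpos this]
          simp
        · rw [mul_comm]
          refine mul_le_mul_of_nonneg_left ?_ (smoothPosPart_nonneg _)
          rw [hs, laplacian_exp_neg_mul hρ.contDiff]
          refine le_mul_of_one_le_right (Real.exp_pos _).le (hα.trans ?_)
          have h4 : Δ ρ x ≤ |D| := by
            have := hD x (subset_closure hx)
            rw [Real.norm_eq_abs] at this
            exact (le_abs_self _).trans (this.trans (le_abs_self _))
          have h5 : g ^ 2 ≤ ‖gradient ρ x‖ ^ 2 := pow_le_pow_left₀ hg.le (hgrad x hx hxδ) 2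
          nlinarith [mul_le_mul_of_nonneg_left h4 hα0, mul_le_mul_of_nonneg_left h5 (sq_nonneg α)]
      linarith
    have h2 : 0 ≤ ∫ x in Ω, (inner ℝ (G x) (Φ x) + w x * smoothPosPart (W x)) := by
      rw [e _ _ hP]
      exact setIntegral_nonneg hΩ.measurableSet fun x hx =>
        mul_nonneg (hf x hx) (smoothPosPart_nonneg _)
    have h3 : ∫ x in Ω, (inner ℝ (ε • gradient s x + (-1 : ℝ) • G x) (Φ x)
        + W x * smoothPosPart (W x))
        = ε * (∫ x in Ω, (inner ℝ (gradient s x) (Φ x) + s x * smoothPosPart (W x)))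
          - ∫ x in Ω, (inner ℝ (G x) (Φ x) + w x * smoothPosPart (W x)) := by
      rw [← integral_const_mul, ← integral_sub
        (f := fun x => ε * (inner ℝ (gradient s x) (Φ x) + s x * smoothPosPart (W x)))
        (g := fun x => inner ℝ (G x) (Φ x) + w x * smoothPosPart (W x))
        ((hI1.add hI2).const_mul ε) (hI3.add hI4)]
      refine integral_congr_ae (Eventually.of_forall fun x => ?_)
      simp only [inner_add_left, inner_smul_left, RCLike.conj_to_real]
      simp only [hWdef]
      ring
    rw [h3]
    nlinarith
  have hfinal := forall_le_of_ae hΩ (w₁ := W) (w₂ := fun _ => 0)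
    ((continuousOn_const.mul hsc.continuous.continuousOn).add (continuousOn_const.mul hcont))
    continuousOn_const hle
  refine ⟨ε, hε0, fun x hx => ?_⟩
  have h1 := hfinal x hx
  simp only [hWdef] at h1
  nlinarith [hs1 x hx]

end Barrier

/-- The solution of the Neumann problem with a nonnegative right-hand side is bounded below by a
multiple of the mass. With a bump `χ` and `h = (I - Δ)⁻¹ χ ≥ c₀`, symmetry gives
`∫ w χ = ∫ f h ≥ c₀ ∫ f`; the Harnack inequality turns this into a pointwise bound
`w ≥ λ` on the support of `χ`, and `λ h` is a subsolution elsewhere. -/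
theorem IsSmoothBoundedDomain.exists_mass_le (hΩs : IsSmoothBoundedDomain Ω) :
    ∃ c > 0, ∀ f w : 𝔼 → ℝ, IsNeumannInv Ω f w → (∀ x ∈ Ω, 0 ≤ f x) →
      ∀ x ∈ Ω, c * (∫ y in Ω, f y) ≤ w x := by
  have hΩ := hΩs.isOpen
  have hfin : volume Ω ≠ ⊤ := hΩs.isBounded.measure_lt_top.ne
  obtain ⟨x₀, hx₀⟩ := hΩs.isConnected.nonempty
  obtain ⟨r', hr', hball'⟩ := nhds_basis_closedBall.mem_iff.1 (hΩ.mem_nhds hx₀)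
  -- for `x`, `y` in the ball of radius `r`, the kernel of radius `3 r` at `x` is positive at `y`, and
  -- the ball of radius `4 r` about `x` is still contained in the domain
  set r := r' / 5 with hr
  have hr0 : 0 < r := by positivity
  let χ : ContDiffBump x₀ := ⟨r / 2, r, by positivity, by linarith⟩
  have hχsupp : ∀ x, χ x ≠ 0 → x ∈ ball x₀ r := fun x hx => by
    have : x ∈ Function.support χ := hx
    rwa [χ.support_eq] at this
  have hχΩ : ball x₀ r ⊆ Ω := fun x hx => hball' (by
    rw [mem_closedBall]; have := mem_ball.1 hx; linarith)
  obtain ⟨h, hh⟩ := exists_isNeumannInv hΩ hfin (f := χ) zero_le_one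
    χ.continuous.aestronglyMeasurable (Eventually.of_forall fun x => by
      rw [abs_of_nonneg χ.nonneg]; exact χ.le_one)
  have hχ0 : ∀ x ∈ Ω, 0 ≤ χ x := fun x _ => χ.nonneg
  have hχi : IntegrableOn χ Ω := hh.2.integrableOn_right hfin
  have hχpos : 0 < ∫ x in Ω, χ x := by
    rw [setIntegral_eq_integral_of_forall_compl_eq_zero fun x hx => by
      by_contra hn
      exact hx (hχΩ (hχsupp x hn))]
    exact χ.integral_pos
  obtain ⟨c₀, hc₀, hc₀h⟩ := hh.exists_pos_le hΩs hχ0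
    (hh.pos hΩ hΩs.isConnected.isPreconnected hfin hχ0 hχpos)
  have hh1 : ∀ x ∈ Ω, h x ≤ 1 := fun x hx => (le_abs_self _).trans
    (hh.abs_le hΩ hfin (M := 1) (fun y _ => by rw [abs_of_nonneg χ.nonneg]; exact χ.le_one) x hx)
  obtain ⟨a, ha, hak⟩ : ∃ a > 0, ∀ z : 𝔼, ‖z‖ ≤ 2 * r → a ≤ meanKernel (3 * r) z := by
    obtain ⟨z₀, hz₀, hmin⟩ := (isCompact_closedBall (0 : 𝔼) (2 * r)).exists_isMinOn
      ⟨0, mem_closedBall_self (by positivity)⟩ (continuous_meanKernel (3 * r)).continuousOn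
    refine ⟨_, meanKernel_pos (by positivity : 0 < 3 * r) (z := z₀) ?_,
      fun z hz => hmin (mem_closedBall_zero_iff.2 hz)⟩
    have := mem_closedBall_zero_iff.1 hz₀
    linarith
  have hZ := meanKernelMass_pos (n := n)
  set b := Real.exp (-((3 * r) ^ 2 / 2)) * a / meanKernelMass n with hb
  have hb0 : 0 < b := by positivity
  refine ⟨b * c₀ * c₀, by positivity, fun f w hw hf => ?_⟩
  have hw0 := hw.nonneg hΩ hfin hf
  have hwi := hw.2.integrableOn hfin
  have hfi := hw.2.integrableOn_right hfin
  set m := ∫ y in Ω, f y with hm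
  have hm0 : 0 ≤ m := setIntegral_nonneg hΩ.measurableSet hf
  have h1 : c₀ * m ≤ ∫ x in Ω, χ x * w x := by
    rw [hh.2.integral_mul_comm hw.2, hm, ← integral_const_mul]
    refine setIntegral_mono_on (hfi.const_mul _) ?_ hΩ.measurableSet fun x hx => ?_
    · obtain ⟨_, G, hG, _⟩ := hh.2
      exact integrableOn_mul_of_memLp hw.2.1 hG.memLp
    · rw [mul_comm]
      exact mul_le_mul_of_nonneg_left (hc₀h x hx) (hf x hx)
  have h2 : ∀ x ∈ ball x₀ r, b * c₀ * m ≤ w x := fun x hx => by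
    have hball : closedBall x (4 * r) ⊆ Ω := fun y hy => hball' (by
      rw [mem_closedBall] at hy ⊢
      have := mem_ball.1 hx
      linarith [dist_triangle y x x₀])
    have h3 := hw.meanAvg_le hΩ hfin hf (by positivity : 0 < 3 * r) (by linarith) hball
    have h4 : a * (∫ y in Ω, χ y * w y) ≤ meanAvg Ω w (3 * r) x := by
      rw [meanAvg, ← integral_const_mul]
      refine setIntegral_mono_on ?_ (integrableOn_mul_meanKernel hwi (by positivity) x)
        hΩ.measurableSet fun y hy => ?_
      · refine Integrable.const_mul (Integrable.bdd_mul (c := 1) hwi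
          χ.continuous.aestronglyMeasurable (Eventually.of_forall fun y => ?_)) a
        rw [Real.norm_of_nonneg χ.nonneg]
        exact χ.le_one
      · rcases eq_or_ne (χ y) 0 with h0 | h0
        · rw [h0, zero_mul, mul_zero]
          exact mul_nonneg (hw0 y hy) (meanKernel_nonneg (by positivity) _)
        · have h5 := mem_ball.1 (hχsupp y h0)
          have h6 := mem_ball.1 hx
          have h7 : a ≤ meanKernel (3 * r) (y - x) := hak _ (by
            rw [← dist_eq_norm]
            linarith [dist_triangle_right y x x₀])
          have h8 : χ y * w y ≤ w y := mul_le_of_le_one_left (hw0 y hy) χ.le_one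
          calc a * (χ y * w y) ≤ a * w y := mul_le_mul_of_nonneg_left h8 ha.le
            _ ≤ meanKernel (3 * r) (y - x) * w y := mul_le_mul_of_nonneg_right h7 (hw0 y hy)
            _ = _ := mul_comm _ _
    have h5 : Real.exp (-((3 * r) ^ 2 / 2)) * (a * (c₀ * m)) ≤ meanKernelMass n * w x :=
      (mul_le_mul_of_nonneg_left ((mul_le_mul_of_nonneg_left h1 ha.le).trans h4)
        (Real.exp_pos _).le).trans h3
    have h6 : b * c₀ * m = Real.exp (-((3 * r) ^ 2 / 2)) * (a * (c₀ * m)) / meanKernelMass n := by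
      rw [hb]; ring
    rw [h6, div_le_iff₀ hZ, mul_comm (w x)]
    exact h5
  set l := b * c₀ * m with hl
  have hl0 : 0 ≤ l := by positivity
  have h3 : ∀ᵐ x ∂((volume : Measure 𝔼).restrict Ω), l * h x + -1 * w x ≤ 0 := by
    refine (hh.2.linear_comb hfin hw.2 l (-1)).nonpos_of_mul_nonpos hΩ hfin fun x hx => ?_
    rcases eq_or_ne (χ x) 0 with h0 | h0
    · refine mul_nonpos_of_nonpos_of_nonneg ?_ (smoothPosPart_nonneg _)
      rw [h0]
      linarith [hf x hx]
    · rw [smoothPosPart_of_nonpos, mul_zero]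
      have h4 := h2 x (hχsupp x h0)
      nlinarith [hh1 x hx]
  intro x hx
  have h4 := forall_le_of_ae hΩ (w₁ := fun x => l * h x + -1 * w x)
    ((continuousOn_const.mul hh.1).add (continuousOn_const.mul hw.1))
    continuousOn_const h3 x hx
  have h5 := mul_le_mul_of_nonneg_left (hc₀h x hx) hl0
  have h6 : b * c₀ * c₀ * m = l * c₀ := by rw [hl]; ring
  rw [h6]
  beta_reduce at h4
  linarith

/-! ### The Neumann condition in quantitative form -/

/-- The derivative along `∇ρ` of a function with the Neumann boundary condition is `O(|ρ|)`: from a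
point near the boundary, follow the direction `∇ρ` to a boundary point, where the derivative
vanishes. -/
theorem IsDefiningFunction.exists_normal_le (hbd : Bornology.IsBounded Ω) {ρ h : 𝔼 → ℝ}
    (hρ : IsDefiningFunction Ω ρ) (hh : ContDiffOn ℝ 2 h Ω) {C : ℝ}
    (hC₁ : ∀ x ∈ Ω, ‖fderiv ℝ h x‖ ≤ C) (hC₂ : ∀ x ∈ Ω, ‖fderiv ℝ (fderiv ℝ h) x‖ ≤ C)
    (hN : NeumannBC Ω h) : ∃ K, ∀ x ∈ Ω, |fderiv ℝ h x (gradient ρ x)| ≤ K * |ρ x| := by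
  have hΩ := hρ.isOpen
  rcases Ω.eq_empty_or_nonempty with he | ⟨x₁, hx₁⟩
  · exact ⟨0, by simp [he]⟩
  have hC0 : 0 ≤ C := (norm_nonneg _).trans (hC₁ x₁ hx₁)
  obtain ⟨δ, hδ, c, hc, hgrad⟩ := hρ.exists_gradient_ge hbd
  obtain ⟨R, hR⟩ := hbd.subset_closedBall (0 : 𝔼)
  have hgc := hρ.contDiff_gradient
  obtain ⟨L, hL⟩ := (isCompact_closedBall (0 : 𝔼) (R + 1)).exists_bound_of_continuousOn
    hgc.continuous.continuousOn
  obtain ⟨H, hH⟩ := (isCompact_closedBall (0 : 𝔼) (R + 1)).exists_bound_of_continuousOn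
    (hgc.continuous_fderiv (by simp)).continuousOn
  have hx₁' : x₁ ∈ closedBall (0 : 𝔼) (R + 1) := closedBall_subset_closedBall (by linarith) (hR hx₁)
  have hL0 : 0 ≤ L := (norm_nonneg _).trans (hL _ hx₁')
  have hH0 : 0 ≤ H := (norm_nonneg _).trans (hH _ hx₁')
  -- up to time `t₀` the segments `x + t ∇ρ(x)` stay in the large ball, and `∇ρ` varies along them by
  -- at most half of its length
  set t₀ := 1 / (2 * (L + H + 1)) with ht₀
  have ht₀pos : 0 < t₀ := by positivity
  have ht₀mul : t₀ * (L + H + 1) = 1 / 2 := by rw [ht₀]; field_simp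
  set K₁ := (C * H + C * L) * L with hK₁
  have hK₁0 : 0 ≤ K₁ := by positivity
  set d := min δ (c ^ 2 / 2 * t₀) with hd
  have hd0 : 0 < d := lt_min hδ (by positivity)
  refine ⟨K₁ * (2 / c ^ 2) + C * L / d, fun x hx => ?_⟩
  have hρx := (hρ.mem_iff x).1 hx
  have hxR : ‖x‖ ≤ R := mem_closedBall_zero_iff.1 (hR hx)
  set N := gradient ρ x with hNdef
  have hNL : ‖N‖ ≤ L := hL x (mem_closedBall_zero_iff.2 (by linarith))
  rw [abs_of_neg hρx]
  rcases le_or_gt d (-ρ x) with hfar | hnear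
  · have h1 : |fderiv ℝ h x N| ≤ C * L :=
      ((fderiv ℝ h x).le_opNorm N).trans (mul_le_mul (hC₁ x hx) hNL (norm_nonneg _) hC0)
    have h2 : C * L ≤ C * L / d * (-ρ x) := by
      rw [div_mul_eq_mul_div, le_div_iff₀ hd0]
      exact mul_le_mul_of_nonneg_left hfar (by positivity)
    have h3 : 0 ≤ K₁ * (2 / c ^ 2) * (-ρ x) := mul_nonneg (by positivity) (by linarith)
    linarith
  have hNc : c ≤ ‖N‖ := hgrad x hx (by linarith [min_le_left δ (c ^ 2 / 2 * t₀)])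
  have hline : ∀ t ∈ Icc (0 : ℝ) t₀, x + t • N ∈ closedBall (0 : 𝔼) (R + 1) := fun t ht => by
    rw [mem_closedBall_zero_iff]
    refine (norm_add_le _ _).trans (add_le_add hxR ?_)
    rw [norm_smul, Real.norm_of_nonneg ht.1]
    have := mul_le_mul ht.2 hNL (norm_nonneg _) ht₀pos.le
    nlinarith
  have hder : ∀ t : ℝ, HasDerivAt (fun t : ℝ => x + t • N) N t := fun t => by
    simpa using ((hasDerivAt_id t).smul_const N).const_add x
  set f : ℝ → ℝ := fun t => ρ (x + t • N) with hf
  have hfd : ∀ t, HasDerivAt f (fderiv ℝ ρ (x + t • N) N) t := fun t =>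
    (hρ.contDiff.differentiable (by simp) _).hasFDerivAt.comp_hasDerivAt t (hder t)
  have hfc : Continuous f := continuous_iff_continuousAt.2 fun t => (hfd t).continuousAt
  have hfd' : ∀ t ∈ Icc (0 : ℝ) t₀, c ^ 2 / 2 ≤ fderiv ℝ ρ (x + t • N) N := fun t ht => by
    have h1 : ‖gradient ρ (x + t • N) - N‖ ≤ H * ‖(x + t • N) - x‖ :=
      (convex_closedBall (0 : 𝔼) (R + 1)).norm_image_sub_le_of_norm_fderiv_le
        (fun z _ => hgc.differentiable (by simp) z) (fun z hz => hH z hz)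
        (mem_closedBall_zero_iff.2 (by linarith)) (hline t ht)
    rw [add_sub_cancel_left, norm_smul, Real.norm_of_nonneg ht.1] at h1
    have h2 : fderiv ℝ ρ (x + t • N) N = ‖N‖ ^ 2 + inner ℝ (gradient ρ (x + t • N) - N) N := by
      rw [inner_sub_left, inner_gradient_left, real_inner_self_eq_norm_sq]
      ring
    have h3 : |inner ℝ (gradient ρ (x + t • N) - N) N| ≤ 1 / 2 * ‖N‖ * ‖N‖ := by
      refine (abs_real_inner_le_norm _ _).trans
        (mul_le_mul_of_nonneg_right (h1.trans ?_) (norm_nonneg _))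
      have : H * t ≤ 1 / 2 := by nlinarith [mul_le_mul_of_nonneg_left ht.2 hH0]
      calc H * (t * ‖N‖) = H * t * ‖N‖ := by ring
        _ ≤ 1 / 2 * ‖N‖ := mul_le_mul_of_nonneg_right this (norm_nonneg _)
    have h4 := (abs_le.1 h3).1
    rw [h2]
    nlinarith [pow_le_pow_left₀ hc.le hNc 2]
  have hgrow : ∀ s ∈ Icc (0 : ℝ) t₀, ∀ t ∈ Icc (0 : ℝ) t₀, s ≤ t →
      c ^ 2 / 2 * (t - s) ≤ f t - f s :=
    (convex_Icc 0 t₀).mul_sub_le_image_sub_of_le_deriv hfc.continuousOn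
      (fun t _ => (hfd t).differentiableAt.differentiableWithinAt) fun t ht => by
        rw [(hfd t).deriv]
        exact hfd' t (interior_subset ht)
  have hf0 : f 0 = ρ x := by simp [hf]
  have h0mem : (0 : ℝ) ∈ Icc (0 : ℝ) t₀ := left_mem_Icc.2 ht₀pos.le
  have hft₀ : 0 ≤ f t₀ := by
    have := hgrow 0 h0mem t₀ (right_mem_Icc.2 ht₀pos.le) ht₀pos.le
    rw [hf0, sub_zero] at this
    linarith [min_le_right δ (c ^ 2 / 2 * t₀)]
  -- the first time at which the segment meets the boundary
  obtain ⟨T, hT, hfT⟩ := intermediate_value_Icc ht₀pos.le hfc.continuousOn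
    (show (0 : ℝ) ∈ Icc (f 0) (f t₀) from ⟨by rw [hf0]; exact hρx.le, hft₀⟩)
  have hT0 : 0 < T := by
    rcases hT.1.eq_or_lt with h | h
    · rw [← h, hf0] at hfT
      exact absurd hfT hρx.ne
    · exact h
  have hTle : T ≤ 2 / c ^ 2 * (-ρ x) := by
    have := hgrow 0 h0mem T hT hT.1
    rw [hf0, hfT, sub_zero, zero_sub] at this
    rw [div_mul_eq_mul_div, le_div_iff₀ (by positivity)]
    linarith
  have hin : ∀ t ∈ Ico (0 : ℝ) T, x + t • N ∈ Ω := fun t ht => by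
    have := hgrow t ⟨ht.1, ht.2.le.trans hT.2⟩ T hT ht.2.le
    rw [hfT, zero_sub] at this
    refine (hρ.mem_iff _).2 ?_
    have h2 : 0 < c ^ 2 / 2 * (T - t) := mul_pos (by positivity) (by linarith [ht.2])
    change f t < 0
    linarith
  set y := x + T • N with hy
  have hlim : Tendsto (fun t : ℝ => x + t • N) (𝓝[<] T) (𝓝[Ω] y) := by
    refine tendsto_nhdsWithin_iff.2 ⟨((hder T).continuousAt.tendsto).mono_left nhdsWithin_le_nhds,
      ?_⟩
    filter_upwards [Ico_mem_nhdsLT hT0] with t ht using hin t ht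
  have hyfr : y ∈ frontier Ω := hρ.mem_frontier
    (mem_closure_iff_nhdsWithin_neBot.2 (hlim.neBot)) hfT.ge
  set k : 𝔼 → ℝ := fun z => fderiv ℝ h z (gradient ρ z) with hk
  have hk0 : Tendsto k (𝓝[Ω] y) (𝓝 0) := by
    have hgy := hρ.gradient_ne_zero y hyfr
    have h1 := (hN y hyfr _ ⟨ρ, hρ.isBoundaryDefining hyfr, rfl⟩).const_mul ‖gradient ρ y‖
    simp only [map_smul, smul_eq_mul, mul_zero,
      mul_inv_cancel_left₀ (norm_ne_zero_iff.2 hgy)] at h1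
    have h2 : Tendsto (fun z => C * ‖gradient ρ z - gradient ρ y‖) (𝓝[Ω] y) (𝓝 0) := by
      have h3 : Continuous fun z => C * ‖gradient ρ z - gradient ρ y‖ :=
        continuous_const.mul (hgc.continuous.sub continuous_const).norm
      simpa using (h3.tendsto y).mono_left (nhdsWithin_le_nhds (s := Ω))
    have h4 : Tendsto (fun z => fderiv ℝ h z (gradient ρ z - gradient ρ y)) (𝓝[Ω] y) (𝓝 0) := by
      refine squeeze_zero_norm' ?_ h2
      filter_upwards [self_mem_nhdsWithin] with z hz
      exact ((fderiv ℝ h z).le_opNorm _).trans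
        (mul_le_mul_of_nonneg_right (hC₁ z hz) (norm_nonneg _))
    have h5 := h1.add h4
    rw [add_zero] at h5
    refine h5.congr fun z => ?_
    rw [map_sub, hk]
    ring
  have hkd : ∀ z ∈ Ω, HasFDerivAt k ((fderiv ℝ h z).comp (fderiv ℝ (gradient ρ) z)
      + (fderiv ℝ (fderiv ℝ h) z).flip (gradient ρ z)) z := fun z hz =>
    (hh.differentiableAt_fderiv_of_two hΩ hz).hasFDerivAt.clm_apply
      (hgc.differentiable (by simp) z).hasFDerivAt
  have hgd : ∀ t ∈ Ico (0 : ℝ) T, HasDerivWithinAt (fun t : ℝ => k (x + t • N))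
      (((fderiv ℝ h (x + t • N)).comp (fderiv ℝ (gradient ρ) (x + t • N))
      + (fderiv ℝ (fderiv ℝ h) (x + t • N)).flip (gradient ρ (x + t • N))) N) (Ico 0 T) t :=
    fun t ht => by
      have h1 := (hkd _ (hin t ht)).comp_hasDerivAt t (hder t)
      exact h1.hasDerivWithinAt
  have hgb : ∀ t ∈ Ico (0 : ℝ) T,
      ‖((fderiv ℝ h (x + t • N)).comp (fderiv ℝ (gradient ρ) (x + t • N))
      + (fderiv ℝ (fderiv ℝ h) (x + t • N)).flip (gradient ρ (x + t • N))) N‖ ≤ K₁ := fun t ht => by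
    have hz := hin t ht
    have hz' := hline t ⟨ht.1, ht.2.le.trans hT.2⟩
    rw [add_apply, ContinuousLinearMap.comp_apply, ContinuousLinearMap.flip_apply, hK₁, add_mul]
    refine (norm_add_le _ _).trans (add_le_add ?_ ?_)
    · refine ((fderiv ℝ h (x + t • N)).le_opNorm _).trans ?_
      rw [mul_assoc]
      refine mul_le_mul (hC₁ _ hz) ?_ (norm_nonneg _) hC0
      exact ((fderiv ℝ (gradient ρ) (x + t • N)).le_opNorm N).trans
        (mul_le_mul (hH _ hz') hNL (norm_nonneg _) hH0)
    · refine ((fderiv ℝ (fderiv ℝ h) (x + t • N)).le_opNorm₂ _ _).trans ?_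
      calc _ = ‖fderiv ℝ (fderiv ℝ h) (x + t • N)‖ * (‖N‖ * ‖gradient ρ (x + t • N)‖) := by ring
        _ ≤ C * (L * L) := mul_le_mul (hC₂ _ hz) (mul_le_mul hNL (hL _ hz') (norm_nonneg _) hL0)
            (by positivity) hC0
        _ = _ := by ring
  have hmv : ∀ t ∈ Ico (0 : ℝ) T, ‖k x - k (x + t • N)‖ ≤ K₁ * T := fun t ht => by
    have h1 := (convex_Ico (0 : ℝ) T).norm_image_sub_le_of_norm_hasDerivWithin_le hgd hgb
      ht (left_mem_Ico.2 hT0)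
    simp only [zero_smul, add_zero, zero_sub, norm_neg, Real.norm_of_nonneg ht.1] at h1
    exact h1.trans (mul_le_mul_of_nonneg_left ht.2.le hK₁0)
  have hfinal : ‖k x - 0‖ ≤ K₁ * T := by
    refine le_of_tendsto ((tendsto_const_nhds.sub (hk0.comp hlim)).norm) ?_
    filter_upwards [Ico_mem_nhdsLT hT0] with t ht using hmv t ht
  rw [sub_zero, Real.norm_eq_abs] at hfinal
  have h2 : 0 ≤ C * L / d * (-ρ x) := mul_nonneg (by positivity) (by linarith)
  have h3 := mul_le_mul_of_nonneg_left hTle hK₁0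
  calc |k x| ≤ K₁ * T := hfinal
    _ ≤ _ := by rw [add_mul, mul_assoc]; linarith

theorem abs_laplacian_le (h : 𝔼 → ℝ) (x : 𝔼) : |Δ h x| ≤ n * ‖fderiv ℝ (fderiv ℝ h) x‖ := by
  rw [laplacian_eq_sum]
  refine (Finset.abs_sum_le_sum_abs _ _).trans ?_
  calc _ ≤ ∑ _i : Fin n, ‖fderiv ℝ (fderiv ℝ h) x‖ := Finset.sum_le_sum fun i _ => by
        refine ((fderiv ℝ (fderiv ℝ h) x).le_opNorm₂ _ _).trans ?_
        simp
    _ = _ := by simp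

theorem isNeumannRegular_of_neumannBC (hbd : Bornology.IsBounded Ω) {ρ h : 𝔼 → ℝ}
    (hρ : IsDefiningFunction Ω ρ) (hh : ContDiffOn ℝ 2 h Ω) {C : ℝ} (hC₀ : ∀ x ∈ Ω, |h x| ≤ C)
    (hC₁ : ∀ x ∈ Ω, ‖fderiv ℝ h x‖ ≤ C) (hC₂ : ∀ x ∈ Ω, ‖fderiv ℝ (fderiv ℝ h) x‖ ≤ C)
    (hN : NeumannBC Ω h) : IsNeumannRegular Ω ρ h where
  contDiffOn := hh
  bounded := ⟨C, hC₀⟩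
  bounded_fderiv := ⟨C, hC₁⟩
  bounded_laplacian := ⟨n * C, fun x hx => (abs_laplacian_le h x).trans
    (mul_le_mul_of_nonneg_left (hC₂ x hx) (Nat.cast_nonneg n))⟩
  normal := hρ.exists_normal_le hbd hh hC₁ hC₂ hN

/-! ### Time dependence of the Neumann problem -/

section Time

variable {T : EReal}

theorem coe_lt_of_le {t b : ℝ} (h : t ≤ b) (hb : (b : EReal) < T) : (t : EReal) < T :=
  (EReal.coe_le_coe_iff.2 h).trans_lt hb

theorem prod_Icc_subset {a b : ℝ} (ha : 0 < a) (hb : (b : EReal) < T) (K : Set 𝔼) :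
    K ×ˢ Icc a b ⊆ K ×ˢ {t : ℝ | 0 < t ∧ (t : EReal) < T} :=
  prod_mono subset_rfl fun _ ht => ⟨ha.trans_le ht.1, coe_lt_of_le ht.2 hb⟩

theorem exists_uniform_modulus {K : Set 𝔼} (hK : IsCompact K) {F : 𝔼 × ℝ → ℝ} {a b : ℝ}
    (hF : ContinuousOn F (K ×ˢ Icc a b)) {ε : ℝ} (hε : 0 < ε) : ∃ δ > 0, ∀ x ∈ K,
      ∀ s ∈ Icc a b, ∀ t ∈ Icc a b, |s - t| < δ → |F (x, s) - F (x, t)| ≤ ε := by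
  obtain ⟨δ, hδ, h⟩ := Metric.uniformContinuousOn_iff.1
    ((hK.prod isCompact_Icc).uniformContinuousOn_of_continuous hF) ε hε
  refine ⟨δ, hδ, fun x hx s hs t ht hst => ?_⟩
  have := h (x, s) ⟨hx, hs⟩ (x, t) ⟨hx, ht⟩ (by
    rw [Prod.dist_eq, dist_self]
    exact max_lt hδ (by rwa [Real.dist_eq]))
  rw [Real.dist_eq] at this
  exact this.le

theorem IsC21.exists_bound (hbd : Bornology.IsBounded Ω) {f : 𝔼 → ℝ → ℝ} (h : IsC21 Ω T f)
    {a b : ℝ} (ha : 0 < a) (hb : (b : EReal) < T) : ∃ C, ∀ x ∈ Ω, ∀ t ∈ Icc a b,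
      |f x t| ≤ C ∧ ‖fderiv ℝ (fun y => f y t) x‖ ≤ C ∧
      ‖fderiv ℝ (fderiv ℝ (fun y => f y t)) x‖ ≤ C ∧ |deriv (fun s => f x s) t| ≤ C := by
  have hK : IsCompact (closure Ω ×ˢ Icc a b) := hbd.isCompact_closure.prod isCompact_Icc
  have hsub := prod_Icc_subset ha hb (closure Ω)
  obtain ⟨g₁, hg₁, e₁⟩ := h.grad_ext
  obtain ⟨g₂, hg₂, e₂⟩ := h.hess_ext
  obtain ⟨g₃, hg₃, e₃⟩ := h.time_ext
  obtain ⟨C₀, hC₀⟩ := hK.exists_bound_of_continuousOn (h.continuousOn.mono hsub)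
  obtain ⟨C₁, hC₁⟩ := hK.exists_bound_of_continuousOn (hg₁.mono hsub)
  obtain ⟨C₂, hC₂⟩ := hK.exists_bound_of_continuousOn (E := 𝔼 →L[ℝ] 𝔼 →L[ℝ] ℝ) (hg₂.mono hsub)
  obtain ⟨C₃, hC₃⟩ := hK.exists_bound_of_continuousOn (hg₃.mono hsub)
  refine ⟨max (max C₀ C₁) (max C₂ C₃), fun x hx t ht => ?_⟩
  have ht0 := ha.trans_le ht.1
  have htT := coe_lt_of_le ht.2 hb
  have hmem : (x, t) ∈ closure Ω ×ˢ Icc a b := ⟨subset_closure hx, ht⟩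
  rw [← e₁ x hx t ht0 htT, ← e₂ x hx t ht0 htT, ← e₃ x hx t ht0 htT]
  exact ⟨(hC₀ _ hmem).trans (le_max_of_le_left (le_max_left _ _)),
    (hC₁ _ hmem).trans (le_max_of_le_left (le_max_right _ _)),
    (hC₂ _ hmem).trans (le_max_of_le_right (le_max_left _ _)),
    (hC₃ _ hmem).trans (le_max_of_le_right (le_max_right _ _))⟩

theorem IsC21.continuousOn_deriv {f : 𝔼 → ℝ → ℝ} (h : IsC21 Ω T f) {t : ℝ} (ht : 0 < t)
    (htT : (t : EReal) < T) : ContinuousOn (fun x => deriv (fun s => f x s) t) Ω := by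
  obtain ⟨g, hg, e⟩ := h.time_ext
  have h1 : ContinuousOn (fun x => g (x, t)) Ω :=
    hg.comp (continuousOn_id.prodMk continuousOn_const) fun x hx => ⟨subset_closure hx, ht, htT⟩
  exact h1.congr fun x hx => (e x hx t ht htT).symm

theorem IsC21.exists_modulus_deriv (hbd : Bornology.IsBounded Ω) {f : 𝔼 → ℝ → ℝ}
    (h : IsC21 Ω T f) {a b : ℝ} (ha : 0 < a) (hb : (b : EReal) < T) {ε : ℝ} (hε : 0 < ε) :
    ∃ δ > 0, ∀ x ∈ Ω, ∀ s ∈ Icc a b, ∀ t ∈ Icc a b, |s - t| < δ →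
      |deriv (fun r => f x r) s - deriv (fun r => f x r) t| ≤ ε := by
  obtain ⟨g, hg, e⟩ := h.time_ext
  obtain ⟨δ, hδ, hd⟩ := exists_uniform_modulus hbd.isCompact_closure
    (hg.mono (prod_Icc_subset ha hb (closure Ω))) hε
  refine ⟨δ, hδ, fun x hx s hs t ht hst => ?_⟩
  rw [← e x hx s (ha.trans_le hs.1) (coe_lt_of_le hs.2 hb),
    ← e x hx t (ha.trans_le ht.1) (coe_lt_of_le ht.2 hb)]
  exact hd x (subset_closure hx) s hs t ht hst

theorem exists_isNeumannInv_of_continuousOn (hΩ : IsOpen Ω) (hbd : Bornology.IsBounded Ω)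
    {f : 𝔼 → ℝ} (hf : ContinuousOn f Ω) {M : ℝ} (hM : ∀ x ∈ Ω, |f x| ≤ M) :
    ∃ w, IsNeumannInv Ω f w :=
  exists_isNeumannInv hΩ hbd.measure_lt_top.ne (abs_nonneg M)
    (hf.aestronglyMeasurable hΩ.measurableSet)
    ((ae_restrict_mem hΩ.measurableSet).mono fun x hx => (hM x hx).trans (le_abs_self M))

theorem IsNeumannInv.abs_sub_le (hΩ : IsOpen Ω) (hfin : volume Ω ≠ ⊤) {f₁ f₂ w₁ w₂ : 𝔼 → ℝ} {M : ℝ}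
    (h₁ : IsNeumannInv Ω f₁ w₁) (h₂ : IsNeumannInv Ω f₂ w₂) (hf : ∀ x ∈ Ω, |f₁ x - f₂ x| ≤ M) :
    ∀ x ∈ Ω, |w₁ x - w₂ x| ≤ M := fun x hx => by
  have h := (h₁.linear_comb hfin h₂ 1 (-1)).abs_le hΩ hfin (M := M) (fun y hy => by
    rw [one_mul, neg_one_mul, ← sub_eq_add_neg]
    exact hf y hy) x hx
  rwa [one_mul, neg_one_mul, ← sub_eq_add_neg] at h

/-- The Neumann inverse commutes with the time derivative. -/
theorem IsC21.isNeumannInv_deriv (hΩ : IsOpen Ω) (hbd : Bornology.IsBounded Ω) {u v : 𝔼 → ℝ → ℝ}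
    (h : IsC21 Ω T u)
    (huv : ∀ t : ℝ, 0 < t → (t : EReal) < T → IsNeumannInv Ω (fun x => u x t) (fun x => v x t))
    {t : ℝ} (ht : 0 < t) (htT : (t : EReal) < T) :
    IsNeumannInv Ω (fun x => deriv (fun s => u x s) t) (fun x => deriv (fun s => v x s) t) ∧
      ∀ x ∈ Ω, DifferentiableAt ℝ (fun s => v x s) t := by
  have hfin : volume Ω ≠ ⊤ := hbd.measure_lt_top.ne
  obtain ⟨b, htb, hbT⟩ := EReal.lt_iff_exists_real_btwn.1 htT
  rw [EReal.coe_lt_coe_iff] at htb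
  have ha : 0 < t / 2 := half_pos ht
  have htmem : t ∈ Icc (t / 2) b := ⟨by linarith, htb.le⟩
  obtain ⟨C, hC⟩ := h.exists_bound hbd ha hbT
  obtain ⟨W, hW⟩ := exists_isNeumannInv_of_continuousOn hΩ hbd (h.continuousOn_deriv ht htT)
    fun x hx => (hC x hx t htmem).2.2.2
  have hd : ∀ x ∈ Ω, HasDerivAt (fun s => v x s) (W x) t := fun x hx => by
    rw [hasDerivAt_iff_isLittleO, Asymptotics.isLittleO_iff]
    intro ε hε
    obtain ⟨δ, hδ, hmod⟩ := h.exists_modulus_deriv hbd ha hbT hε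
    filter_upwards [Icc_mem_nhds (by linarith : t / 2 < t) htb, ball_mem_nhds t hδ] with s hs hsδ
    have hs0 : 0 < s := ha.trans_le hs.1
    rw [mem_ball, Real.dist_eq] at hsδ
    have h1 := ((huv s hs0 (coe_lt_of_le hs.2 hbT)).linear_comb hfin (huv t ht htT)
      1 (-1)).linear_comb hfin hW 1 (-(s - t))
    have h2 := h1.abs_le hΩ hfin (M := ε * |s - t|) (fun y hy => by
      have hsub : uIcc t s ⊆ Icc (t / 2) b := uIcc_subset_Icc htmem hs
      have h3 : ∀ r ∈ uIcc t s, HasDerivWithinAt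
          (fun r => u y r - r * deriv (fun s => u y s) t)
          (deriv (fun s => u y s) r - deriv (fun s => u y s) t) (uIcc t s) r := fun r hr => by
        have h4 := (h.differentiableAt y hy r (ha.trans_le (hsub hr).1)
          (coe_lt_of_le (hsub hr).2 hbT)).hasDerivAt
        have h5 := (hasDerivAt_id r).mul_const (deriv (fun s => u y s) t)
        rw [one_mul] at h5
        exact (h4.sub h5).hasDerivWithinAt
      have h6 := (convex_uIcc t s).norm_image_sub_le_of_norm_hasDerivWithin_le (C := ε) h3
        (fun r hr => hmod y hy r (hsub hr) t htmem
          ((abs_sub_left_of_mem_uIcc hr).trans_lt hsδ)) left_mem_uIcc right_mem_uIcc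
      rw [Real.norm_eq_abs, Real.norm_eq_abs] at h6
      refine le_of_eq_of_le ?_ h6
      congr 1
      ring) x hx
    rw [Real.norm_eq_abs, Real.norm_eq_abs, smul_eq_mul]
    refine le_of_eq_of_le ?_ h2
    congr 1
    ring
  exact ⟨hW.congr hΩ (fun _ _ => rfl) fun x hx => (hd x hx).deriv.symm,
    fun x hx => (hd x hx).differentiableAt⟩

theorem continuousOn_slice {F : 𝔼 × ℝ → ℝ} {I : Set ℝ}
    (hF : ContinuousOn F (closure Ω ×ˢ I)) {t : ℝ} (ht : t ∈ I) :
    ContinuousOn (fun x => F (x, t)) Ω :=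
  hF.comp (continuousOn_id.prodMk continuousOn_const) fun _ hx => ⟨subset_closure hx, ht⟩

/-- `(I - Δ)⁻¹ F(·, t)` is continuous in time. -/
theorem continuousOn_neumannInv (hΩ : IsOpen Ω) (hbd : Bornology.IsBounded Ω) {F : 𝔼 → ℝ → ℝ}
    {a b : ℝ} (hF : ContinuousOn (fun p : 𝔼 × ℝ => F p.1 p.2) (closure Ω ×ˢ Icc a b)) :
    (∀ t ∈ Icc a b, IsNeumannInv Ω (fun y => F y t) (neumannInv Ω fun y => F y t)) ∧
      ∀ x ∈ Ω, ContinuousOn (fun t => neumannInv Ω (fun y => F y t) x) (Icc a b) := by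
  have hfin : volume Ω ≠ ⊤ := hbd.measure_lt_top.ne
  obtain ⟨M, hM⟩ := (hbd.isCompact_closure.prod isCompact_Icc).exists_bound_of_continuousOn hF
  have hex : ∀ t ∈ Icc a b, IsNeumannInv Ω (fun y => F y t) (neumannInv Ω fun y => F y t) :=
    fun t ht => by
      obtain ⟨w, hw⟩ := exists_isNeumannInv_of_continuousOn hΩ hbd (continuousOn_slice hF ht)
        fun x hx => hM (x, t) ⟨subset_closure hx, ht⟩
      exact hw.isNeumannInv_neumannInv
  refine ⟨hex, fun x hx => Metric.continuousOn_iff.2 fun t ht ε hε => ?_⟩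
  obtain ⟨δ, hδ, hmod⟩ := exists_uniform_modulus hbd.isCompact_closure hF (half_pos hε)
  refine ⟨δ, hδ, fun s hs hst => ?_⟩
  rw [Real.dist_eq] at hst ⊢
  exact ((hex s hs).abs_sub_le hΩ hfin (hex t ht)
    (fun y hy => hmod y (subset_closure hy) s hs t ht hst) x hx).trans_lt (half_lt_self hε)

end Time

/-! ### The key identity for a solution with positive signal -/

section Motility

variable {γ : ℝ → ℝ}

theorem IsMotility.contDiffAt (hγ : IsMotility γ) {s : ℝ} (hs : 0 < s) : ContDiffAt ℝ 3 γ s :=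
  hγ.contDiffOn.contDiffAt (Ici_mem_nhds hs)

theorem IsMotility.hasDerivAt (hγ : IsMotility γ) {s : ℝ} (hs : 0 < s) :
    HasDerivAt γ (deriv γ s) s :=
  ((hγ.contDiffAt hs).differentiableAt (by norm_num)).hasDerivAt

theorem IsMotility.continuousOn_deriv (hγ : IsMotility γ) : ContinuousOn (deriv γ) (Ioi 0) :=
  (hγ.contDiffOn.mono Ioi_subset_Ici_self).continuousOn_deriv_of_isOpen isOpen_Ioi (by norm_num)

theorem IsMotility.antitoneOn (hγ : IsMotility γ) : AntitoneOn γ (Ici 0) :=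
  antitoneOn_of_deriv_nonpos (convex_Ici 0) hγ.contDiffOn.continuousOn
    (fun s hs => by
      rw [interior_Ici] at hs
      exact (hγ.hasDerivAt hs).differentiableAt.differentiableWithinAt)
    (fun s hs => by
      rw [interior_Ici] at hs
      exact hγ.deriv_nonpos s hs)

theorem IsMotility.le_zero (hγ : IsMotility γ) {s : ℝ} (hs : 0 ≤ s) : γ s ≤ γ 0 :=
  hγ.antitoneOn self_mem_Ici hs hs

theorem IsMotility.zero_pos (hγ : IsMotility γ) : 0 < γ 0 :=
  (hγ.pos 1 one_pos).trans_le (hγ.le_zero zero_le_one)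

theorem IsMotility.nonneg (hγ : IsMotility γ) {s : ℝ} (hs : 0 ≤ s) : 0 ≤ γ s := by
  rcases hs.eq_or_lt with rfl | h
  · exact hγ.zero_pos.le
  · exact (hγ.pos s h).le

theorem IsMotility.exists_bound_deriv (hγ : IsMotility γ) {κ M : ℝ} (hκ : 0 < κ) :
    ∃ C, 0 ≤ C ∧ ∀ s ∈ Icc κ M, |deriv γ s| ≤ C := by
  obtain ⟨C, hC⟩ := (isCompact_Icc (a := κ) (b := M)).exists_bound_of_continuousOn
    (hγ.continuousOn_deriv.mono fun s hs => hκ.trans_le hs.1)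
  exact ⟨|C|, abs_nonneg C, fun s hs => (hC s hs).trans (le_abs_self C)⟩

theorem hasFDerivAt_motility_mul (hγ : IsMotility γ) {U V : 𝔼 → ℝ} {x : 𝔼}
    (hU : DifferentiableAt ℝ U x) (hV : DifferentiableAt ℝ V x) (hVx : 0 < V x) :
    HasFDerivAt (fun y => γ (V y) * U y)
      (γ (V x) • fderiv ℝ U x + (U x * deriv γ (V x)) • fderiv ℝ V x) x := by
  have h1 : HasFDerivAt (fun y => γ (V y)) (deriv γ (V x) • fderiv ℝ V x) x :=
    (hγ.hasDerivAt hVx).comp_hasFDerivAt x hV.hasFDerivAt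
  have h2 := h1.mul hU.hasFDerivAt
  rw [smul_smul] at h2
  exact h2

theorem IsNeumannRegular.motility_mul (hΩ : IsOpen Ω) {ρ U V : 𝔼 → ℝ} (hγ : IsMotility γ)
    (hU : IsNeumannRegular Ω ρ U) (hV : IsNeumannRegular Ω ρ V) {κ : ℝ} (hκ : 0 < κ)
    (hVκ : ∀ x ∈ Ω, κ ≤ V x) {C : ℝ} (hΔ : ∀ x ∈ Ω, |Δ (fun y => γ (V y) * U y) x| ≤ C) :
    IsNeumannRegular Ω ρ (fun y => γ (V y) * U y) := by
  have hVpos : ∀ x ∈ Ω, 0 < V x := fun x hx => hκ.trans_le (hVκ x hx)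
  obtain ⟨A, hA⟩ := hU.bounded
  obtain ⟨A₁, hA₁⟩ := hU.bounded_fderiv
  obtain ⟨A₂, hA₂⟩ := hU.normal
  obtain ⟨B, hB⟩ := hV.bounded
  obtain ⟨B₁, hB₁⟩ := hV.bounded_fderiv
  obtain ⟨B₂, hB₂⟩ := hV.normal
  obtain ⟨D, hD0, hD⟩ := hγ.exists_bound_deriv (M := B) hκ
  have hγV : ∀ x ∈ Ω, |γ (V x)| ≤ γ 0 := fun x hx => by
    rw [abs_of_nonneg (hγ.nonneg (hVpos x hx).le)]
    exact hγ.le_zero (hVpos x hx).le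
  have hγ'V : ∀ x ∈ Ω, |U x * deriv γ (V x)| ≤ |A| * D := fun x hx => by
    rw [abs_mul]
    exact mul_le_mul ((hA x hx).trans (le_abs_self A))
      (hD _ ⟨hVκ x hx, (le_abs_self _).trans (hB x hx)⟩) (abs_nonneg _) (abs_nonneg _)
  have hγ0 := hγ.zero_pos.le
  have hAD : 0 ≤ |A| * D := mul_nonneg (abs_nonneg _) hD0
  have hfd : ∀ x ∈ Ω, fderiv ℝ (fun y => γ (V y) * U y) x
      = γ (V x) • fderiv ℝ U x + (U x * deriv γ (V x)) • fderiv ℝ V x := fun x hx =>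
    (hasFDerivAt_motility_mul hγ
      ((hU.contDiffOn.contDiffAt (hΩ.mem_nhds hx)).differentiableAt (by norm_num))
      ((hV.contDiffOn.contDiffAt (hΩ.mem_nhds hx)).differentiableAt (by norm_num))
      (hVpos x hx)).fderiv
  refine ⟨fun x hx => ?_, ⟨γ 0 * |A|, fun x hx => ?_⟩, ⟨γ 0 * A₁ + |A| * D * B₁, fun x hx => ?_⟩,
    ⟨C, hΔ⟩, ⟨γ 0 * A₂ + |A| * D * B₂, fun x hx => ?_⟩⟩
  · exact ((((hγ.contDiffAt (hVpos x hx)).of_le (by norm_num)).comp x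
      (hV.contDiffOn.contDiffAt (hΩ.mem_nhds hx))).mul
      (hU.contDiffOn.contDiffAt (hΩ.mem_nhds hx))).contDiffWithinAt
  · rw [abs_mul]
    exact mul_le_mul (hγV x hx) ((hA x hx).trans (le_abs_self A)) (abs_nonneg _) hγ0
  · rw [hfd x hx]
    refine (norm_add_le _ _).trans (add_le_add ?_ ?_)
    · rw [norm_smul]
      exact mul_le_mul (hγV x hx) (hA₁ x hx) (norm_nonneg _) hγ0
    · rw [norm_smul]
      exact mul_le_mul (hγ'V x hx) (hB₁ x hx) (norm_nonneg _) hAD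
  · rw [hfd x hx, add_apply, smul_apply, smul_apply, smul_eq_mul, smul_eq_mul, add_mul]
    refine (abs_add_le _ _).trans (add_le_add ?_ ?_)
    · rw [abs_mul, mul_assoc]
      exact mul_le_mul (hγV x hx) (hA₂ x hx) (abs_nonneg _) hγ0
    · rw [abs_mul, mul_assoc (|A| * D)]
      exact mul_le_mul (hγ'V x hx) (hB₂ x hx) (abs_nonneg _) hAD

end Motility

section Solution

variable {γ : ℝ → ℝ} {μ : ℝ} {u₀ : EuclideanSpace ℝ (Fin n) → ℝ} {T : EReal}
  {u v : EuclideanSpace ℝ (Fin n) → ℝ → ℝ}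

theorem Icc_zero_subset {b : ℝ} (hb : (b : EReal) < T) (K : Set 𝔼) :
    K ×ˢ Icc 0 b ⊆ K ×ˢ {t : ℝ | 0 ≤ t ∧ (t : EReal) < T} :=
  prod_mono subset_rfl fun _ ht => ⟨ht.1, coe_lt_of_le ht.2 hb⟩

theorem IsClassicalSolution.exists_bound (hbd : Bornology.IsBounded Ω)
    (h : IsClassicalSolution Ω γ μ u₀ T u v) {b : ℝ} (hb : (b : EReal) < T) :
    ∃ M, 0 ≤ M ∧ ∀ x ∈ closure Ω, ∀ t ∈ Icc 0 b, |u x t| ≤ M ∧ |v x t| ≤ M := by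
  have hK : IsCompact (closure Ω ×ˢ Icc 0 b) := hbd.isCompact_closure.prod isCompact_Icc
  obtain ⟨A, hA⟩ := hK.exists_bound_of_continuousOn
    (h.continuousOn_u.mono (Icc_zero_subset hb (closure Ω)))
  obtain ⟨B, hB⟩ := hK.exists_bound_of_continuousOn
    (h.continuousOn_v.mono (Icc_zero_subset hb (closure Ω)))
  exact ⟨max |A| |B|, le_max_of_le_left (abs_nonneg _), fun x hx t ht =>
    ⟨(hA (x, t) ⟨hx, ht⟩).trans ((le_abs_self A).trans (le_max_left _ _)),
      (hB (x, t) ⟨hx, ht⟩).trans ((le_abs_self B).trans (le_max_right _ _))⟩⟩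

theorem IsC21.isNeumannRegular (hbd : Bornology.IsBounded Ω) {ρ : 𝔼 → ℝ}
    (hρ : IsDefiningFunction Ω ρ) {f : 𝔼 → ℝ → ℝ} (h : IsC21 Ω T f) {t : ℝ} (ht : 0 < t)
    (htT : (t : EReal) < T) (hN : NeumannBC Ω fun y => f y t) :
    IsNeumannRegular Ω ρ fun y => f y t := by
  obtain ⟨C, hC⟩ := h.exists_bound hbd ht htT
  have hm : t ∈ Icc t t := ⟨le_rfl, le_rfl⟩
  exact isNeumannRegular_of_neumannBC hbd hρ (h.contDiffOn t ht htT)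
    (fun x hx => (hC x hx t hm).1) (fun x hx => (hC x hx t hm).2.1)
    (fun x hx => (hC x hx t hm).2.2.1) hN

/-- The signal is `v = (I - Δ)⁻¹ u`. -/
theorem IsClassicalSolution.isNeumannInv_of_pos (hΩs : IsSmoothBoundedDomain Ω)
    (h : IsClassicalSolution Ω γ μ u₀ T u v) {t : ℝ} (ht : 0 < t) (htT : (t : EReal) < T) :
    IsNeumannInv Ω (fun x => u x t) (fun x => v x t) := by
  obtain ⟨ρ, hρ⟩ := hΩs.exists_isDefiningFunction
  refine ((h.regular_v.isNeumannRegular hΩs.isBounded hρ ht htT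
    (h.neumann_v t ht htT)).isNeumannInv hΩs.isBounded hρ).congr hΩs.isOpen (fun x hx => ?_)
    fun _ _ => rfl
  rw [← h.eq_v x hx t ht htT]
  ring

theorem IsClassicalSolution.isNeumannInv_zero (hΩs : IsSmoothBoundedDomain Ω)
    (h : IsClassicalSolution Ω γ μ u₀ T u v) (hT : 0 < T) :
    IsNeumannInv Ω (fun x => u x 0) (fun x => v x 0) := by
  have hΩ := hΩs.isOpen
  have hbd := hΩs.isBounded
  have hfin : volume Ω ≠ ⊤ := hbd.measure_lt_top.ne
  obtain ⟨b, hb0, hb⟩ := EReal.lt_iff_exists_real_btwn.1 hT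
  have hb0' : 0 < b := by exact_mod_cast hb0
  have h0 : (0 : ℝ) ∈ Icc 0 b := left_mem_Icc.2 hb0'.le
  obtain ⟨M, hM0, hM⟩ := h.exists_bound hbd hb
  have hcu := h.continuousOn_u.mono (Icc_zero_subset hb (closure Ω))
  have hcv := h.continuousOn_v.mono (Icc_zero_subset hb (closure Ω))
  obtain ⟨w, hw⟩ := exists_isNeumannInv_of_continuousOn hΩ hbd (continuousOn_slice hcu h0)
    fun x hx => (hM x (subset_closure hx) 0 h0).1
  refine hw.congr hΩ (fun _ _ => rfl) fun x hx => ?_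
  refine eq_of_abs_sub_le_all fun ε hε => ?_
  obtain ⟨δ₁, hδ₁, h₁⟩ := exists_uniform_modulus hbd.isCompact_closure hcu (half_pos hε)
  obtain ⟨δ₂, hδ₂, h₂⟩ := exists_uniform_modulus hbd.isCompact_closure hcv (half_pos hε)
  set s := min b (min δ₁ δ₂ / 2) with hs
  have hm := lt_min hδ₁ hδ₂
  have hs0 : 0 < s := lt_min hb0' (half_pos hm)
  have hsb : s ∈ Icc 0 b := ⟨hs0.le, min_le_left _ _⟩
  have hsδ : s < min δ₁ δ₂ := (min_le_right _ _).trans_lt (half_lt_self hm)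
  have hs' : |0 - s| < min δ₁ δ₂ := by rwa [zero_sub, abs_neg, abs_of_pos hs0]
  have e₁ := hw.abs_sub_le hΩ hfin (h.isNeumannInv_of_pos hΩs hs0 (coe_lt_of_le hsb.2 hb))
    (fun y hy => h₁ y (subset_closure hy) 0 h0 s hsb (hs'.trans_le (min_le_left _ _))) x hx
  have e₂ := h₂ x (subset_closure hx) 0 h0 s hsb (hs'.trans_le (min_le_right _ _))
  rw [abs_sub_comm] at e₂
  have e₃ := abs_sub_le (w x) (v x s) (v x 0)
  simp only at e₁ e₂ ⊢
  linarith

theorem IsClassicalSolution.isNeumannInv (hΩs : IsSmoothBoundedDomain Ω)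
    (h : IsClassicalSolution Ω γ μ u₀ T u v) {t : ℝ} (ht : 0 ≤ t) (htT : (t : EReal) < T) :
    IsNeumannInv Ω (fun x => u x t) (fun x => v x t) := by
  rcases ht.eq_or_lt with rfl | h0
  · exact h.isNeumannInv_zero hΩs (by exact_mod_cast htT)
  · exact h.isNeumannInv_of_pos hΩs h0 htT

theorem IsClassicalSolution.isNeumannInv_deriv (hΩs : IsSmoothBoundedDomain Ω)
    (h : IsClassicalSolution Ω γ μ u₀ T u v) {t : ℝ} (ht : 0 < t) (htT : (t : EReal) < T) :
    IsNeumannInv Ω (fun x => deriv (fun s => u x s) t) (fun x => deriv (fun s => v x s) t) :=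
  (h.regular_u.isNeumannInv_deriv hΩs.isOpen hΩs.isBounded
    (fun _ h0 hT => h.isNeumannInv_of_pos hΩs h0 hT) ht htT).1

theorem IsClassicalSolution.isNeumannRegular_motility_mul (hΩs : IsSmoothBoundedDomain Ω)
    {ρ : 𝔼 → ℝ} (hρ : IsDefiningFunction Ω ρ) (hγ : IsMotility γ)
    (h : IsClassicalSolution Ω γ μ u₀ T u v) {t : ℝ} (ht : 0 < t) (htT : (t : EReal) < T) {κ : ℝ}
    (hκ : 0 < κ) (hv : ∀ x ∈ Ω, κ ≤ v x t) : IsNeumannRegular Ω ρ fun y => γ (v y t) * u y t := by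
  obtain ⟨C, hC⟩ := h.regular_u.exists_bound hΩs.isBounded ht htT
  have hm : t ∈ Icc t t := ⟨le_rfl, le_rfl⟩
  refine (h.regular_u.isNeumannRegular hΩs.isBounded hρ ht htT (h.neumann_u t ht htT)).motility_mul
    hΩs.isOpen hγ (h.regular_v.isNeumannRegular hΩs.isBounded hρ ht htT (h.neumann_v t ht htT))
    hκ hv (C := C + |μ| * C * (1 + C)) fun x hx => ?_
  have h1 : Δ (fun y => γ (v y t) * u y t) x
      = deriv (fun s => u x s) t - μ * u x t * (1 - u x t) := by
    rw [h.eq_u x hx t ht htT]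
    ring
  obtain ⟨c1, _, _, c2⟩ := hC x hx t hm
  have hC0 : 0 ≤ C := (abs_nonneg _).trans c1
  rw [h1]
  refine (abs_sub _ _).trans (add_le_add c2 ?_)
  rw [abs_mul, abs_mul]
  refine mul_le_mul (mul_le_mul_of_nonneg_left c1 (abs_nonneg _)) ((abs_sub _ _).trans ?_)
    (abs_nonneg _) (by positivity)
  rw [abs_one]
  linarith

theorem IsClassicalSolution.isNeumannInv_sq (hΩs : IsSmoothBoundedDomain Ω)
    (h : IsClassicalSolution Ω γ μ u₀ T u v) {t : ℝ} (ht : 0 ≤ t) (htT : (t : EReal) < T) :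
    IsNeumannInv Ω (fun y => u y t ^ 2) (neumannInv Ω fun y => u y t ^ 2) :=
  (continuousOn_neumannInv hΩs.isOpen hΩs.isBounded (F := fun y t => u y t ^ 2)
    ((h.continuousOn_u.mono (Icc_zero_subset htT (closure Ω))).pow 2)).1 t (right_mem_Icc.2 ht)

/-- Applying `(I - Δ)⁻¹` to the first equation. -/
theorem IsClassicalSolution.isNeumannInv_motility_of_signal (hΩs : IsSmoothBoundedDomain Ω)
    (hγ : IsMotility γ) (h : IsClassicalSolution Ω γ μ u₀ T u v) {t : ℝ} (ht : 0 < t)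
    (htT : (t : EReal) < T) {κ : ℝ} (hκ : 0 < κ) (hv : ∀ x ∈ Ω, κ ≤ v x t) :
    IsNeumannInv Ω (fun y => γ (v y t) * u y t + μ * u y t)
      (fun x => deriv (fun s => v x s) t + γ (v x t) * u x t
        + μ * neumannInv Ω (fun y => u y t ^ 2) x) := by
  have hfin : volume Ω ≠ ⊤ := hΩs.isBounded.measure_lt_top.ne
  obtain ⟨ρ, hρ⟩ := hΩs.exists_isDefiningFunction
  have h1 := (h.isNeumannRegular_motility_mul hΩs hρ hγ ht htT hκ hv).isNeumannInv hΩs.isBounded hρ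
  have h2 := ((h.isNeumannInv_deriv hΩs ht htT).linear_comb hfin h1 1 1).linear_comb hfin
    (h.isNeumannInv_sq hΩs ht.le htT) 1 μ
  refine h2.congr hΩs.isOpen (fun x hx => ?_) (fun x hx => ?_)
  · simp only []
    rw [h.eq_u x hx t ht htT]
    ring
  · simp only []
    ring

end Solution

/-! ### Nonnegativity of the density -/

theorem hasDerivAt_setIntegral_of_bounded (hΩ : IsOpen Ω) (hfin : volume Ω ≠ ⊤) {F F' : 𝔼 → ℝ → ℝ}
    {a b t C : ℝ} (ht : t ∈ Ioo a b) (hFc : ∀ s ∈ Ioo a b, ContinuousOn (fun x => F x s) Ω)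
    (hFb : ∀ x ∈ Ω, |F x t| ≤ C) (hF'c : ContinuousOn (fun x => F' x t) Ω)
    (hF'b : ∀ x ∈ Ω, ∀ s ∈ Ioo a b, |F' x s| ≤ C)
    (hd : ∀ x ∈ Ω, ∀ s ∈ Ioo a b, HasDerivAt (F x) (F' x s) s) :
    HasDerivAt (fun s => ∫ x in Ω, F x s) (∫ x in Ω, F' x t) t := by
  have := isFiniteMeasure_restrict hfin
  have hmem := Ioo_mem_nhds ht.1 ht.2
  refine (hasDerivAt_integral_of_dominated_loc_of_deriv_le (s := Ioo a b)
    (μ := volume.restrict Ω) (F := fun s x => F x s) (F' := fun s x => F' x s)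
    (bound := fun _ => C) hmem ?_ ?_ (hF'c.aestronglyMeasurable hΩ.measurableSet) ?_
    (integrable_const C) ?_).2
  · filter_upwards [hmem] with s hs using (hFc s hs).aestronglyMeasurable hΩ.measurableSet
  · exact Integrable.of_bound ((hFc t ht).aestronglyMeasurable hΩ.measurableSet) C
      ((ae_restrict_mem hΩ.measurableSet).mono fun x hx => hFb x hx)
  · exact (ae_restrict_mem hΩ.measurableSet).mono fun x hx => hF'b x hx
  · exact (ae_restrict_mem hΩ.measurableSet).mono fun x hx => hd x hx

theorem continuousOn_setIntegral_slice (hΩ : IsOpen Ω) (hbd : Bornology.IsBounded Ω)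
    {F : 𝔼 × ℝ → ℝ} {a b : ℝ} (hF : ContinuousOn F (closure Ω ×ˢ Icc a b)) :
    ContinuousOn (fun t => ∫ x in Ω, F (x, t)) (Icc a b) := by
  have := isFiniteMeasure_restrict hbd.measure_lt_top.ne
  obtain ⟨C, hC⟩ := (hbd.isCompact_closure.prod isCompact_Icc).exists_bound_of_continuousOn hF
  refine continuousOn_of_dominated (bound := fun _ => C)
    (fun t ht => (continuousOn_slice hF ht).aestronglyMeasurable hΩ.measurableSet)
    (fun t ht => (ae_restrict_mem hΩ.measurableSet).mono fun x hx =>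
      hC (x, t) ⟨subset_closure hx, ht⟩)
    (integrable_const C) ((ae_restrict_mem hΩ.measurableSet).mono fun x hx => ?_)
  exact hF.comp (continuousOn_const.prodMk continuousOn_id) fun t ht => ⟨subset_closure hx, ht⟩

/-- Green's formula with the test function `(w⁻)²`: the integral is `2 ∫ w⁻ |∇w|²`. -/
theorem IsNeumannRegular.integral_neg_part_sq_mul_laplacian (hbd : Bornology.IsBounded Ω)
    {ρ w : 𝔼 → ℝ} (hρ : IsDefiningFunction Ω ρ) (h : IsNeumannRegular Ω ρ w) :
    0 ≤ ∫ x in Ω, max (-w x) 0 ^ 2 * Δ w x := by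
  have hΩ := hρ.isOpen
  have hfin : volume Ω ≠ ⊤ := hbd.measure_lt_top.ne
  obtain ⟨A, hA⟩ := h.bounded
  obtain ⟨A₁, hA₁⟩ := h.bounded_fderiv
  have hmax : ∀ x ∈ Ω, max (-w x) 0 ≤ |A| := fun x hx =>
    max_le ((neg_le_abs _).trans ((hA x hx).trans (le_abs_self A))) (abs_nonneg A)
  have hfd : ∀ x ∈ Ω, HasFDerivAt (fun x => max (-w x) 0 ^ 2)
      ((-(2 * max (-w x) 0)) • fderiv ℝ w x) x := fun x hx => by
    have h1 := ((h.contDiffOn.contDiffAt (hΩ.mem_nhds hx)).differentiableAt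
      (by norm_num)).hasFDerivAt.neg
    have h2 := HasDerivAt.comp_hasFDerivAt (f := fun x => -w x) x (hasDerivAt_max_zero_sq (-w x)) h1
    rw [smul_neg, ← neg_smul] at h2
    exact h2
  have hC1 : ContDiffOn ℝ 1 (fun x => max (-w x) 0 ^ 2) Ω := by
    rw [show (1 : WithTop ℕ∞) = 0 + 1 by norm_num, contDiffOn_succ_iff_fderiv_of_isOpen hΩ]
    refine ⟨fun x hx => (hfd x hx).differentiableAt.differentiableWithinAt, by simp, ?_⟩
    rw [contDiffOn_zero]
    have h1 : ContinuousOn (fun x => (-(2 * max (-w x) 0)) • fderiv ℝ w x) Ω := by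
      have h2 : ContinuousOn w Ω := h.contDiffOn.continuousOn
      have h3 : ContinuousOn (fun x => max (-w x) 0) Ω := h2.neg.sup continuousOn_const
      exact ((continuousOn_const.mul h3).neg).smul
        (h.contDiffOn.continuousOn_fderiv_of_isOpen hΩ one_le_two)
    exact h1.congr fun x hx => (hfd x hx).fderiv
  have hmem := memH1_of_contDiffOn hΩ hfin hC1 (C := |A| ^ 2) (C' := 2 * |A| * A₁)
    (fun x hx => by
      rw [abs_of_nonneg (by positivity)]
      exact pow_le_pow_left₀ (le_max_right _ _) (hmax x hx) 2)
    (fun x hx => by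
      rw [(hfd x hx).fderiv, norm_smul, norm_neg,
        Real.norm_of_nonneg (mul_nonneg zero_le_two (le_max_right _ _))]
      exact mul_le_mul (mul_le_mul_of_nonneg_left (hmax x hx) zero_le_two) (hA₁ x hx)
        (norm_nonneg _) (by positivity))
  have h1 := h.integral_inner hbd hρ hmem
  have h2 : ∫ x in Ω, inner ℝ (gradient w x) (gradient (fun x => max (-w x) 0 ^ 2) x) ≤ 0 := by
    refine setIntegral_nonpos hΩ.measurableSet fun x hx => ?_
    have h3 : gradient (fun x => max (-w x) 0 ^ 2) x = (-(2 * max (-w x) 0)) • gradient w x := by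
      rw [gradient, (hfd x hx).fderiv, map_smul, gradient]
    rw [h3, inner_smul_right]
    exact mul_nonpos_of_nonpos_of_nonneg
      (neg_nonpos.2 (mul_nonneg zero_le_two (le_max_right _ _))) real_inner_self_nonneg
  linarith

theorem hasDerivAt_max_neg_cube (s : ℝ) :
    HasDerivAt (fun s : ℝ => max (-s) 0 ^ 3) (-(3 * max (-s) 0 ^ 2)) s := by
  have h1 : ∀ s : ℝ, max (-s) 0 ^ 3 = -s * max (-s) 0 ^ 2 := fun s => by
    rcases le_total (-s) 0 with h | h
    · rw [max_eq_right h]; ring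
    · rw [max_eq_left h]; ring
  have h2 := (hasDerivAt_id s).neg.mul
    ((hasDerivAt_max_zero_sq (-s)).comp s (hasDerivAt_id s).neg)
  have h3 : (fun s : ℝ => max (-s) 0 ^ 3) = (-id) * ((fun s : ℝ => max s 0 ^ 2) ∘ (-id)) :=
    funext fun s => h1 s
  rw [h3]
  convert! h2 using 1
  simp only [Function.comp_apply, Pi.neg_apply, id_eq]
  rcases le_total (-s) 0 with h | h
  · rw [max_eq_right h]; ring
  · rw [max_eq_left h]; ring

section Solution

variable {γ : ℝ → ℝ} {μ : ℝ} {u₀ : EuclideanSpace ℝ (Fin n) → ℝ} {T : EReal}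
  {u v : EuclideanSpace ℝ (Fin n) → ℝ → ℝ}

theorem IsClassicalSolution.le_on_closure (h : IsClassicalSolution Ω γ μ u₀ T u v) {t : ℝ}
    (ht : 0 ≤ t) (htT : (t : EReal) < T) {c : ℝ} (hc : ∀ x ∈ Ω, c ≤ v x t) :
    ∀ x ∈ closure Ω, c ≤ v x t := fun _ hx =>
  _root_.le_on_closure hc continuousOn_const (h.continuousOn_v.comp
    (continuousOn_id.prodMk continuousOn_const) fun _ hx => ⟨hx, ht, htT⟩) hx

theorem IsClassicalSolution.continuousOn_motility (hγ : IsMotility γ)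
    (h : IsClassicalSolution Ω γ μ u₀ T u v) {b : ℝ} (hb : (b : EReal) < T)
    (hv : ∀ x ∈ Ω, ∀ t ∈ Icc 0 b, 0 ≤ v x t) :
    ContinuousOn (fun p : 𝔼 × ℝ => γ (v p.1 p.2)) (closure Ω ×ˢ Icc 0 b) :=
  hγ.contDiffOn.continuousOn.comp (h.continuousOn_v.mono (Icc_zero_subset hb (closure Ω)))
    fun _ hp => h.le_on_closure hp.2.1 (coe_lt_of_le hp.2.2 hb) (fun x hx => hv x hx _ hp.2) _ hp.1

/-- As long as the signal is bounded below, its time derivative is bounded down to `t = 0`. -/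
theorem IsClassicalSolution.abs_deriv_signal_le (hΩs : IsSmoothBoundedDomain Ω) (hγ : IsMotility γ)
    (hμ : 0 ≤ μ) (h : IsClassicalSolution Ω γ μ u₀ T u v) {t : ℝ} (ht : 0 < t)
    (htT : (t : EReal) < T) {κ : ℝ} (hκ : 0 < κ) (hv : ∀ x ∈ Ω, κ ≤ v x t) {M : ℝ}
    (hM : ∀ x ∈ Ω, |u x t| ≤ M) : ∀ x ∈ Ω,
      |deriv (fun s => v x s) t| ≤ 2 * (γ 0 * M) + μ * M + μ * M ^ 2 := fun x hx => by
  have hΩ := hΩs.isOpen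
  have hfin : volume Ω ≠ ⊤ := hΩs.isBounded.measure_lt_top.ne
  have hγu : ∀ y ∈ Ω, |γ (v y t) * u y t| ≤ γ 0 * M := fun y hy => by
    have h0 : 0 ≤ v y t := hκ.le.trans (hv y hy)
    rw [abs_mul, abs_of_nonneg (hγ.nonneg h0)]
    exact mul_le_mul (hγ.le_zero h0) (hM y hy) (abs_nonneg _) hγ.zero_pos.le
  have h1 := (h.isNeumannInv_motility_of_signal hΩs hγ ht htT hκ hv).abs_le hΩ hfin
    (M := γ 0 * M + μ * M) (fun y hy => by
      refine (abs_add_le _ _).trans (add_le_add (hγu y hy) ?_)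
      rw [abs_mul, abs_of_nonneg hμ]
      exact mul_le_mul_of_nonneg_left (hM y hy) hμ) x hx
  have h2 := (h.isNeumannInv_sq hΩs ht.le htT).abs_le hΩ hfin (M := M ^ 2) (fun y hy => by
    rw [abs_pow]
    exact pow_le_pow_left₀ (abs_nonneg _) (hM y hy) 2) x hx
  have h3 := hγu x hx
  have h4 : |μ * neumannInv Ω (fun y => u y t ^ 2) x| ≤ μ * M ^ 2 := by
    rw [abs_mul, abs_of_nonneg hμ]
    exact mul_le_mul_of_nonneg_left h2 hμ
  rw [_root_.abs_le] at *
  constructor <;> linarith [h1.1, h1.2, h3.1, h3.2, h4.1, h4.2]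

/-- The density is nonnegative: Gronwall's inequality for `∫ (u⁻)³ γ(v)²`. With `w = γ(v) u`, the
diffusion contributes `-3 ∫ (w⁻)² Δw ≤ 0`. -/
theorem IsClassicalSolution.nonneg_of_signal (hΩs : IsSmoothBoundedDomain Ω) (hγ : IsMotility γ)
    (hμ : 0 ≤ μ) (hu₀ : IsInitialDatum Ω u₀) (h : IsClassicalSolution Ω γ μ u₀ T u v) {b : ℝ}
    (hb : (b : EReal) < T) {κ : ℝ} (hκ : 0 < κ)
    (hv : ∀ x ∈ Ω, ∀ t ∈ Icc 0 b, κ ≤ v x t) : ∀ x ∈ Ω, ∀ t ∈ Icc 0 b, 0 ≤ u x t := by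
  have hΩ := hΩs.isOpen
  have hbd := hΩs.isBounded
  have hfin : volume Ω ≠ ⊤ := hbd.measure_lt_top.ne
  have := isFiniteMeasure_restrict hfin
  obtain ⟨ρ, hρ⟩ := hΩs.exists_isDefiningFunction
  obtain ⟨M, hM0, hM⟩ := h.exists_bound hbd hb
  obtain ⟨D, hD0, hD⟩ := hγ.exists_bound_deriv (M := M) hκ
  have hvpos : ∀ x ∈ Ω, ∀ t ∈ Icc 0 b, 0 < v x t := fun x hx t ht => hκ.trans_le (hv x hx t ht)
  have hvM : ∀ x ∈ Ω, ∀ t ∈ Icc 0 b, v x t ≤ M := fun x hx t ht =>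
    (le_abs_self _).trans (hM x (subset_closure hx) t ht).2
  set V := 2 * (γ 0 * M) + μ * M + μ * M ^ 2 with hV
  have hγ0 := hγ.zero_pos
  have hV0 : 0 ≤ V := by positivity
  -- the reaction term contributes at most the first summand, and the term with `v_t` the second
  set K := 3 * μ * (1 + M) + 2 * D * V / γ (max M κ) with hK
  have hMκ : 0 < max M κ := hκ.trans_le (le_max_right _ _)
  have hg0 := hγ.pos _ hMκ
  have hK0 : 0 ≤ K := by positivity
  set m : 𝔼 → ℝ → ℝ := fun x t => max (-u x t) 0 with hm
  have hm0 : ∀ x t, 0 ≤ m x t := fun x t => le_max_right _ _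
  have hmM : ∀ x ∈ Ω, ∀ t ∈ Icc 0 b, m x t ≤ M := fun x hx t ht =>
    max_le ((neg_le_abs _).trans (hM x (subset_closure hx) t ht).1) hM0
  set F : 𝔼 → ℝ → ℝ := fun x t => m x t ^ 3 * γ (v x t) ^ 2 with hF
  set F' : 𝔼 → ℝ → ℝ := fun x t => -(3 * m x t ^ 2) * deriv (fun s => u x s) t * γ (v x t) ^ 2
    + m x t ^ 3 * (2 * γ (v x t) * (deriv γ (v x t) * deriv (fun s => v x s) t)) with hF'
  have hcu := h.continuousOn_u.mono (Icc_zero_subset hb (closure Ω))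
  have hcv := h.continuousOn_v.mono (Icc_zero_subset hb (closure Ω))
  have hcγ := h.continuousOn_motility hγ hb fun x hx t ht => (hvpos x hx t ht).le
  have hcF : ContinuousOn (fun p : 𝔼 × ℝ => F p.1 p.2) (closure Ω ×ˢ Icc 0 b) :=
    ((hcu.neg.sup continuousOn_const).pow 3).mul (hcγ.pow 2)
  have hF0 : ∀ x t, 0 ≤ F x t := fun x t => mul_nonneg (pow_nonneg (hm0 x t) 3) (sq_nonneg _)
  have hγv : ∀ x ∈ Ω, ∀ t ∈ Icc 0 b, 0 < γ (v x t) ∧ γ (v x t) ≤ γ 0 ∧ γ (max M κ) ≤ γ (v x t) :=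
    fun x hx t ht => ⟨hγ.pos _ (hvpos x hx t ht), hγ.le_zero (hvpos x hx t ht).le,
      hγ.antitoneOn (hvpos x hx t ht).le hMκ.le ((hvM x hx t ht).trans (le_max_left _ _))⟩
  have hvt : ∀ x ∈ Ω, ∀ t ∈ Ioo 0 b, |deriv (fun s => v x s) t| ≤ V := fun x hx t ht =>
    h.abs_deriv_signal_le hΩs hγ hμ ht.1 (coe_lt_of_le ht.2.le hb) hκ
      (fun y hy => hv y hy t (Ioo_subset_Icc_self ht))
      (fun y hy => (hM y (subset_closure hy) t (Ioo_subset_Icc_self ht)).1) x hx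
  have hFd : ∀ x ∈ Ω, ∀ t ∈ Ioo 0 b, HasDerivAt (F x) (F' x t) t := fun x hx t ht => by
    have htT := coe_lt_of_le ht.2.le hb
    have h1 := (h.regular_u.differentiableAt x hx t ht.1 htT).hasDerivAt
    have h2 := (h.regular_v.differentiableAt x hx t ht.1 htT).hasDerivAt
    have h3 : HasDerivAt (fun t => m x t ^ 3) _ t := (hasDerivAt_max_neg_cube (u x t)).comp t h1
    have h4 : HasDerivAt (fun t => γ (v x t)) _ t :=
      (hγ.hasDerivAt (hvpos x hx t (Ioo_subset_Icc_self ht))).comp t h2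
    have h5 := h3.mul (h4.pow 2)
    convert! h5 using 1
    simp [hF', hm]
  have hF'c : ∀ t ∈ Ioo 0 b, ContinuousOn (fun x => F' x t) Ω := fun t ht => by
    have htT := coe_lt_of_le ht.2.le hb
    have htm : t ∈ Icc 0 b := Ioo_subset_Icc_self ht
    have c1 : ContinuousOn (fun x => u x t) Ω := continuousOn_slice hcu htm
    have c2 : ContinuousOn (fun x => v x t) Ω := continuousOn_slice hcv htm
    have c3 : ContinuousOn (fun x => γ (v x t)) Ω := continuousOn_slice hcγ htm
    have c4 : ContinuousOn (fun x => m x t) Ω := c1.neg.sup continuousOn_const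
    have c5 : ContinuousOn (fun x => deriv γ (v x t)) Ω :=
      hγ.continuousOn_deriv.comp c2 fun x hx => hvpos x hx t htm
    exact (((continuousOn_const.mul (c4.pow 2)).neg.mul
      (h.regular_u.continuousOn_deriv ht.1 htT)).mul (c3.pow 2)).add ((c4.pow 3).mul
      ((continuousOn_const.mul c3).mul (c5.mul (h.regular_v.continuousOn_deriv ht.1 htT))))
  have hF'b : ∀ t ∈ Ioo 0 b, ∃ C, 0 ≤ C ∧ ∀ x ∈ Ω, ∀ s ∈ Ioo (t / 2) b, |F' x s| ≤ C :=
    fun t ht => by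
    have ha : 0 < t / 2 := half_pos ht.1
    obtain ⟨C, hC⟩ := h.regular_u.exists_bound hbd ha hb
    refine ⟨3 * M ^ 2 * |C| * γ 0 ^ 2 + M ^ 3 * (2 * γ 0 * (D * V)), by positivity,
      fun x hx s hs => ?_⟩
    have hs0 : s ∈ Ioo 0 b := ⟨ha.trans hs.1, hs.2⟩
    have hs' := Ioo_subset_Icc_self hs0
    obtain ⟨g1, g2, _⟩ := hγv x hx s hs'
    have e1 : |deriv (fun s => u x s) s| ≤ |C| :=
      (hC x hx s (Ioo_subset_Icc_self hs)).2.2.2.trans (le_abs_self C)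
    have e2 := hvt x hx s hs0
    have e3 := hD _ ⟨hv x hx s hs', hvM x hx s hs'⟩
    have e4 := hmM x hx s hs'
    have e5 := hm0 x s
    refine (abs_add_le _ _).trans (add_le_add ?_ ?_)
    · rw [abs_mul, abs_mul, abs_neg, abs_of_nonneg (by positivity : 0 ≤ 3 * m x s ^ 2),
        abs_of_nonneg (sq_nonneg (γ (v x s)))]
      gcongr
    · rw [abs_mul, abs_of_nonneg (pow_nonneg e5 3), abs_mul,
        abs_of_nonneg (by positivity : 0 ≤ 2 * γ (v x s)), abs_mul]
      gcongr
  have hFi : ∀ t ∈ Icc 0 b, IntegrableOn (fun x => F x t) Ω := fun t ht => by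
    obtain ⟨C, hC⟩ := (hbd.isCompact_closure.prod isCompact_Icc).exists_bound_of_continuousOn hcF
    exact Integrable.of_bound ((continuousOn_slice hcF ht).aestronglyMeasurable hΩ.measurableSet)
      C ((ae_restrict_mem hΩ.measurableSet).mono fun x hx => hC (x, t) ⟨subset_closure hx, ht⟩)
  have hY : ∀ t ∈ Ioo 0 b, HasDerivAt (fun s => ∫ x in Ω, F x s) (∫ x in Ω, F' x t) t := by
    intro t ht
    have ha : 0 < t / 2 := half_pos ht.1
    obtain ⟨C, hC0, hC⟩ := hF'b t ht
    have hsub : ∀ s ∈ Ioo (t / 2) b, s ∈ Ioo 0 b := fun s hs => ⟨ha.trans hs.1, hs.2⟩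
    have htm : t ∈ Icc 0 b := Ioo_subset_Icc_self ht
    refine hasDerivAt_setIntegral_of_bounded hΩ hfin (a := t / 2) (b := b)
      (C := M ^ 3 * γ 0 ^ 2 + C) ⟨by linarith [ht.1], ht.2⟩
      (fun s hs => continuousOn_slice (F := fun p => F p.1 p.2) hcF
        (Ioo_subset_Icc_self (hsub s hs))) (fun x hx => ?_) (hF'c t ht)
      (fun x hx s hs => (hC x hx s hs).trans (le_add_of_nonneg_left (by positivity)))
      fun x hx s hs => hFd x hx s (hsub s hs)
    obtain ⟨g1, g2, _⟩ := hγv x hx t htm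
    rw [abs_of_nonneg (hF0 x t)]
    have : F x t ≤ M ^ 3 * γ 0 ^ 2 := mul_le_mul (pow_le_pow_left₀ (hm0 x t) (hmM x hx t htm) 3)
      (pow_le_pow_left₀ g1.le g2 2) (sq_nonneg _) (by positivity)
    linarith
  have hYle : ∀ t ∈ Ioo 0 b, ∫ x in Ω, F' x t ≤ K * ∫ x in Ω, F x t := by
    intro t ht
    have htT := coe_lt_of_le ht.2.le hb
    have htm : t ∈ Icc 0 b := Ioo_subset_Icc_self ht
    have hw := h.isNeumannRegular_motility_mul hΩs hρ hγ ht.1 htT hκ fun x hx => hv x hx t htm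
    have h1 := hw.integral_neg_part_sq_mul_laplacian hbd hρ
    set w : 𝔼 → ℝ := fun y => γ (v y t) * u y t with hwdef
    have hwi : IntegrableOn (fun x => max (-w x) 0 ^ 2 * Δ w x) Ω := by
      obtain ⟨C, hC⟩ := hw.bounded_laplacian
      refine integrableOn_mul_laplacian hΩ hw.contDiffOn hC ?_
      obtain ⟨A, hA⟩ := hw.bounded
      refine Integrable.of_bound (((hw.contDiffOn.continuousOn.neg.sup
        continuousOn_const).pow 2).aestronglyMeasurable hΩ.measurableSet) (|A| ^ 2)
        ((ae_restrict_mem hΩ.measurableSet).mono fun x hx => ?_)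
      change |max (-w x) 0 ^ 2| ≤ _
      rw [abs_of_nonneg (by positivity)]
      exact pow_le_pow_left₀ (le_max_right _ _)
        (max_le ((neg_le_abs _).trans ((hA x hx).trans (le_abs_self A))) (abs_nonneg A)) 2
    have hF'i : IntegrableOn (fun x => F' x t) Ω := by
      obtain ⟨C, -, hC⟩ := hF'b t ht
      exact Integrable.of_bound ((hF'c t ht).aestronglyMeasurable hΩ.measurableSet) C
        ((ae_restrict_mem hΩ.measurableSet).mono fun x hx =>
          hC x hx t ⟨half_lt_self ht.1, ht.2⟩)
    have h2 : ∫ x in Ω, F' x t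
        ≤ ∫ x in Ω, (K * F x t - 3 * (max (-w x) 0 ^ 2 * Δ w x)) := by
      refine setIntegral_mono_on hF'i (((hFi t htm).const_mul K).sub (hwi.const_mul 3))
        hΩ.measurableSet fun x hx => ?_
      obtain ⟨g1, -, g3⟩ := hγv x hx t htm
      have e2 := hvt x hx t ht
      have e3 := hD _ ⟨hv x hx t htm, hvM x hx t htm⟩
      have hwm : max (-w x) 0 = γ (v x t) * m x t := by
        rw [hwdef, hm, mul_max_of_nonneg _ _ g1.le, mul_zero, mul_neg]
      have hmu : m x t ^ 2 * u x t = -m x t ^ 3 := by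
        simp only [hm]
        rcases le_total (-u x t) 0 with h | h
        · rw [max_eq_right h]; ring
        · rw [max_eq_left h]; ring
      have hu1 : 1 - u x t ≤ 1 + M := by
        have := (_root_.abs_le.1 (hM x (subset_closure hx) t htm).1).1
        linarith
      have hm3 : 0 ≤ m x t ^ 3 := pow_nonneg (hm0 x t) 3
      have hF'eq : F' x t = -3 * (max (-w x) 0 ^ 2 * Δ w x) + 3 * μ * (1 - u x t) * F x t
          + m x t ^ 3 * (2 * γ (v x t) * (deriv γ (v x t) * deriv (fun s => v x s) t)) := by
        simp only [hF', hF]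
        rw [h.eq_u x hx t ht.1 htT, hwm]
        linear_combination -3 * μ * (1 - u x t) * γ (v x t) ^ 2 * hmu
      have e4 : deriv γ (v x t) * deriv (fun s => v x s) t ≤ D * V := by
        refine (le_abs_self _).trans ?_
        rw [abs_mul]
        exact mul_le_mul e3 e2 (abs_nonneg _) hD0
      have e5 : γ (v x t) ≤ γ (v x t) ^ 2 / γ (max M κ) := by
        rw [le_div_iff₀ hg0, pow_two]
        exact mul_le_mul_of_nonneg_left g3 g1.le
      have e6 : m x t ^ 3 * (2 * γ (v x t) * (deriv γ (v x t) * deriv (fun s => v x s) t))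
          ≤ 2 * D * V / γ (max M κ) * F x t := by
        calc _ ≤ m x t ^ 3 * (2 * γ (v x t) * (D * V)) := by gcongr
          _ ≤ m x t ^ 3 * (2 * (γ (v x t) ^ 2 / γ (max M κ)) * (D * V)) := by gcongr
          _ = _ := by simp only [hF]; ring
      have e7 : 3 * μ * (1 - u x t) * F x t ≤ 3 * μ * (1 + M) * F x t := by
        have := hF0 x t
        gcongr
      rw [hF'eq, hK, add_mul]
      linarith
    rw [integral_sub ((hFi t htm).const_mul K) (hwi.const_mul 3), integral_const_mul,
      integral_const_mul] at h2
    linarith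
  have hcY : ContinuousOn (fun s => ∫ x in Ω, F x s) (Icc 0 b) :=
    continuousOn_setIntegral_slice hΩ hbd hcF
  have hanti : AntitoneOn (fun t => Real.exp (-(K * t)) * ∫ x in Ω, F x t) (Icc 0 b) := by
    have hd : ∀ t ∈ Ioo 0 b, HasDerivAt (fun t => Real.exp (-(K * t)) * ∫ x in Ω, F x t)
        (Real.exp (-(K * t)) * ((∫ x in Ω, F' x t) - K * ∫ x in Ω, F x t)) t := fun t ht => by
      have h1 := (((hasDerivAt_id t).const_mul K).neg.exp).mul (hY t ht)
      convert! h1 using 1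
      simp only [Pi.neg_apply, id_eq]
      ring
    refine antitoneOn_of_deriv_nonpos (convex_Icc 0 b)
      ((Continuous.continuousOn (by fun_prop)).mul hcY) (fun t ht => ?_) fun t ht => ?_
    · rw [interior_Icc] at ht
      exact (hd t ht).differentiableAt.differentiableWithinAt
    · rw [interior_Icc] at ht
      rw [(hd t ht).deriv]
      exact mul_nonpos_of_nonneg_of_nonpos (Real.exp_pos _).le (by linarith [hYle t ht])
  intro x hx t ht
  have hb0 : (0 : ℝ) ∈ Icc 0 b := left_mem_Icc.2 (ht.1.trans ht.2)
  have hY0 : ∫ x in Ω, F x 0 = 0 := setIntegral_eq_zero_of_forall_eq_zero fun y hy => by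
    have h1 : m y 0 = 0 := by
      simp only [hm]
      rw [h.initial y (subset_closure hy)]
      exact max_eq_right (neg_nonpos.2 (hu₀.nonneg y (subset_closure hy)))
    simp [hF, h1]
  have h1 := hanti hb0 ht ht.1
  simp only [hY0, mul_zero] at h1
  have h2 : ∫ x in Ω, F x t = 0 :=
    le_antisymm (nonpos_of_mul_nonpos_right h1 (Real.exp_pos _)) (integral_nonneg fun x => hF0 x t)
  have h3 := (integral_eq_zero_iff_of_nonneg (fun x => hF0 x t) (hFi t ht)).1 h2
  have h4 := forall_le_of_ae hΩ (w₁ := fun x => F x t) (w₂ := fun _ => 0)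
    (continuousOn_slice hcF ht) continuousOn_const (h3.mono fun y hy => le_of_eq hy) x hx
  by_contra hn
  have h5 : 0 < m x t := lt_max_of_lt_left (by linarith)
  have h6 : 0 < F x t := mul_pos (pow_pos h5 3) (pow_pos (hγv x hx t ht).1 2)
  exact absurd h4 (not_le.2 h6)

end Solution

/-! ### Mass and positivity of the signal -/

section Solution

variable {γ : ℝ → ℝ} {μ : ℝ} {u₀ : EuclideanSpace ℝ (Fin n) → ℝ} {T : EReal}
  {u v : EuclideanSpace ℝ (Fin n) → ℝ → ℝ}

/-- The mass satisfies `d/dt ∫ u = μ ∫ u (1 - u) ≥ -μ M ∫ u`. -/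
theorem IsClassicalSolution.le_mass (hΩs : IsSmoothBoundedDomain Ω) (hγ : IsMotility γ)
    (hμ : 0 ≤ μ) (hu₀ : IsInitialDatum Ω u₀) (h : IsClassicalSolution Ω γ μ u₀ T u v) {b : ℝ}
    (hb : (b : EReal) < T) {κ : ℝ} (hκ : 0 < κ)
    (hv : ∀ x ∈ Ω, ∀ t ∈ Icc 0 b, κ ≤ v x t) {M : ℝ}
    (hM : ∀ x ∈ Ω, ∀ t ∈ Icc 0 b, u x t ≤ M) :
    ∀ t ∈ Icc 0 b, Real.exp (-(μ * M * t)) * (∫ x in Ω, u₀ x) ≤ ∫ x in Ω, u x t := by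
  have hΩ := hΩs.isOpen
  have hbd := hΩs.isBounded
  have hfin : volume Ω ≠ ⊤ := hbd.measure_lt_top.ne
  have := isFiniteMeasure_restrict hfin
  obtain ⟨ρ, hρ⟩ := hΩs.exists_isDefiningFunction
  have hu := h.nonneg_of_signal hΩs hγ hμ hu₀ hb hκ hv
  have hcu := h.continuousOn_u.mono (Icc_zero_subset hb (closure Ω))
  have hui : ∀ t ∈ Icc 0 b, IntegrableOn (fun x => u x t) Ω := fun t ht =>
    (h.isNeumannInv hΩs ht.1 (coe_lt_of_le ht.2 hb)).2.integrableOn_right hfin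
  have hd : ∀ t ∈ Ioo 0 b, HasDerivAt (fun s => ∫ x in Ω, u x s)
      (∫ x in Ω, deriv (fun s => u x s) t) t := fun t ht => by
    have ha : 0 < t / 2 := half_pos ht.1
    obtain ⟨C, hC⟩ := h.regular_u.exists_bound hbd ha hb
    have hmem : t ∈ Ioo (t / 2) b := ⟨half_lt_self ht.1, ht.2⟩
    exact hasDerivAt_setIntegral_of_bounded hΩ hfin (F := u)
      (F' := fun x t => deriv (fun s => u x s) t) hmem
      (fun s hs => continuousOn_slice (F := fun p => u p.1 p.2) hcu
        ⟨(ha.trans hs.1).le, hs.2.le⟩)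
      (fun x hx => (hC x hx t (Ioo_subset_Icc_self hmem)).1)
      (h.regular_u.continuousOn_deriv ht.1 (coe_lt_of_le ht.2.le hb))
      (fun x hx s hs => (hC x hx s (Ioo_subset_Icc_self hs)).2.2.2)
      fun x hx s hs => (h.regular_u.differentiableAt x hx s (ha.trans hs.1)
        (coe_lt_of_le hs.2.le hb)).hasDerivAt
  have hle : ∀ t ∈ Ioo 0 b, -(μ * M) * (∫ x in Ω, u x t)
      ≤ ∫ x in Ω, deriv (fun s => u x s) t := fun t ht => by
    have htm := Ioo_subset_Icc_self ht
    have htT := coe_lt_of_le ht.2.le hb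
    have hw := h.isNeumannRegular_motility_mul hΩs hρ hγ ht.1 htT hκ fun x hx => hv x hx t htm
    have h1 := hw.integral_inner hbd hρ (memH1_const hΩ hfin 1)
    simp only [inner_zero_right, integral_zero, one_mul] at h1
    have h2 : IntegrableOn (fun x => deriv (fun s => u x s) t) Ω :=
      (h.isNeumannInv_deriv hΩs ht.1 htT).2.integrableOn_right hfin
    have h3 : IntegrableOn (Δ fun y => γ (v y t) * u y t) Ω := by
      obtain ⟨C, hC⟩ := hw.bounded_laplacian
      exact Integrable.of_bound ((continuousOn_laplacian hΩ hw.contDiffOn).aestronglyMeasurable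
        hΩ.measurableSet) C ((ae_restrict_mem hΩ.measurableSet).mono fun x hx => hC x hx)
    have h4 : ∫ x in Ω, (-(μ * M) * u x t + Δ (fun y => γ (v y t) * u y t) x)
        ≤ ∫ x in Ω, deriv (fun s => u x s) t := by
      refine setIntegral_mono_on (((hui t htm).const_mul _).add h3) h2 hΩ.measurableSet
        fun x hx => ?_
      rw [h.eq_u x hx t ht.1 htT]
      have h5 : 0 ≤ μ * (u x t * (1 + (M - u x t))) :=
        mul_nonneg hμ (mul_nonneg (hu x hx t htm) (by linarith [hM x hx t htm]))
      nlinarith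
    rw [integral_add ((hui t htm).const_mul _) h3, integral_const_mul] at h4
    linarith
  have hmono : MonotoneOn (fun t => Real.exp (μ * M * t) * ∫ x in Ω, u x t) (Icc 0 b) := by
    have hd' : ∀ t ∈ Ioo 0 b, HasDerivAt (fun t => Real.exp (μ * M * t) * ∫ x in Ω, u x t)
        (Real.exp (μ * M * t) * (μ * M * (∫ x in Ω, u x t)
          + ∫ x in Ω, deriv (fun s => u x s) t)) t := fun t ht => by
      have h1 := (((hasDerivAt_id t).const_mul (μ * M)).exp).mul (hd t ht)
      convert! h1 using 1
      simp only [id_eq]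
      ring
    refine monotoneOn_of_deriv_nonneg (convex_Icc 0 b)
      ((Continuous.continuousOn (by fun_prop)).mul (continuousOn_setIntegral_slice hΩ hbd hcu))
      (fun t ht => ?_) fun t ht => ?_
    · rw [interior_Icc] at ht
      exact (hd' t ht).differentiableAt.differentiableWithinAt
    · rw [interior_Icc] at ht
      rw [(hd' t ht).deriv]
      exact mul_nonneg (Real.exp_pos _).le (by linarith [hle t ht])
  intro t ht
  have h1 := hmono (left_mem_Icc.2 (ht.1.trans ht.2)) ht ht.1
  simp only [mul_zero, Real.exp_zero, one_mul] at h1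
  rw [setIntegral_congr_fun hΩ.measurableSet fun x hx => h.initial x (subset_closure hx)] at h1
  rw [Real.exp_neg, inv_mul_le_iff₀ (Real.exp_pos _)]
  exact h1

theorem IsInitialDatum.integral_pos (hΩ : IsOpen Ω) (hbd : Bornology.IsBounded Ω)
    (hu₀ : IsInitialDatum Ω u₀) : 0 < ∫ x in Ω, u₀ x := by
  have := isFiniteMeasure_restrict hbd.measure_lt_top.ne
  have h0 : ∀ᵐ x ∂((volume : Measure 𝔼).restrict Ω), 0 ≤ u₀ x :=
    (ae_restrict_mem hΩ.measurableSet).mono fun x hx => hu₀.nonneg x (subset_closure hx)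
  have hc : ContinuousOn u₀ Ω := hu₀.continuousOn.mono subset_closure
  obtain ⟨C, hC⟩ := hbd.isCompact_closure.exists_bound_of_continuousOn hu₀.continuousOn
  have hi : IntegrableOn u₀ Ω := Integrable.of_bound (hc.aestronglyMeasurable hΩ.measurableSet) C
    ((ae_restrict_mem hΩ.measurableSet).mono fun x hx => hC x (subset_closure hx))
  refine lt_of_le_of_ne (integral_nonneg_of_ae h0) fun hn => ?_
  have h1 := (integral_eq_zero_iff_of_nonneg_ae h0 hi).1 hn.symm
  have h2 := forall_le_of_ae hΩ hc continuousOn_const (h1.mono fun x hx => le_of_eq hx)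
  obtain ⟨x, hx, hx0⟩ := hu₀.not_zero
  exact hx0 (le_antisymm (le_on_closure h2 hu₀.continuousOn continuousOn_const hx)
    (hu₀.nonneg x hx))

/-- The signal stays above a positive constant on bounded time intervals. A bound
`κ / 2 ≤ v` on `[0, t]` makes `u` nonnegative and hence improves itself to `κ ≤ v`, because
`v` is bounded below by a multiple of the mass; by uniform continuity
it then persists on a slightly longer interval, whose extra length does not depend on `t`. -/
theorem IsClassicalSolution.le_signal (hΩs : IsSmoothBoundedDomain Ω) (hγ : IsMotility γ)
    (hμ : 0 ≤ μ) (hu₀ : IsInitialDatum Ω u₀) (h : IsClassicalSolution Ω γ μ u₀ T u v) {c : ℝ}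
    (hc : 0 < c) (hcN : ∀ f w : 𝔼 → ℝ, IsNeumannInv Ω f w → (∀ x ∈ Ω, 0 ≤ f x) →
      ∀ x ∈ Ω, c * (∫ y in Ω, f y) ≤ w x) {b M : ℝ} (hb : (b : EReal) < T) (hM0 : 0 ≤ M)
    (hM : ∀ x ∈ Ω, ∀ t ∈ Icc 0 b, u x t ≤ M) : ∀ x ∈ Ω, ∀ t ∈ Icc 0 b,
      c * (Real.exp (-(μ * M * b)) * ∫ y in Ω, u₀ y) ≤ v x t := by
  have hΩ := hΩs.isOpen
  have hbd := hΩs.isBounded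
  set κ := c * (Real.exp (-(μ * M * b)) * ∫ y in Ω, u₀ y) with hκdef
  have hm0 := hu₀.integral_pos hΩ hbd
  have hκ : 0 < κ := by positivity
  have hboot : ∀ t, t ≤ b → (∀ x ∈ Ω, ∀ s ∈ Icc 0 t, κ / 2 ≤ v x s) →
      ∀ x ∈ Ω, ∀ s ∈ Icc 0 t, κ ≤ v x s := fun t htb hv x hx s hs => by
    have htT := coe_lt_of_le htb hb
    have h1 := h.nonneg_of_signal hΩs hγ hμ hu₀ htT (half_pos hκ) hv
    have h2 := h.le_mass hΩs hγ hμ hu₀ htT (half_pos hκ) hv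
      (fun y hy r hr => hM y hy r ⟨hr.1, hr.2.trans htb⟩) s hs
    have h3 := hcN _ _ (h.isNeumannInv hΩs hs.1 (coe_lt_of_le hs.2 htT))
      (fun y hy => h1 y hy s hs) x hx
    refine le_trans (mul_le_mul_of_nonneg_left (le_trans (mul_le_mul_of_nonneg_right
      (Real.exp_le_exp.2 ?_) hm0.le) h2) hc.le) h3
    exact neg_le_neg (mul_le_mul_of_nonneg_left (hs.2.trans htb) (mul_nonneg hμ hM0))
  obtain ⟨δ, hδ, hmod⟩ := exists_uniform_modulus hbd.isCompact_closure
    (h.continuousOn_v.mono (Icc_zero_subset hb (closure Ω))) (half_pos hκ)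
  rcases lt_or_ge b 0 with hb0 | hb0
  · intro x _ t ht
    linarith [ht.1, ht.2]
  have hstep : ∀ k : ℕ, ∀ x ∈ Ω, ∀ s ∈ Icc 0 (min (k * (δ / 2)) b), κ ≤ v x s := by
    intro k
    induction k with
    | zero =>
      intro x hx s hs
      have hs0 : s = 0 := le_antisymm (by
        have := hs.2.trans (min_le_left _ _)
        simpa using this) hs.1
      subst hs0
      have hT : ((0 : ℝ) : EReal) < T := coe_lt_of_le hb0 hb
      have h3 := hcN _ _ (h.isNeumannInv hΩs le_rfl hT) (fun y hy => by
        rw [h.initial y (subset_closure hy)]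
        exact hu₀.nonneg y (subset_closure hy)) x hx
      rw [setIntegral_congr_fun hΩ.measurableSet fun x hx => h.initial x (subset_closure hx)] at h3
      refine le_trans (mul_le_mul_of_nonneg_left (mul_le_of_le_one_left hm0.le ?_) hc.le) h3
      exact Real.exp_le_one_iff.2 (neg_nonpos.2 (mul_nonneg (mul_nonneg hμ hM0) hb0))
    | succ k ih =>
      refine hboot _ (min_le_right _ _) fun x hx s hs => ?_
      set τ := min ((k : ℝ) * (δ / 2)) b with hτ
      have hτ0 : 0 ≤ τ := le_min (by positivity) hb0
      rcases le_or_gt s τ with hsτ | hsτ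
      · linarith [ih x hx s ⟨hs.1, hsτ⟩]
      · have h1 := ih x hx τ ⟨hτ0, le_rfl⟩
        have hsb := hs.2.trans (min_le_right _ _)
        have h2 : s ≤ τ + δ / 2 := by
          rcases le_total ((k : ℝ) * (δ / 2)) b with hkb | hkb
          · rw [hτ, min_eq_left hkb]
            have := hs.2.trans (min_le_left _ _)
            push_cast at this
            linarith
          · rw [hτ, min_eq_right hkb]
            linarith
        have h3 := hmod x (subset_closure hx) s ⟨hs.1, hsb⟩ τ ⟨hτ0, min_le_right _ _⟩ (by
          rw [abs_of_pos (by linarith)]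
          linarith)
        have h4 := (_root_.abs_le.1 h3).1
        simp only at h4
        linarith
  obtain ⟨k, hk⟩ := exists_nat_gt (b / (δ / 2))
  intro x hx t ht
  refine hstep k x hx t ⟨ht.1, le_min (ht.2.trans ?_) ht.2⟩
  rw [div_lt_iff₀ (half_pos hδ)] at hk
  exact hk.le

end Solution

/-! ### Bounds for the signal -/

section Solution

variable {γ : ℝ → ℝ} {μ : ℝ} {u₀ : EuclideanSpace ℝ (Fin n) → ℝ} {T : EReal}
  {u v : EuclideanSpace ℝ (Fin n) → ℝ → ℝ}

theorem IsClassicalSolution.exists_pos_le_signal (hΩs : IsSmoothBoundedDomain Ω)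
    (hγ : IsMotility γ) (hμ : 0 ≤ μ) (hu₀ : IsInitialDatum Ω u₀)
    (h : IsClassicalSolution Ω γ μ u₀ T u v) {b : ℝ} (hb : (b : EReal) < T) :
    ∃ κ > 0, ∀ x ∈ Ω, ∀ t ∈ Icc 0 b, κ ≤ v x t := by
  obtain ⟨c, hc, hcN⟩ := hΩs.exists_mass_le
  obtain ⟨M, hM0, hM⟩ := h.exists_bound hΩs.isBounded hb
  have hm0 := hu₀.integral_pos hΩs.isOpen hΩs.isBounded
  exact ⟨c * (Real.exp (-(μ * M * b)) * ∫ y in Ω, u₀ y), by positivity,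
    h.le_signal hΩs hγ hμ hu₀ hc hcN hb hM0 fun x hx t ht =>
      (le_abs_self _).trans (hM x (subset_closure hx) t ht).1⟩

theorem IsClassicalSolution.nonneg (hΩs : IsSmoothBoundedDomain Ω) (hγ : IsMotility γ)
    (hμ : 0 ≤ μ) (hu₀ : IsInitialDatum Ω u₀) (h : IsClassicalSolution Ω γ μ u₀ T u v) {t : ℝ}
    (ht : 0 ≤ t) (htT : (t : EReal) < T) {x : 𝔼} (hx : x ∈ Ω) : 0 ≤ u x t := by
  obtain ⟨κ, hκ, hv⟩ := h.exists_pos_le_signal hΩs hγ hμ hu₀ htT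
  exact h.nonneg_of_signal hΩs hγ hμ hu₀ htT hκ hv x hx t (right_mem_Icc.2 ht)

theorem IsClassicalSolution.signal_pos (hΩs : IsSmoothBoundedDomain Ω) (hγ : IsMotility γ)
    (hμ : 0 ≤ μ) (hu₀ : IsInitialDatum Ω u₀) (h : IsClassicalSolution Ω γ μ u₀ T u v) {t : ℝ}
    (ht : 0 ≤ t) (htT : (t : EReal) < T) {x : 𝔼} (hx : x ∈ Ω) : 0 < v x t := by
  obtain ⟨κ, hκ, hv⟩ := h.exists_pos_le_signal hΩs hγ hμ hu₀ htT
  exact hκ.trans_le (hv x hx t (right_mem_Icc.2 ht))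

theorem IsClassicalSolution.isNeumannInv_initial (hΩs : IsSmoothBoundedDomain Ω)
    (h : IsClassicalSolution Ω γ μ u₀ T u v) (hT : 0 < T) :
    IsNeumannInv Ω u₀ (fun x => v x 0) :=
  (h.isNeumannInv_zero hΩs hT).congr hΩs.isOpen (fun x hx => h.initial x (subset_closure hx))
    fun _ _ => rfl

theorem IsClassicalSolution.isNeumannInv_motility (hΩs : IsSmoothBoundedDomain Ω)
    (hγ : IsMotility γ) (hμ : 0 ≤ μ) (hu₀ : IsInitialDatum Ω u₀)
    (h : IsClassicalSolution Ω γ μ u₀ T u v) {t : ℝ} (ht : 0 < t) (htT : (t : EReal) < T) :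
    IsNeumannInv Ω (fun y => γ (v y t) * u y t + μ * u y t)
      (fun x => deriv (fun s => v x s) t + γ (v x t) * u x t
        + μ * neumannInv Ω (fun y => u y t ^ 2) x) := by
  obtain ⟨κ, hκ, hv⟩ := h.exists_pos_le_signal hΩs hγ hμ hu₀ htT
  exact h.isNeumannInv_motility_of_signal hΩs hγ ht htT hκ fun x hx =>
    hv x hx t (right_mem_Icc.2 ht.le)

/-- The differential inequality contained in the key identity. -/
theorem IsClassicalSolution.deriv_signal_le (hΩs : IsSmoothBoundedDomain Ω) (hγ : IsMotility γ)
    (hμ : 0 ≤ μ) (hu₀ : IsInitialDatum Ω u₀) (h : IsClassicalSolution Ω γ μ u₀ T u v) {t : ℝ}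
    (ht : 0 < t) (htT : (t : EReal) < T) {x : 𝔼} (hx : x ∈ Ω) :
    deriv (fun s => v x s) t ≤ neumannInv Ω (fun y => γ (v y t) * u y t + μ * u y t) x := by
  have hfin : volume Ω ≠ ⊤ := hΩs.isBounded.measure_lt_top.ne
  rw [(h.isNeumannInv_motility hΩs hγ hμ hu₀ ht htT).neumannInv_eqOn hΩs.isOpen hfin hx]
  have h1 : 0 ≤ γ (v x t) * u x t :=
    mul_nonneg (hγ.nonneg (h.signal_pos hΩs hγ hμ hu₀ ht.le htT hx).le)
      (h.nonneg hΩs hγ hμ hu₀ ht.le htT hx)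
  have h2 : 0 ≤ μ * neumannInv Ω (fun y => u y t ^ 2) x := mul_nonneg hμ
    ((h.isNeumannInv_sq hΩs ht.le htT).nonneg hΩs.isOpen hfin (fun y _ => sq_nonneg _) x hx)
  linarith

theorem IsClassicalSolution.continuousOn_signal (h : IsClassicalSolution Ω γ μ u₀ T u v) {b : ℝ}
    (hb : (b : EReal) < T) {x : 𝔼} (hx : x ∈ Ω) : ContinuousOn (fun t => v x t) (Icc 0 b) :=
  (h.continuousOn_v.mono (Icc_zero_subset hb (closure Ω))).comp
    (continuousOn_const.prodMk continuousOn_id) fun _ ht => ⟨subset_closure hx, ht⟩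

theorem IsClassicalSolution.signal_le_integral (hΩs : IsSmoothBoundedDomain Ω) (hγ : IsMotility γ)
    (hμ : 0 ≤ μ) (hu₀ : IsInitialDatum Ω u₀) (h : IsClassicalSolution Ω γ μ u₀ T u v) {t : ℝ}
    (ht : 0 ≤ t) (htT : (t : EReal) < T) {x : 𝔼} (hx : x ∈ Ω) :
    IntervalIntegrable
      (fun s => neumannInv Ω (fun y => γ (v y s) * u y s + μ * u y s) x) volume 0 t ∧
    v x t - v x 0
      ≤ ∫ s in (0 : ℝ)..t, neumannInv Ω (fun y => γ (v y s) * u y s + μ * u y s) x := by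
  obtain ⟨κ, hκ, hv⟩ := h.exists_pos_le_signal hΩs hγ hμ hu₀ htT
  have hcu := h.continuousOn_u.mono (Icc_zero_subset htT (closure Ω))
  have hcγ := h.continuousOn_motility hγ htT fun x hx s hs => hκ.le.trans (hv x hx s hs)
  have hc := (continuousOn_neumannInv hΩs.isOpen hΩs.isBounded
    (F := fun y s => γ (v y s) * u y s + μ * u y s)
    ((hcγ.mul hcu).add (continuousOn_const.mul hcu))).2 x hx
  refine ⟨hc.intervalIntegrable_of_Icc ht, ?_⟩
  refine intervalIntegral.sub_le_integral_of_hasDeriv_right_of_le ht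
    (h.continuousOn_signal htT hx) (g' := fun s => deriv (fun s => v x s) s)
    (fun s hs => ?_) (hc.integrableOn_Icc) fun s hs =>
      h.deriv_signal_le hΩs hγ hμ hu₀ hs.1 (coe_lt_of_le hs.2.le htT) hx
  exact (h.regular_v.differentiableAt x hx s hs.1
    (coe_lt_of_le hs.2.le htT)).hasDerivAt.hasDerivWithinAt

theorem IsClassicalSolution.signal_le_exp (hΩs : IsSmoothBoundedDomain Ω) (hγ : IsMotility γ)
    (hμ : 0 ≤ μ) (hu₀ : IsInitialDatum Ω u₀) (h : IsClassicalSolution Ω γ μ u₀ T u v) {vs : ℝ}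
    (hvs : 0 ≤ vs) (hle : ∀ x ∈ Ω, ∀ t : ℝ, 0 < t → (t : EReal) < T → vs ≤ v x t) {t : ℝ}
    (ht : 0 ≤ t) (htT : (t : EReal) < T) {x : 𝔼} (hx : x ∈ Ω) :
    v x t ≤ v x 0 * Real.exp ((γ vs + μ) * t) := by
  have hfin : volume Ω ≠ ⊤ := hΩs.isBounded.measure_lt_top.ne
  set K := γ vs + μ with hK
  have hder : ∀ s ∈ Ioo 0 t, deriv (fun s => v x s) s ≤ K * v x s := fun s hs => by
    have hsT := coe_lt_of_le hs.2.le htT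
    have hex := h.isNeumannInv_motility hΩs hγ hμ hu₀ hs.1 hsT
    have h1 := hex.isNeumannInv_neumannInv.mono hΩs.isOpen hfin
      ((h.isNeumannInv_of_pos hΩs hs.1 hsT).linear_comb hfin
        (h.isNeumannInv_of_pos hΩs hs.1 hsT) K 0) (fun y hy => by
        have h2 : γ (v y s) ≤ γ vs :=
          hγ.antitoneOn hvs (hvs.trans (hle y hy s hs.1 hsT)) (hle y hy s hs.1 hsT)
        have h3 := mul_le_mul_of_nonneg_right h2 (h.nonneg hΩs hγ hμ hu₀ hs.1.le hsT hy)
        rw [hK]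
        linarith) x hx
    have h4 := h.deriv_signal_le hΩs hγ hμ hu₀ hs.1 hsT hx
    linarith
  have hanti : AntitoneOn (fun s => Real.exp (-(K * s)) * v x s) (Icc 0 t) := by
    have hd : ∀ s ∈ Ioo 0 t, HasDerivAt (fun s => Real.exp (-(K * s)) * v x s)
        (Real.exp (-(K * s)) * (deriv (fun s => v x s) s - K * v x s)) s := fun s hs => by
      have h1 := (((hasDerivAt_id s).const_mul K).neg.exp).mul
        (h.regular_v.differentiableAt x hx s hs.1 (coe_lt_of_le hs.2.le htT)).hasDerivAt
      convert! h1 using 1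
      simp only [Pi.neg_apply, id_eq]
      ring
    refine antitoneOn_of_deriv_nonpos (convex_Icc 0 t)
      ((Continuous.continuousOn (by fun_prop)).mul (h.continuousOn_signal htT hx))
      (fun s hs => ?_) fun s hs => ?_
    · rw [interior_Icc] at hs
      exact (hd s hs).differentiableAt.differentiableWithinAt
    · rw [interior_Icc] at hs
      rw [(hd s hs).deriv]
      exact mul_nonpos_of_nonneg_of_nonpos (Real.exp_pos _).le (by linarith [hder s hs])
  have h1 := hanti (left_mem_Icc.2 ht) (right_mem_Icc.2 ht) ht
  simp only [mul_zero, neg_zero, Real.exp_zero, one_mul] at h1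
  rwa [Real.exp_neg, inv_mul_le_iff₀ (Real.exp_pos _), mul_comm] at h1

end Solution


theorem lemma3p2 (n : ℕ) (hn : 1 ≤ n) (Ω : Set (EuclideanSpace ℝ (Fin n)))
    (hΩ : IsSmoothBoundedDomain Ω) :
    -- `vlow m` is a positive lower bound for `v` in the case `μ = 0`; it depends only on `n`, `Ω`
    -- and the mass `m` of the initial datum
    ∃ vlow : ℝ → ℝ, (∀ m, 0 < m → 0 < vlow m) ∧
    ∀ (γ : ℝ → ℝ) (_ : IsMotility γ) (μ : ℝ) (_ : 0 ≤ μ)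
      (u₀ : EuclideanSpace ℝ (Fin n) → ℝ) (_ : IsInitialDatum Ω u₀)
      (T : EReal) (_ : 0 < T) (u v : EuclideanSpace ℝ (Fin n) → ℝ → ℝ)
      (_ : IsClassicalSolution Ω γ μ u₀ T u v),
      -- all the functions `(I - Δ)⁻¹[...]` below exist
      (IsNeumannInv Ω u₀ (neumannInv Ω u₀) ∧
        ∀ t : ℝ, 0 < t → (t : EReal) < T →
          IsNeumannInv Ω (fun y => u y t ^ 2) (neumannInv Ω (fun y => u y t ^ 2)) ∧
          IsNeumannInv Ω (fun y => γ (v y t) * u y t + μ * u y t)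
            (neumannInv Ω (fun y => γ (v y t) * u y t + μ * u y t))) ∧
      -- the key identity
      (∀ x ∈ Ω, ∀ t : ℝ, 0 < t → (t : EReal) < T →
        deriv (fun s => v x s) t + γ (v x t) * u x t + μ * neumannInv Ω (fun y => u y t ^ 2) x
          = neumannInv Ω (fun y => γ (v y t) * u y t + μ * u y t) x) ∧
      -- its integrated form
      (∀ x ∈ Ω, ∀ t : ℝ, 0 ≤ t → (t : EReal) < T →
        IntervalIntegrable
          (fun s => neumannInv Ω (fun y => γ (v y s) * u y s + μ * u y s) x) volume 0 t ∧
        v x t ≤ neumannInv Ω u₀ x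
          + ∫ s in (0 : ℝ)..t, neumannInv Ω (fun y => γ (v y s) * u y s + μ * u y s) x) ∧
      -- `0` is a lower bound for `v`, and so is `vlow` if `μ = 0`
      (∀ x ∈ Ω, ∀ t : ℝ, 0 ≤ t → (t : EReal) < T → 0 ≤ v x t) ∧
      (μ = 0 → ∀ x ∈ Ω, ∀ t : ℝ, 0 ≤ t → (t : EReal) < T → vlow (∫ y in Ω, u₀ y) ≤ v x t) ∧
      -- the pointwise upper bound, for every nonnegative lower bound `vs` of `v`
      (∀ vs : ℝ, 0 ≤ vs → (∀ x ∈ Ω, ∀ t : ℝ, 0 < t → (t : EReal) < T → vs ≤ v x t) →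
        ∀ x ∈ Ω, ∀ t : ℝ, 0 ≤ t → (t : EReal) < T →
          v x t ≤ neumannInv Ω u₀ x * Real.exp ((γ vs + μ) * t)) ∧
      -- no degeneracy of the diffusion in finite time
      (∀ τ : ℝ, ∃ δ : ℝ, 0 < δ ∧
        ∀ x ∈ Ω, ∀ t : ℝ, 0 ≤ t → (t : EReal) < T → t ≤ τ → δ ≤ γ (v x t)) := by
  have hΩo := hΩ.isOpen
  have hbd := hΩ.isBounded
  have hfin : volume Ω ≠ ⊤ := hbd.measure_lt_top.ne
  obtain ⟨c, hc, hcN⟩ := hΩ.exists_mass_le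
  refine ⟨fun m => c * m, fun m hm => mul_pos hc hm, ?_⟩
  intro γ hγ μ hμ u₀ hu₀ T hT u v h
  have hini := h.isNeumannInv_initial hΩ hT
  have hv0 := hini.neumannInv_eqOn hΩo hfin
  have hexp : ∀ vs : ℝ, 0 ≤ vs →
      (∀ x ∈ Ω, ∀ t : ℝ, 0 < t → (t : EReal) < T → vs ≤ v x t) →
      ∀ x ∈ Ω, ∀ t : ℝ, 0 ≤ t → (t : EReal) < T →
        v x t ≤ neumannInv Ω u₀ x * Real.exp ((γ vs + μ) * t) := by
    intro vs hvs hle x hx t ht htT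
    rw [hv0 hx]
    exact h.signal_le_exp hΩ hγ hμ hu₀ hvs hle ht htT hx
  refine ⟨⟨hini.isNeumannInv_neumannInv, fun t ht htT => ⟨h.isNeumannInv_sq hΩ ht.le htT,
    (h.isNeumannInv_motility hΩ hγ hμ hu₀ ht htT).isNeumannInv_neumannInv⟩⟩,
    fun x hx t ht htT => ((h.isNeumannInv_motility hΩ hγ hμ hu₀ ht htT).neumannInv_eqOn
      hΩo hfin hx).symm, fun x hx t ht htT => ?_,
    fun x hx t ht htT => (h.signal_pos hΩ hγ hμ hu₀ ht htT hx).le,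
    fun hμ0 x hx t ht htT => ?_, hexp, fun τ => ?_⟩
  · obtain ⟨h1, h2⟩ := h.signal_le_integral hΩ hγ hμ hu₀ ht htT hx
    refine ⟨h1, ?_⟩
    rw [hv0 hx]
    linarith
  · obtain ⟨M, hM0, hM⟩ := h.exists_bound hbd htT
    have h1 := h.le_signal hΩ hγ hμ hu₀ hc hcN htT hM0 (fun y hy s hs =>
      (le_abs_self _).trans (hM y (subset_closure hy) s hs).1) x hx t (right_mem_Icc.2 ht)
    -- without reaction the mass does not decay
    simpa [hμ0] using h1
  · obtain ⟨M, hM⟩ := hbd.isCompact_closure.exists_bound_of_continuousOn hu₀.continuousOn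
    set K := γ 0 + μ with hK
    have hK0 : 0 ≤ K := add_nonneg hγ.zero_pos.le hμ
    set B := |M| * Real.exp (K * max τ 0) + 1 with hB
    have hB0 : 0 < B := by positivity
    refine ⟨γ B, hγ.pos B hB0, fun x hx t ht htT htτ => ?_⟩
    have hvpos := h.signal_pos hΩ hγ hμ hu₀ ht htT hx
    refine hγ.antitoneOn hvpos.le hB0.le ?_
    have h1 := hexp 0 le_rfl (fun y hy s hs hsT =>
      (h.signal_pos hΩ hγ hμ hu₀ hs.le hsT hy).le) x hx t ht htT
    have h2 : neumannInv Ω u₀ x ≤ |M| := (le_abs_self _).trans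
      (hini.isNeumannInv_neumannInv.abs_le hΩo hfin
        (fun y hy => (hM y (subset_closure hy)).trans (le_abs_self M)) x hx)
    have h3 : Real.exp (K * t) ≤ Real.exp (K * max τ 0) :=
      Real.exp_le_exp.2 (mul_le_mul_of_nonneg_left (htτ.trans (le_max_left _ _)) hK0)
    have h4 := mul_le_mul h2 h3 (Real.exp_pos _).le (abs_nonneg M)
    linarith
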